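/- Let $k$ be a field, $H$ a Hopf algebra over $k$, $P$ a right $H$-comodule algebra with coaction $\Delta_R(p)=p_{(0)}\otimes p_{(1)}$, and $B=P^{co H}=\{b\in P:\Delta_R(b)=b\otimes 1\}$. Assume that $B\subseteq P$ is a Hopf–Galois extension, i.e. the map $\mathrm{can}:P\otimes_B P\to P\otimes H$, $p\otimes_B q\mapsto pq_{(0)}\otimes q_{(1)}$, is bijective, and that $P$ is a faithfully flat left $B$-module. Let $\tau:H\to P\otimes_B P$, $\tau(h)=\mathrm{can}^{-1}(1\otimes h)=:\tau^1(h)\otimes_B\tau^2(h)$, be the translation map. Let $$\mathcal L=\mathcal L(P,H)=(P\otimes P)^{co H}=\{\textstyle\sum p\otimes q:\ \sum p_{(0)}\otimes q_{(0)}\otimes p_{(1)}q_{(1)}=\sum p\otimes q\otimes 1\},$$ a subalgebra of $P\otimes P^{op}$ (so $(p\otimes q)(r\otimes u)=pr\otimes uq$), with the commuting source and target maps $s(b)=b\otimes 1$, $t(b)=1\otimes b$ for $b\in B$. Let $\mathcal L\otimes_B\mathcal L$ be the tensor product with relations $t(b)X\otimes Y=X\otimes s(b)Y$ and $\mathcal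 L\otimes_{B^{op}}\mathcal L$ the one with relations $Xt(b)\otimes Y=X\otimes t(b)Y$; define $(P\otimes P)\otimes_B(P\otimes P)$ and $(P\otimes P)\otimes_{B^{op}}(P\otimes P)$ in the same way. Then: 1. The canonical maps $\mathcal L\otimes_B\mathcal L\to(P\otimes P)\otimes_B(P\otimes P)$ and $\mathcal L\otimes_{B^{op}}\mathcal L\to(P\otimes P)\otimes_{B^{op}}(P\otimes P)$ are injective. 2. $\mathcal L$, with these source and target maps, is a left $B$-bialgebroid (the Ehresmann–Schauenburg bialgebroid) with coproduct and counit $$\Delta(p\otimes q)=(p_{(0)}\otimes\tau^1(p_{(1)}))\otimes_B(\tau^2(p_{(1)})\otimes q),\qquad \epsilon(p\otimes q)=pq,$$ where the first formula is read in $(P\otimes P)\otimes_B(P\otimes P)$ through the injection of part 1. 3. This left bialgebroid is a left Hopf algebroid: the map $$\lambda:\mathcal L\otimes_{B^{op}}\mathcal L\to\mathcal L\otimes_B\mathcal L,\qquad \lambda(X\otimes_{B^{op}}Y)=X_{(1)}\otimes_B X_{(2)}Y,$$ where $\Delta(X)=X_{(1)}\otimes_B X_{(2)}$, is bijective. For $X=\sum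 p\otimes q$ and $Y$ in $\mathcal L$, its inverse is $$\lambda^{-1}(X\otimes_B Y)=\sum\,(p\otimes\tau^2(q_{(1)}))\otimes_{B^{op}}(q_{(0)}\otimes\tau^1(q_{(1)}))\,Y,$$ read in $(P\otimes P)\otimes_{B^{op}}(P\otimes P)$ through the injection of part 1. -/

import Mathlib

open scoped TensorProduct
open MulOpposite

universe u v w

/-! ### Balanced tensor products

All tensor products over a (noncommutative) algebra `B` are formed as quotients of the tensor
product over the ground ring `k`. The two actions of `B` are given as families of `k`-linear
endomorphisms: `ρ b` is the (right) action of `b` on the left factor and `σ b` the (left) action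
of `b` on the right factor. -/

section Balanced

variable {k : Type*} [CommRing k] {ι : Type*} {M N Q : Type*}
  [AddCommGroup M] [Module k M] [AddCommGroup N] [Module k N] [AddCommGroup Q] [Module k Q]

/-- The relations `ρ b m ⊗ n = m ⊗ σ b n`. -/
def balancedRel (ρ : ι → M →ₗ[k] M) (σ : ι → N →ₗ[k] N) : Submodule k (M ⊗[k] N) :=
  Submodule.span k {z | ∃ (b : ι) (m : M) (n : N), z = ρ b m ⊗ₜ[k] n - m ⊗ₜ[k] σ b n}

/-- The balanced tensor product: `M ⊗[k] N` modulo `ρ b m ⊗ n = m ⊗ σ b n`. -/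
abbrev BalTensor (ρ : ι → M →ₗ[k] M) (σ : ι → N →ₗ[k] N) : Type _ :=
  (M ⊗[k] N) ⧸ balancedRel ρ σ

namespace BalTensor

/-- The quotient map from the tensor product over `k` to the balanced tensor product. -/
abbrev proj (ρ : ι → M →ₗ[k] M) (σ : ι → N →ₗ[k] N) : M ⊗[k] N →ₗ[k] BalTensor ρ σ :=
  (balancedRel ρ σ).mkQ

theorem proj_balanced (ρ : ι → M →ₗ[k] M) (σ : ι → N →ₗ[k] N) (b : ι) (m : M) (n : N) :
    proj ρ σ (ρ b m ⊗ₜ[k] n) = proj ρ σ (m ⊗ₜ[k] σ b n) := by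
  rw [← sub_eq_zero, ← map_sub]
  exact (Submodule.Quotient.mk_eq_zero _).2 (Submodule.subset_span ⟨b, m, n, rfl⟩)

/-- A linear map on `M ⊗[k] N` that is balanced descends to the balanced tensor product. -/
def lift {ρ : ι → M →ₗ[k] M} {σ : ι → N →ₗ[k] N} (f : M ⊗[k] N →ₗ[k] Q)
    (hf : ∀ b m n, f (ρ b m ⊗ₜ[k] n) = f (m ⊗ₜ[k] σ b n)) : BalTensor ρ σ →ₗ[k] Q :=
  (balancedRel ρ σ).liftQ f (by
    refine Submodule.span_le.2 ?_
    rintro _ ⟨b, m, n, rfl⟩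
    simp [hf])

@[simp] theorem lift_proj {ρ : ι → M →ₗ[k] M} {σ : ι → N →ₗ[k] N} (f : M ⊗[k] N →ₗ[k] Q)
    (hf : ∀ b m n, f (ρ b m ⊗ₜ[k] n) = f (m ⊗ₜ[k] σ b n)) (z : M ⊗[k] N) :
    lift f hf (proj ρ σ z) = f z :=
  rfl

theorem hom_ext {ρ : ι → M →ₗ[k] M} {σ : ι → N →ₗ[k] N} {f g : BalTensor ρ σ →ₗ[k] Q}
    (h : ∀ m n, f (proj ρ σ (m ⊗ₜ[k] n)) = g (proj ρ σ (m ⊗ₜ[k] n))) : f = g :=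
  Submodule.linearMap_qext _ (TensorProduct.ext' h)

end BalTensor

end Balanced

/-! ### Faithful flatness over a noncommutative algebra -/

section FaithfullyFlat

variable (k : Type*) [CommRing k] (B : Type*) [Ring B] [Algebra k B]

/-- `M ⊗_B N` for a right `B`-module `M` (a module over `Bᵐᵒᵖ`) and a left `B`-module `N`. -/
abbrev ModTensor (M N : Type*) [AddCommGroup M] [Module k M] [Module Bᵐᵒᵖ M]
    [IsScalarTower k Bᵐᵒᵖ M] [AddCommGroup N] [Module k N] [Module B N] [IsScalarTower k B N] :
    Type _ :=
  BalTensor (k := k) (fun b : B => Algebra.lsmul k k M (op b)) (fun b : B => Algebra.lsmul k k N b)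

/-- The map `f ⊗_B id : M ⊗_B N → M' ⊗_B N` for a map `f` of right `B`-modules. -/
def modTensorMap {M M' : Type*} (N : Type*) [AddCommGroup M] [Module k M] [Module Bᵐᵒᵖ M]
    [IsScalarTower k Bᵐᵒᵖ M] [AddCommGroup M'] [Module k M'] [Module Bᵐᵒᵖ M']
    [IsScalarTower k Bᵐᵒᵖ M'] [AddCommGroup N] [Module k N] [Module B N] [IsScalarTower k B N]
    (f : M →ₗ[Bᵐᵒᵖ] M') : ModTensor k B M N →ₗ[k] ModTensor k B M' N :=
  BalTensor.lift (BalTensor.proj _ _ ∘ₗ (f.restrictScalars k).rTensor N) (by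
    intro b m n
    have h := BalTensor.proj_balanced (k := k) (fun b : B => Algebra.lsmul k k M' (op b))
      (fun b : B => Algebra.lsmul k k N b) b (f m) n
    simpa using h)

/-- A left `B`-module `N` is faithfully flat: the functor `- ⊗_B N` on right `B`-modules preserves
and reflects exact sequences. -/
def IsFaithfullyFlatLeft (N : Type*) [AddCommGroup N] [Module k N] [Module B N]
    [IsScalarTower k B N] : Prop :=
  ∀ (M₁ M₂ M₃ : Type v) [AddCommGroup M₁] [AddCommGroup M₂] [AddCommGroup M₃]
    [Module k M₁] [Module k M₂] [Module k M₃]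
    [Module Bᵐᵒᵖ M₁] [Module Bᵐᵒᵖ M₂] [Module Bᵐᵒᵖ M₃]
    [IsScalarTower k Bᵐᵒᵖ M₁] [IsScalarTower k Bᵐᵒᵖ M₂] [IsScalarTower k Bᵐᵒᵖ M₃]
    (f : M₁ →ₗ[Bᵐᵒᵖ] M₂) (g : M₂ →ₗ[Bᵐᵒᵖ] M₃),
    Function.Exact f g ↔ Function.Exact (modTensorMap k B N f) (modTensorMap k B N g)

end FaithfullyFlat

/-! ### Left bialgebroids and left Hopf algebroids -/

/-- Commuting source and target maps `s : B → L`, `t : Bᵒᵖ → L`; equivalently a ring over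
`B ⊗ Bᵒᵖ`. -/
structure BeRing (k B L : Type*) [CommRing k] [Ring B] [Algebra k B] [Ring L] [Algebra k L] where
  s : B →ₐ[k] L
  t : Bᵐᵒᵖ →ₐ[k] L
  comm : ∀ (b : B) (c : Bᵐᵒᵖ), s b * t c = t c * s b

namespace BeRing

variable {k B L : Type*} [CommRing k] [Ring B] [Algebra k B] [Ring L] [Algebra k L]
  (E : BeRing k B L)

/-- `L ⊗_B L` for the bimodule structure `b.X.c = s(b) t(c) X`:
the relations are `t(b) X ⊗ Y = X ⊗ s(b) Y`. -/
abbrev Tens : Type _ :=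
  BalTensor (k := k) (fun b : B => LinearMap.mulLeft k (E.t (op b)))
    (fun b : B => LinearMap.mulLeft k (E.s b))

/-- `L ⊗_{Bᵒᵖ} L`: the relations are `X t(b) ⊗ Y = X ⊗ t(b) Y`. -/
abbrev TensOp : Type _ :=
  BalTensor (k := k) (fun b : B => LinearMap.mulRight k (E.t (op b)))
    (fun b : B => LinearMap.mulLeft k (E.t (op b)))

/-- The class `X ⊗_B Y`. -/
def tmul (X Y : L) : E.Tens := BalTensor.proj _ _ (X ⊗ₜ[k] Y)

/-- The class `X ⊗_{Bᵒᵖ} Y`. -/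
def tmulOp (X Y : L) : E.TensOp := BalTensor.proj _ _ (X ⊗ₜ[k] Y)

theorem tmul_balanced (b : B) (X Y : L) : E.tmul (E.t (op b) * X) Y = E.tmul X (E.s b * Y) :=
  BalTensor.proj_balanced (k := k) (fun b : B => LinearMap.mulLeft k (E.t (op b)))
    (fun b : B => LinearMap.mulLeft k (E.s b)) b X Y

theorem tmulOp_balanced (b : B) (X Y : L) :
    E.tmulOp (X * E.t (op b)) Y = E.tmulOp X (E.t (op b) * Y) :=
  BalTensor.proj_balanced (k := k) (fun b : B => LinearMap.mulRight k (E.t (op b)))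
    (fun b : B => LinearMap.mulLeft k (E.t (op b))) b X Y

/-- The left action of `B` on `L ⊗_B L`: `b.(X ⊗ Y) = s(b) X ⊗ Y`. -/
def leftAct (b : B) : E.Tens →ₗ[k] E.Tens :=
  BalTensor.lift (BalTensor.proj _ _ ∘ₗ (LinearMap.mulLeft k (E.s b)).rTensor L) (by
    intro c X Y
    have h := E.tmul_balanced c (E.s b * X) Y
    rw [← mul_assoc, ← E.comm, mul_assoc] at h
    exact h)

/-- The right action of `B` on `L ⊗_B L`: `(X ⊗ Y).b = X ⊗ t(b) Y`. -/
def rightAct (b : B) : E.Tens →ₗ[k] E.Tens :=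
  BalTensor.lift (BalTensor.proj _ _ ∘ₗ (LinearMap.mulLeft k (E.t (op b))).lTensor L) (by
    intro c X Y
    have h := E.tmul_balanced c X (E.t (op b) * Y)
    rw [← mul_assoc, E.comm, mul_assoc] at h
    exact h)

/-- `L ⊗_B L` is a right module over the algebra `L ⊗[k] L`:
`(X ⊗_B Y)(X' ⊗ Y') = X X' ⊗_B Y Y'`. -/
def mulAct : E.Tens →ₗ[k] (L ⊗[k] L) →ₗ[k] E.Tens :=
  BalTensor.lift ((LinearMap.mul k (L ⊗[k] L)).compr₂ (BalTensor.proj _ _)) (by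
    intro c X Y
    refine TensorProduct.ext' fun X' Y' => ?_
    have h := E.tmul_balanced c (X * X') (Y * Y')
    rw [← mul_assoc, ← mul_assoc] at h
    simpa [tmul] using h)

theorem mulAct_proj (u v : L ⊗[k] L) :
    E.mulAct (BalTensor.proj _ _ u) v = BalTensor.proj _ _ (u * v) :=
  rfl

theorem mulAct_tmul (X Y X' Y' : L) :
    E.mulAct (E.tmul X Y) (X' ⊗ₜ[k] Y') = E.tmul (X * X') (Y * Y') := by
  rw [tmul, mulAct_proj, Algebra.TensorProduct.tmul_mul_tmul, tmul]

theorem mulAct_mul (U : E.Tens) (v v' : L ⊗[k] L) :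
    E.mulAct U (v * v') = E.mulAct (E.mulAct U v) v' := by
  obtain ⟨u, rfl⟩ := Submodule.mkQ_surjective _ U
  change BalTensor.proj _ _ (u * (v * v')) = BalTensor.proj _ _ (u * v * v')
  rw [mul_assoc]

/-- Right multiplication on the second factor of `L ⊗_{Bᵒᵖ} L`: `(X ⊗ Z) ↦ X ⊗ Z Y`. -/
def rmulOp (Y : L) : E.TensOp →ₗ[k] E.TensOp :=
  BalTensor.lift (BalTensor.proj _ _ ∘ₗ (LinearMap.mulRight k Y).lTensor L) (by
    intro b X Z
    have h := E.tmulOp_balanced b X (Z * Y)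
    rw [← mul_assoc] at h
    exact h)

theorem rmulOp_tmulOp (X Y Z : L) : E.rmulOp Y (E.tmulOp X Z) = E.tmulOp X (Z * Y) :=
  rfl

/-- The Takeuchi product `L ×_B L ⊆ L ⊗_B L` of those `∑ Xᵢ ⊗ Yᵢ` with
`∑ Xᵢ t(b) ⊗ Yᵢ = ∑ Xᵢ ⊗ Yᵢ s(b)` for all `b`. -/
def takeuchi : Submodule k E.Tens where
  carrier := {U | ∀ b : B,
    E.mulAct U (E.t (op b) ⊗ₜ[k] (1 : L)) = E.mulAct U ((1 : L) ⊗ₜ[k] E.s b)}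
  add_mem' := by
    intro U V hU hV b
    simp only [map_add, LinearMap.add_apply, hU b, hV b]
  zero_mem' := by
    intro b
    simp
  smul_mem' := by
    intro c U hU b
    simp only [map_smul, LinearMap.smul_apply, hU b]

/-- Factorwise multiplication `(X ⊗ Y)(X' ⊗ Y') = X X' ⊗ Y Y'` on `L ⊗_B L`,
well defined when the left factor lies in the Takeuchi product. -/
def takeuchiMul (U : E.takeuchi) : E.Tens →ₗ[k] E.Tens :=
  BalTensor.lift (E.mulAct (U : E.Tens)) (by
    intro b X Y
    have h1 : (E.t (op b) * X) ⊗ₜ[k] Y = (E.t (op b) ⊗ₜ[k] (1 : L)) * (X ⊗ₜ[k] Y) := by simp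
    have h2 : X ⊗ₜ[k] (E.s b * Y) = ((1 : L) ⊗ₜ[k] E.s b) * (X ⊗ₜ[k] Y) := by simp
    change E.mulAct _ ((E.t (op b) * X) ⊗ₜ[k] Y) = E.mulAct _ (X ⊗ₜ[k] (E.s b * Y))
    rw [h1, h2, mulAct_mul, mulAct_mul, U.2 b])

/-- `(L ⊗_B L) ⊗_B L`. -/
abbrev TensL : Type _ :=
  BalTensor (k := k) (fun b : B => E.rightAct b) (fun b : B => LinearMap.mulLeft k (E.s b))

/-- `L ⊗_B (L ⊗_B L)`. -/
abbrev TensR : Type _ :=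
  BalTensor (k := k) (fun b : B => LinearMap.mulLeft k (E.t (op b))) (fun b : B => E.leftAct b)

/-- The map `(X ⊗ Y) ↦ (Z ↦ X ⊗_B (Y ⊗_B Z))`. -/
def preAssoc : L ⊗[k] L →ₗ[k] L →ₗ[k] E.TensR :=
  TensorProduct.curry ((BalTensor.proj _ _ : L ⊗[k] E.Tens →ₗ[k] E.TensR) ∘ₗ
    (BalTensor.proj _ _ : L ⊗[k] L →ₗ[k] E.Tens).lTensor L ∘ₗ
    (TensorProduct.assoc k L L L).toLinearMap)

theorem preAssoc_tmul (X Y Z : L) :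
    E.preAssoc (X ⊗ₜ[k] Y) Z = BalTensor.proj _ _ (X ⊗ₜ[k] E.tmul Y Z) :=
  rfl

/-- The map `X ⊗_B Y ↦ (Z ↦ X ⊗_B (Y ⊗_B Z))`. -/
def midAssoc : E.Tens →ₗ[k] L →ₗ[k] E.TensR :=
  BalTensor.lift E.preAssoc (by
    intro b X Y
    refine LinearMap.ext fun Z => ?_
    rw [preAssoc_tmul, preAssoc_tmul]
    exact BalTensor.proj_balanced (k := k) (fun b : B => LinearMap.mulLeft k (E.t (op b)))
      (fun b : B => E.leftAct b) b X (E.tmul Y Z))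

theorem midAssoc_tmul (X Y Z : L) :
    E.midAssoc (E.tmul X Y) Z = BalTensor.proj _ _ (X ⊗ₜ[k] E.tmul Y Z) :=
  rfl

theorem midAssoc_balanced (b : B) (Z : L) :
    E.midAssoc.flip Z ∘ₗ E.rightAct b = E.midAssoc.flip (E.s b * Z) := by
  refine BalTensor.hom_ext fun X Y => ?_
  change E.midAssoc (E.tmul X (E.t (op b) * Y)) Z = E.midAssoc (E.tmul X Y) (E.s b * Z)
  rw [midAssoc_tmul, midAssoc_tmul, tmul_balanced]

/-- The associator `(L ⊗_B L) ⊗_B L → L ⊗_B (L ⊗_B L)`, `(X ⊗ Y) ⊗ Z ↦ X ⊗ (Y ⊗ Z)`. -/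
def assoc : E.TensL →ₗ[k] E.TensR :=
  BalTensor.lift (TensorProduct.lift E.midAssoc) (by
    intro b U Z
    exact LinearMap.congr_fun (E.midAssoc_balanced b Z) U)

theorem assoc_tmul (X Y Z : L) :
    E.assoc (BalTensor.proj _ _ (E.tmul X Y ⊗ₜ[k] Z)) =
      BalTensor.proj _ _ (X ⊗ₜ[k] E.tmul Y Z) :=
  rfl

/-- `Δ ⊗_B id` for a right `B`-linear `Δ`. -/
def comulLeft (Δ : L →ₗ[k] E.Tens) (hΔ : ∀ b X, Δ (E.t (op b) * X) = E.rightAct b (Δ X)) :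
    E.Tens →ₗ[k] E.TensL :=
  BalTensor.lift (BalTensor.proj _ _ ∘ₗ Δ.rTensor L) (by
    intro b X Y
    have h := BalTensor.proj_balanced (k := k) (fun b : B => E.rightAct b)
      (fun b : B => LinearMap.mulLeft k (E.s b)) b (Δ X) Y
    simp only [← hΔ] at h
    exact h)

/-- `id ⊗_B Δ` for a left `B`-linear `Δ`. -/
def comulRight (Δ : L →ₗ[k] E.Tens) (hΔ : ∀ b X, Δ (E.s b * X) = E.leftAct b (Δ X)) :
    E.Tens →ₗ[k] E.TensR :=
  BalTensor.lift (BalTensor.proj _ _ ∘ₗ Δ.lTensor L) (by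
    intro b X Y
    have h := BalTensor.proj_balanced (k := k) (fun b : B => LinearMap.mulLeft k (E.t (op b)))
      (fun b : B => E.leftAct b) b X (Δ Y)
    simp only [← hΔ] at h
    exact h)

/-- `ε ⊗_B id : L ⊗_B L → B ⊗_B L = L`, `X ⊗ Y ↦ s(ε(X)) Y`, for a right `B`-linear `ε`. -/
def counitLeft (ε : L →ₗ[k] B) (hε : ∀ b X, ε (E.t (op b) * X) = ε X * b) :
    E.Tens →ₗ[k] L :=
  BalTensor.lift (TensorProduct.lift (LinearMap.mul k L ∘ₗ E.s.toLinearMap ∘ₗ ε)) (by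
    intro b X Y
    simp [hε, mul_assoc])

/-- `id ⊗_B ε : L ⊗_B L → L ⊗_B B = L`, `X ⊗ Y ↦ t(ε(Y)) X`, for a left `B`-linear `ε`. -/
def counitRight (ε : L →ₗ[k] B) (hε : ∀ b X, ε (E.s b * X) = b * ε X) :
    E.Tens →ₗ[k] L :=
  BalTensor.lift (TensorProduct.lift
    (LinearMap.mul k L ∘ₗ E.t.toLinearMap ∘ₗ (opLinearEquiv k).toLinearMap ∘ₗ ε).flip) (by
    intro b X Y
    simp [hε, mul_assoc])

end BeRing

/-- A left `B`-bialgebroid structure on a ring `L` with given source and target maps. -/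
structure LeftBialgebroid {k B L : Type*} [CommRing k] [Ring B] [Algebra k B] [Ring L]
    [Algebra k L] (E : BeRing k B L) where
  /-- The coproduct, a map of `B`-bimodules. -/
  comul : L →ₗ[k] E.Tens
  comul_s : ∀ b X, comul (E.s b * X) = E.leftAct b (comul X)
  comul_t : ∀ b X, comul (E.t (op b) * X) = E.rightAct b (comul X)
  /-- The counit, a map of `B`-bimodules. -/
  counit : L →ₗ[k] B
  counit_s : ∀ b X, counit (E.s b * X) = b * counit X
  counit_t : ∀ b X, counit (E.t (op b) * X) = counit X * b
  coassoc : ∀ X, E.assoc (E.comulLeft comul comul_t (comul X)) =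
    E.comulRight comul comul_s (comul X)
  counit_comul : ∀ X, E.counitLeft counit counit_t (comul X) = X
  comul_counit : ∀ X, E.counitRight counit counit_s (comul X) = X
  /-- The coproduct corestricts to an algebra map into the Takeuchi product. -/
  comul_mem : ∀ X, comul X ∈ E.takeuchi
  comul_one : comul 1 = E.tmul 1 1
  comul_mul : ∀ X Y, comul (X * Y) = E.takeuchiMul ⟨comul X, comul_mem X⟩ (comul Y)
  /-- The counit is a left character. -/
  counit_one : counit 1 = 1
  counit_mul_s : ∀ X Y, counit (X * E.s (counit Y)) = counit (X * Y)
  counit_mul_t : ∀ X Y, counit (X * E.t (op (counit Y))) = counit (X * Y)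

namespace LeftBialgebroid

variable {k B L : Type*} [CommRing k] [Ring B] [Algebra k B] [Ring L] [Algebra k L]
  {E : BeRing k B L} (𝓛 : LeftBialgebroid E)

theorem comul_target (b : B) : 𝓛.comul (E.t (op b)) = E.tmul 1 (E.t (op b)) := by
  have h := 𝓛.comul_t b 1
  rw [mul_one, 𝓛.comul_one] at h
  rw [h]
  change E.tmul 1 (E.t (op b) * 1) = _
  rw [mul_one]

theorem comul_mul_target (X : L) (b : B) :
    𝓛.comul (X * E.t (op b)) = E.mulAct (𝓛.comul X) ((1 : L) ⊗ₜ[k] E.t (op b)) := by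
  rw [𝓛.comul_mul, comul_target]
  rfl

/-- The map `λ : L ⊗_{Bᵒᵖ} L → L ⊗_B L`, `λ(X ⊗ Y) = X₍₁₎ ⊗ X₍₂₎ Y`. -/
def galoisMap : E.TensOp →ₗ[k] E.Tens :=
  BalTensor.lift (TensorProduct.lift
      ((LinearMap.lcomp k E.Tens (TensorProduct.mk k L L 1)) ∘ₗ E.mulAct ∘ₗ 𝓛.comul)) (by
    intro b X Y
    change E.mulAct (𝓛.comul (X * E.t (op b))) ((1 : L) ⊗ₜ[k] Y) =
      E.mulAct (𝓛.comul X) ((1 : L) ⊗ₜ[k] (E.t (op b) * Y))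
    rw [comul_mul_target, ← BeRing.mulAct_mul]
    simp)

theorem galoisMap_tmulOp (X Y : L) :
    𝓛.galoisMap (E.tmulOp X Y) = E.mulAct (𝓛.comul X) ((1 : L) ⊗ₜ[k] Y) :=
  rfl

/-- A left bialgebroid is a left Hopf algebroid if `λ` is invertible. -/
def IsLeftHopf : Prop := Function.Bijective 𝓛.galoisMap

/-- The inverse of `λ` on a left Hopf algebroid. -/
noncomputable def galoisInv (h : 𝓛.IsLeftHopf) : E.Tens →ₗ[k] E.TensOp :=
  (LinearEquiv.ofBijective 𝓛.galoisMap h).symm.toLinearMap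

end LeftBialgebroid

/-! ### The algebra `P ⊗ Pᵒᵖ` -/

section Pair

/-- The algebra `P ⊗ Pᵒᵖ`: the vector space `P ⊗ P` with product
`(p ⊗ q)(r ⊗ u) = p r ⊗ u q`. -/
def Pair (k : Type u) (P : Type w) [Field k] [Ring P] [Algebra k P] : Type w :=
  P ⊗[k] Pᵐᵒᵖ

variable {k : Type u} {P : Type w} [Field k] [Ring P] [Algebra k P]

noncomputable instance Pair.instRing : Ring (Pair k P) :=
  inferInstanceAs (Ring (P ⊗[k] Pᵐᵒᵖ))

noncomputable instance Pair.instAlgebra : Algebra k (Pair k P) :=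
  inferInstanceAs (Algebra k (P ⊗[k] Pᵐᵒᵖ))

namespace Pair

/-- `Pair k P` is `P ⊗ Pᵒᵖ` as an algebra. -/
noncomputable def equiv (k : Type u) (P : Type w) [Field k] [Ring P] [Algebra k P] :
    P ⊗[k] Pᵐᵒᵖ ≃ₐ[k] Pair k P :=
  AlgEquiv.refl

/-- The linear map `P ⊗ P → Pair k P` that is the identity on underlying spaces. -/
noncomputable def ofTensor (k : Type u) (P : Type w) [Field k] [Ring P] [Algebra k P] :
    P ⊗[k] P ≃ₗ[k] Pair k P :=
  (TensorProduct.congr (LinearEquiv.refl k P) (opLinearEquiv k)).trans (equiv k P).toLinearEquiv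

/-- The element `p ⊗ q` of `P ⊗ P`. -/
noncomputable def tmul (k : Type u) {P : Type w} [Field k] [Ring P] [Algebra k P] (p q : P) :
    Pair k P :=
  ofTensor k P (p ⊗ₜ[k] q)

theorem equiv_tmul (p q : P) : equiv k P (p ⊗ₜ[k] op q) = tmul k p q := rfl

theorem tmul_mul_tmul (p q r u : P) : tmul k p q * tmul k r u = tmul k (p * r) (u * q) := by
  rw [← equiv_tmul, ← equiv_tmul, ← map_mul, Algebra.TensorProduct.tmul_mul_tmul, ← op_mul,
    equiv_tmul]

theorem one_def : (1 : Pair k P) = tmul k 1 1 := rfl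

theorem add_tmul (p p' q : P) : tmul k (p + p') q = tmul k p q + tmul k p' q := by
  simp [tmul, TensorProduct.add_tmul]

theorem tmul_add (p q q' : P) : tmul k p (q + q') = tmul k p q + tmul k p q' := by
  simp [tmul, TensorProduct.tmul_add]

theorem smul_tmul (c : k) (p q : P) : tmul k (c • p) q = c • tmul k p q := by
  rw [tmul, ← TensorProduct.smul_tmul', map_smul, tmul]

theorem tmul_smul (c : k) (p q : P) : tmul k p (c • q) = c • tmul k p q := by
  simp [tmul]

theorem induction {motive : Pair k P → Prop} (zero : motive 0)
    (tmul : ∀ p q, motive (tmul k p q)) (add : ∀ X Y, motive X → motive Y → motive (X + Y))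
    (X : Pair k P) : motive X := by
  obtain ⟨z, rfl⟩ := (ofTensor k P).surjective X
  induction z using TensorProduct.induction_on with
  | zero => simpa using zero
  | tmul p q => exact tmul p q
  | add x y hx hy => simpa using add _ _ hx hy

/-- The linear map out of `P ⊗ P` given by a bilinear map. -/
noncomputable def lift {Q : Type*} [AddCommGroup Q] [Module k Q] (f : P →ₗ[k] P →ₗ[k] Q) :
    Pair k P →ₗ[k] Q :=
  TensorProduct.lift f ∘ₗ (ofTensor k P).symm.toLinearMap

@[simp] theorem lift_tmul {Q : Type*} [AddCommGroup Q] [Module k Q] (f : P →ₗ[k] P →ₗ[k] Q)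
    (p q : P) : lift f (tmul k p q) = f p q := by
  simp [lift, tmul]

end Pair

end Pair

/-! ### Hopf-Galois extensions -/

/-- A right `H`-comodule algebra structure on the algebra `P`: a coassociative and counital
coaction `P → P ⊗ H` that is an algebra map. -/
structure RightComoduleAlgebra (k : Type u) (H : Type v) (P : Type w) [Field k] [Ring H]
    [HopfAlgebra k H] [Ring P] [Algebra k P] where
  coact : P →ₐ[k] P ⊗[k] H
  coassoc : ∀ p, TensorProduct.assoc k P H H (coact.toLinearMap.rTensor H (coact p)) =
    (Coalgebra.comul (R := k) (A := H)).lTensor P (coact p)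
  counit : ∀ p, TensorProduct.rid k P ((Coalgebra.counit (R := k) (A := H)).lTensor P (coact p)) = p

namespace RightComoduleAlgebra

variable {k : Type u} {H : Type v} {P : Type w} [Field k] [Ring H] [HopfAlgebra k H] [Ring P]
  [Algebra k P] (δ : RightComoduleAlgebra k H P)

/-- The coinvariant subalgebra `B = {b | δ(b) = b ⊗ 1}`. -/
def coinv : Subalgebra k P := AlgHom.equalizer δ.coact Algebra.TensorProduct.includeLeft

theorem coact_coinv (b : δ.coinv) : δ.coact (b : P) = (b : P) ⊗ₜ[k] (1 : H) := b.2

/-- `P ⊗_B P`, with relations `p b ⊗ q = p ⊗ b q`. -/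
abbrev PBP : Type _ :=
  BalTensor (k := k) (fun b : δ.coinv => LinearMap.mulRight k (b : P))
    (fun b : δ.coinv => LinearMap.mulLeft k (b : P))

/-- The canonical map `P ⊗_B P → P ⊗ H`, `p ⊗ q ↦ p q₍₀₎ ⊗ q₍₁₎`. -/
noncomputable def can : δ.PBP →ₗ[k] P ⊗[k] H :=
  BalTensor.lift (TensorProduct.lift
    ((LinearMap.mul k (P ⊗[k] H)).compl₁₂
      (Algebra.TensorProduct.includeLeft : P →ₐ[k] P ⊗[k] H).toLinearMap δ.coact.toLinearMap)) (by
    intro b p q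
    simp [δ.coact_coinv, ← mul_assoc])

theorem can_proj (p q : P) :
    δ.can (BalTensor.proj _ _ (p ⊗ₜ[k] q)) = (p ⊗ₜ[k] (1 : H)) * δ.coact q :=
  rfl

/-- `B ⊆ P` is a Hopf-Galois extension: the canonical map is bijective. -/
def IsHopfGalois : Prop := Function.Bijective δ.can

/-- The translation map `τ : H → P ⊗_B P`, `τ(h) = can⁻¹(1 ⊗ h)`. -/
noncomputable def translation (hG : δ.IsHopfGalois) : H →ₗ[k] δ.PBP :=
  (LinearEquiv.ofBijective δ.can hG).symm.toLinearMap ∘ₗ TensorProduct.mk k P H 1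

/-- The map `(p ⊗ h) ⊗ (q ⊗ g) ↦ (p ⊗ q) ⊗ h g`. -/
noncomputable def diagMerge (k : Type u) (H : Type v) (P : Type w) [Field k] [Ring H] [Algebra k H]
    [Ring P] [Algebra k P] : (P ⊗[k] H) ⊗[k] (P ⊗[k] H) →ₗ[k] Pair k P ⊗[k] H :=
  TensorProduct.map (Pair.ofTensor k P).toLinearMap (LinearMap.mul' k H) ∘ₗ
    (TensorProduct.tensorTensorTensorComm k P H P H).toLinearMap

/-- The diagonal coaction `p ⊗ q ↦ p₍₀₎ ⊗ q₍₀₎ ⊗ p₍₁₎ q₍₁₎` on `P ⊗ P`. -/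
noncomputable def diagCoact : Pair k P →ₗ[k] Pair k P ⊗[k] H :=
  diagMerge k H P ∘ₗ TensorProduct.map δ.coact.toLinearMap δ.coact.toLinearMap ∘ₗ
    (Pair.ofTensor k P).symm.toLinearMap

theorem diagMerge_tmul (p q : P) (h g : H) :
    diagMerge k H P ((p ⊗ₜ[k] h) ⊗ₜ[k] (q ⊗ₜ[k] g)) = Pair.tmul k p q ⊗ₜ[k] (h * g) :=
  rfl

theorem diagCoact_tmul (p q : P) :
    δ.diagCoact (Pair.tmul k p q) = diagMerge k H P (δ.coact p ⊗ₜ[k] δ.coact q) := by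
  simp [diagCoact, Pair.tmul]

/-- The map `(r ⊗ u) ⊗ m ↦ x (r ⊗ u ⊗ m) x'`, where for `x = p ⊗ h` and `x' = q ⊗ g` the result is
`(p ⊗ q)(r ⊗ u) ⊗ h m g`. -/
noncomputable def sandwich (k : Type u) (H : Type v) (P : Type w) [Field k] [Ring H] [Algebra k H]
    [Ring P] [Algebra k P] :
    (P ⊗[k] H) →ₗ[k] (P ⊗[k] H) →ₗ[k] (Pair k P ⊗[k] H) →ₗ[k] (Pair k P ⊗[k] H) :=
  TensorProduct.curry (TensorProduct.lift
    ((TensorProduct.mapBilinear (.id k) (Pair k P) H (Pair k P) H).compl₁₂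
      ((LinearMap.mul k (Pair k P)) ∘ₗ (Pair.ofTensor k P).toLinearMap)
      (TensorProduct.lift ((LinearMap.mul k (Module.End k H)).compl₁₂
        (LinearMap.mul k H) (LinearMap.mul k H).flip))) ∘ₗ
    (TensorProduct.tensorTensorTensorComm k P H P H).toLinearMap)

theorem sandwich_tmul (p q : P) (h g m : H) (Y : Pair k P) :
    sandwich k H P (p ⊗ₜ[k] h) (q ⊗ₜ[k] g) (Y ⊗ₜ[k] m) =
      (Pair.tmul k p q * Y) ⊗ₜ[k] (h * (m * g)) :=
  rfl

theorem diagMerge_mul (x x' y y' : P ⊗[k] H) :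
    diagMerge k H P ((x * y) ⊗ₜ[k] (y' * x')) =
      sandwich k H P x x' (diagMerge k H P (y ⊗ₜ[k] y')) := by
  induction x using TensorProduct.induction_on with
  | zero => simp
  | add a b ha hb => simp only [add_mul, TensorProduct.add_tmul, map_add, LinearMap.add_apply, ha, hb]
  | tmul p h =>
  induction x' using TensorProduct.induction_on with
  | zero => simp
  | add a b ha hb => simp only [mul_add, TensorProduct.tmul_add, map_add, LinearMap.add_apply, ha, hb]
  | tmul q g =>
  induction y using TensorProduct.induction_on with
  | zero => simp
  | add a b ha hb => simp only [mul_add, TensorProduct.add_tmul, map_add, ha, hb]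
  | tmul r m =>
  induction y' using TensorProduct.induction_on with
  | zero => simp
  | add a b ha hb => simp only [add_mul, TensorProduct.tmul_add, map_add, ha, hb]
  | tmul u n =>
    simp only [Algebra.TensorProduct.tmul_mul_tmul, diagMerge_tmul, sandwich_tmul,
      Pair.tmul_mul_tmul, mul_assoc]

theorem sandwich_one (x x' : P ⊗[k] H) (Y : Pair k P) :
    sandwich k H P x x' (Y ⊗ₜ[k] (1 : H)) =
      diagMerge k H P (x ⊗ₜ[k] x') * (Y ⊗ₜ[k] (1 : H)) := by
  induction x using TensorProduct.induction_on with
  | zero => simp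
  | add a b ha hb => simp only [add_mul, TensorProduct.add_tmul, map_add, LinearMap.add_apply, ha, hb]
  | tmul p h =>
  induction x' using TensorProduct.induction_on with
  | zero => simp
  | add a b ha hb =>
    simp only [add_mul, TensorProduct.tmul_add, map_add, LinearMap.add_apply, ha, hb]
  | tmul q g =>
    simp only [sandwich_tmul, diagMerge_tmul, Algebra.TensorProduct.tmul_mul_tmul, one_mul, mul_one]

theorem diagCoact_tmul_mul (p q : P) (Y : Pair k P) :
    δ.diagCoact (Pair.tmul k p q * Y) =
      sandwich k H P (δ.coact p) (δ.coact q) (δ.diagCoact Y) := by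
  induction Y using Pair.induction with
  | zero => simp
  | add x y hx hy => simp only [mul_add, map_add, hx, hy]
  | tmul r u => rw [Pair.tmul_mul_tmul, diagCoact_tmul, diagCoact_tmul, map_mul, map_mul,
      diagMerge_mul]

theorem diagCoact_mul (X Y : Pair k P) (hY : δ.diagCoact Y = Y ⊗ₜ[k] (1 : H)) :
    δ.diagCoact (X * Y) = δ.diagCoact X * (Y ⊗ₜ[k] (1 : H)) := by
  induction X using Pair.induction with
  | zero => simp
  | add x y hx hy => simp only [add_mul, map_add, hx, hy]
  | tmul p q => rw [diagCoact_tmul_mul, hY, sandwich_one, diagCoact_tmul]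

/-- The algebra `𝓛(P, H) = (P ⊗ P)^{co H}` of coinvariants for the diagonal coaction,
a subalgebra of `P ⊗ Pᵒᵖ`. -/
noncomputable def ES : Subalgebra k (Pair k P) where
  carrier := {X | δ.diagCoact X = X ⊗ₜ[k] (1 : H)}
  mul_mem' := by
    intro X Y hX hY
    change δ.diagCoact (X * Y) = (X * Y) ⊗ₜ[k] (1 : H)
    rw [diagCoact_mul δ X Y hY, show δ.diagCoact X = X ⊗ₜ[k] (1 : H) from hX]
    simp
  add_mem' := by
    intro X Y hX hY
    change δ.diagCoact (X + Y) = (X + Y) ⊗ₜ[k] (1 : H)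
    rw [map_add, show δ.diagCoact X = X ⊗ₜ[k] (1 : H) from hX,
      show δ.diagCoact Y = Y ⊗ₜ[k] (1 : H) from hY, TensorProduct.add_tmul]
  algebraMap_mem' := by
    intro c
    change δ.diagCoact (algebraMap k (Pair k P) c) = (algebraMap k (Pair k P) c) ⊗ₜ[k] (1 : H)
    rw [Algebra.algebraMap_eq_smul_one, map_smul, Pair.one_def,
      diagCoact_tmul, map_one, Algebra.TensorProduct.one_def, diagMerge_tmul, mul_one,
      TensorProduct.smul_tmul']

theorem mem_ES (X : Pair k P) : X ∈ δ.ES ↔ δ.diagCoact X = X ⊗ₜ[k] (1 : H) := Iff.rfl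

/-- The commuting source and target maps `s(b) = b ⊗ 1`, `t(b) = 1 ⊗ b` with values in
`P ⊗ Pᵒᵖ`. -/
noncomputable def pairRing : BeRing k δ.coinv (Pair k P) where
  s := (Pair.equiv k P).toAlgHom.comp
    ((Algebra.TensorProduct.includeLeft : P →ₐ[k] P ⊗[k] Pᵐᵒᵖ).comp δ.coinv.val)
  t := (Pair.equiv k P).toAlgHom.comp
    ((Algebra.TensorProduct.includeRight : Pᵐᵒᵖ →ₐ[k] P ⊗[k] Pᵐᵒᵖ).comp (AlgHom.op δ.coinv.val))
  comm := by
    intro b c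
    change Pair.tmul k (b : P) 1 * Pair.tmul k 1 (c.unop : P) =
      Pair.tmul k 1 (c.unop : P) * Pair.tmul k (b : P) 1
    simp [Pair.tmul_mul_tmul]

theorem pairRing_s (b : δ.coinv) : δ.pairRing.s b = Pair.tmul k (b : P) 1 := rfl

theorem pairRing_t (b : δ.coinv) : δ.pairRing.t (op b) = Pair.tmul k 1 (b : P) := rfl

theorem pairRing_s_mem (b : δ.coinv) : δ.pairRing.s b ∈ δ.ES := by
  rw [mem_ES, pairRing_s, diagCoact_tmul, coact_coinv, map_one, Algebra.TensorProduct.one_def,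
    diagMerge_tmul, mul_one]

theorem pairRing_t_mem (b : δ.coinvᵐᵒᵖ) : δ.pairRing.t b ∈ δ.ES := by
  rw [← op_unop b, mem_ES, pairRing_t, diagCoact_tmul, coact_coinv, map_one,
    Algebra.TensorProduct.one_def, diagMerge_tmul, mul_one]

/-- The source and target maps `s(b) = b ⊗ 1`, `t(b) = 1 ⊗ b` of `𝓛(P, H)`. -/
noncomputable def esRing : BeRing k δ.coinv δ.ES where
  s := δ.pairRing.s.codRestrict δ.ES δ.pairRing_s_mem
  t := δ.pairRing.t.codRestrict δ.ES δ.pairRing_t_mem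
  comm := by
    intro b c
    exact Subtype.ext (δ.pairRing.comm b c)

/-- The map `𝓛 ⊗_B 𝓛 → (P ⊗ P) ⊗_B (P ⊗ P)` induced by the inclusion `𝓛 ⊆ P ⊗ P`. -/
noncomputable def inclTens : δ.esRing.Tens →ₗ[k] δ.pairRing.Tens :=
  BalTensor.lift (BalTensor.proj _ _ ∘ₗ
    TensorProduct.map δ.ES.val.toLinearMap δ.ES.val.toLinearMap) (by
    intro b X Y
    exact δ.pairRing.tmul_balanced b X Y)

/-- The map `𝓛 ⊗_{Bᵒᵖ} 𝓛 → (P ⊗ P) ⊗_{Bᵒᵖ} (P ⊗ P)` induced by the inclusion `𝓛 ⊆ P ⊗ P`. -/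
noncomputable def inclTensOp : δ.esRing.TensOp →ₗ[k] δ.pairRing.TensOp :=
  BalTensor.lift (BalTensor.proj _ _ ∘ₗ
    TensorProduct.map δ.ES.val.toLinearMap δ.ES.val.toLinearMap) (by
    intro b X Y
    exact δ.pairRing.tmulOp_balanced b X Y)

theorem inclTens_tmul (X Y : δ.ES) :
    δ.inclTens (δ.esRing.tmul X Y) = δ.pairRing.tmul (X : Pair k P) (Y : Pair k P) :=
  rfl

theorem inclTensOp_tmulOp (X Y : δ.ES) :
    δ.inclTensOp (δ.esRing.tmulOp X Y) = δ.pairRing.tmulOp (X : Pair k P) (Y : Pair k P) :=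
  rfl

/-- The multiplication `p ⊗ q ↦ p q` on `P ⊗ P`. -/
noncomputable def pairMul (k : Type u) (P : Type w) [Field k] [Ring P] [Algebra k P] :
    Pair k P →ₗ[k] P :=
  Pair.lift (LinearMap.mul k P)

/-- The map `x ⊗_B y ↦ (p ↦ q ↦ (p ⊗ x) ⊗_B (y ⊗ q))` on `P ⊗_B P`. -/
noncomputable def insertMid : δ.PBP →ₗ[k] P →ₗ[k] P →ₗ[k] δ.pairRing.Tens :=
  BalTensor.lift (TensorProduct.lift (LinearMap.mk₂ k
    (fun x y : P => LinearMap.mk₂ k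
      (fun p q : P => δ.pairRing.tmul (Pair.tmul k p x) (Pair.tmul k y q))
      (by intros; simp [BeRing.tmul, TensorProduct.add_tmul, Pair.add_tmul])
      (by intros; simp [BeRing.tmul, ← TensorProduct.smul_tmul', Pair.smul_tmul])
      (by intros; simp [BeRing.tmul, TensorProduct.tmul_add, Pair.tmul_add])
      (by intros; simp [BeRing.tmul, Pair.tmul_smul]))
    (by intros; ext; simp [BeRing.tmul, TensorProduct.add_tmul, Pair.tmul_add])
    (by intros; ext; simp [BeRing.tmul, ← TensorProduct.smul_tmul', Pair.tmul_smul])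
    (by intros; ext; simp [BeRing.tmul, TensorProduct.tmul_add, Pair.add_tmul])
    (by intros; ext; simp [BeRing.tmul, Pair.smul_tmul]))) (by
    intro b x y
    ext p q
    have h := δ.pairRing.tmul_balanced b (Pair.tmul k p x) (Pair.tmul k y q)
    rw [pairRing_t, pairRing_s, Pair.tmul_mul_tmul, Pair.tmul_mul_tmul, one_mul, mul_one] at h
    exact h)

theorem insertMid_proj (x y p q : P) :
    δ.insertMid (BalTensor.proj _ _ (x ⊗ₜ[k] y)) p q =
      δ.pairRing.tmul (Pair.tmul k p x) (Pair.tmul k y q) :=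
  rfl

/-- The coproduct formula `p ⊗ q ↦ p₍₀₎ ⊗ τ(p₍₁₎) ⊗ q = (p₍₀₎ ⊗ τ¹(p₍₁₎)) ⊗_B (τ²(p₍₁₎) ⊗ q)`,
with values in `(P ⊗ P) ⊗_B (P ⊗ P)`. -/
noncomputable def comulFormula (hG : δ.IsHopfGalois) : Pair k P →ₗ[k] δ.pairRing.Tens :=
  Pair.lift
    (TensorProduct.lift (δ.insertMid ∘ₗ δ.translation hG).flip ∘ₗ δ.coact.toLinearMap)

/-- The map `x ⊗_B y ↦ (q ↦ p ↦ (p ⊗ y) ⊗_{Bᵒᵖ} (q ⊗ x))` on `P ⊗_B P`. -/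
noncomputable def insertOp : δ.PBP →ₗ[k] P →ₗ[k] P →ₗ[k] δ.pairRing.TensOp :=
  BalTensor.lift (TensorProduct.lift (LinearMap.mk₂ k
    (fun x y : P => LinearMap.mk₂ k
      (fun q p : P => δ.pairRing.tmulOp (Pair.tmul k p y) (Pair.tmul k q x))
      (by intros; simp [BeRing.tmulOp, TensorProduct.tmul_add, Pair.add_tmul])
      (by intros; simp [BeRing.tmulOp, Pair.smul_tmul])
      (by intros; simp [BeRing.tmulOp, TensorProduct.add_tmul, Pair.add_tmul])
      (by intros; simp [BeRing.tmulOp, ← TensorProduct.smul_tmul', Pair.smul_tmul]))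
    (by intros; ext; simp [BeRing.tmulOp, TensorProduct.tmul_add, Pair.tmul_add])
    (by intros; ext; simp [BeRing.tmulOp, Pair.tmul_smul])
    (by intros; ext; simp [BeRing.tmulOp, TensorProduct.add_tmul, Pair.tmul_add])
    (by intros; ext; simp [BeRing.tmulOp, ← TensorProduct.smul_tmul', Pair.tmul_smul]))) (by
    intro b x y
    ext q p
    have h := δ.pairRing.tmulOp_balanced b (Pair.tmul k p y) (Pair.tmul k q x)
    rw [pairRing_t, Pair.tmul_mul_tmul, Pair.tmul_mul_tmul, one_mul, mul_one] at h
    exact h.symm)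

theorem insertOp_proj (x y q p : P) :
    δ.insertOp (BalTensor.proj _ _ (x ⊗ₜ[k] y)) q p =
      δ.pairRing.tmulOp (Pair.tmul k p y) (Pair.tmul k q x) :=
  rfl

/-- The map `p ⊗ q ↦ (p ⊗ τ²(q₍₁₎)) ⊗_{Bᵒᵖ} (q₍₀₎ ⊗ τ¹(q₍₁₎))`,
with values in `(P ⊗ P) ⊗_{Bᵒᵖ} (P ⊗ P)`. -/
noncomputable def transFormula (hG : δ.IsHopfGalois) : Pair k P →ₗ[k] δ.pairRing.TensOp :=
  Pair.lift
    (TensorProduct.lift (δ.insertOp ∘ₗ δ.translation hG).flip ∘ₗ δ.coact.toLinearMap).flip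

/-- The formula `(p ⊗ q) ⊗ Y ↦ (p ⊗ τ²(q₍₁₎)) ⊗_{Bᵒᵖ} (q₍₀₎ ⊗ τ¹(q₍₁₎)) Y` for the inverse of `λ`,
with values in `(P ⊗ P) ⊗_{Bᵒᵖ} (P ⊗ P)`. -/
noncomputable def invFormula (hG : δ.IsHopfGalois) (X Y : Pair k P) : δ.pairRing.TensOp :=
  δ.pairRing.rmulOp Y (δ.transFormula hG X)

end RightComoduleAlgebra

/-! The argument is descent for Hopf modules, that is, right P-modules U with a compatible map U → U
⊗ H. Bijectivity of can extends to coefficients: for every right P-module U, x ⊗ p ↦ x p₍₀₎ ⊗ p₍₁₎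
identifies U ⊗_B P with U ⊗ H, with inverse x ⊗ h ↦ x τ(h) (`modCan_bijective`). Let J : K → U be
right B-linear with coinvariant values, and let `extend` be the map K ⊗_B P → U, x ⊗ p ↦ J(x) p.
Faithful flatness of P allows injectivity and exactness to be tested after - ⊗_B P, where the
identification turns them into statements about `extend`. Thus J is injective iff `extend` is; if
`extend` is surjective, then J(K) is the whole space of coinvariants; conversely, if J(K) is that
space, the range of `extend` contains every element on which the coaction is coassociative and
counital.

With U = P ⊗ P this gives 𝓛 ⊗_B P ≅ P ⊗ P (`esExtend_bijective`). If moreover K ⊗_B P ≅ U, then (K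
⊗_B 𝓛) ⊗_B P ≅ (K ⊗_B P) ⊗ P ≅ U ⊗ P (`collapseFun_bijective`, `extend_tensorES_bijective`), so that
K ⊗_B 𝓛 is the space of coinvariants of U ⊗ P. Hence 𝓛 ⊗_B 𝓛 and 𝓛 ⊗_{Bᵒᵖ} 𝓛 are both (P ⊗ P ⊗
P)^{co H}, by (p ⊗ q) ⊗ (a ⊗ c) ↦ p ⊗ q a ⊗ c (`tensMap`) and (p ⊗ q) ⊗ (r ⊗ u) ↦ p ⊗ r ⊗ u q
(`opTensMap`, after a swap of the factors), and the triple product of 𝓛 embeds in P ⊗ P ⊗ P ⊗ P.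
These embeddings factor through the balanced tensor products of P ⊗ P, which proves part 1.

In these coordinates the coproduct is p ⊗ q ↦ p ⊗ 1 ⊗ q, so the bialgebroid axioms become identities
between elementary tensors, and λ becomes the identity of (P ⊗ P ⊗ P)^{co H}. The formulas with τ
live in the larger balanced tensor products of P ⊗ P, where the maps to P ⊗ P ⊗ P are not known to
be injective. They are verified by embedding those products in (P ⊗ P) ⊗ H ⊗ P through can, where τ
disappears. -/

namespace BalTensor

/-! ### Calculus of balanced tensor products. -/

section

variable {k : Type*} [CommRing k] {ι : Type*} {M M' N Q : Type*}
  [AddCommGroup M] [Module k M] [AddCommGroup M'] [Module k M']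
  [AddCommGroup N] [Module k N] [AddCommGroup Q] [Module k Q]

/-- The class of `m ⊗ n` in the balanced tensor product. -/
def mk (ρ : ι → M →ₗ[k] M) (σ : ι → N →ₗ[k] N) (m : M) (n : N) : BalTensor ρ σ :=
  proj ρ σ (m ⊗ₜ[k] n)

theorem mk_balanced (ρ : ι → M →ₗ[k] M) (σ : ι → N →ₗ[k] N) (b : ι) (m : M) (n : N) :
    mk ρ σ (ρ b m) n = mk ρ σ m (σ b n) :=
  proj_balanced ρ σ b m n

theorem ind {ρ : ι → M →ₗ[k] M} {σ : ι → N →ₗ[k] N} {p : BalTensor ρ σ → Prop}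
    (zero : p 0) (mk : ∀ m n, p (mk ρ σ m n)) (add : ∀ x y, p x → p y → p (x + y))
    (x : BalTensor ρ σ) : p x := by
  obtain ⟨z, rfl⟩ := Submodule.mkQ_surjective _ x
  induction z using TensorProduct.induction_on with
  | zero => simpa using zero
  | tmul m n => exact mk m n
  | add a b ha hb => rw [map_add]; exact add _ _ ha hb

/-- A linear map out of a balanced tensor product from a curried balanced map. -/
def lift₂ {ρ : ι → M →ₗ[k] M} {σ : ι → N →ₗ[k] N} (f : M →ₗ[k] N →ₗ[k] Q)
    (hf : ∀ b m n, f (ρ b m) n = f m (σ b n)) : BalTensor ρ σ →ₗ[k] Q :=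
  lift (TensorProduct.lift f) hf

@[simp] theorem lift₂_mk {ρ : ι → M →ₗ[k] M} {σ : ι → N →ₗ[k] N} (f : M →ₗ[k] N →ₗ[k] Q)
    (hf : ∀ b m n, f (ρ b m) n = f m (σ b n)) (m : M) (n : N) :
    lift₂ f hf (mk ρ σ m n) = f m n := rfl

/-- The class `m ⊗ n` as a bilinear map. -/
def mkₗ (ρ : ι → M →ₗ[k] M) (σ : ι → N →ₗ[k] N) : M →ₗ[k] N →ₗ[k] BalTensor ρ σ :=
  (TensorProduct.mk k M N).compr₂ (proj ρ σ)

@[simp] theorem mkₗ_apply (ρ : ι → M →ₗ[k] M) (σ : ι → N →ₗ[k] N) (m : M) (n : N) :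
    mkₗ ρ σ m n = mk ρ σ m n := rfl

/-- The map `f ⊗ id` on balanced tensor products. -/
def mapLeft {ρ : ι → M →ₗ[k] M} {ρ' : ι → M' →ₗ[k] M'} (σ : ι → N →ₗ[k] N) (f : M →ₗ[k] M')
    (hf : ∀ b m, f (ρ b m) = ρ' b (f m)) : BalTensor ρ σ →ₗ[k] BalTensor ρ' σ :=
  lift₂ (mkₗ ρ' σ ∘ₗ f) (by
    intro b m n
    simp [hf, mk_balanced])

@[simp] theorem mapLeft_mk {ρ : ι → M →ₗ[k] M} {ρ' : ι → M' →ₗ[k] M'} (σ : ι → N →ₗ[k] N)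
    (f : M →ₗ[k] M') (hf : ∀ b m, f (ρ b m) = ρ' b (f m)) (m : M) (n : N) :
    mapLeft σ f hf (mk ρ σ m n) = mk ρ' σ (f m) n := rfl

/-- The balanced tensor product with the factors exchanged. -/
def swap (ρ : ι → M →ₗ[k] M) (σ : ι → N →ₗ[k] N) : BalTensor ρ σ ≃ₗ[k] BalTensor σ ρ :=
  LinearEquiv.ofLinearMap
    (lift₂ (mkₗ σ ρ).flip (fun b m n => (proj_balanced σ ρ b n m).symm))
    (lift₂ (mkₗ ρ σ).flip (fun b n m => (proj_balanced ρ σ b m n).symm))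
    (hom_ext fun _ _ => rfl) (hom_ext fun _ _ => rfl)

/-- The map `id ⊗ f` induced by an endomorphism `f` commuting with the left action. -/
def actRight (ρ : ι → M →ₗ[k] M) (σ : ι → N →ₗ[k] N) (f : N →ₗ[k] N)
    (hf : ∀ b n, f (σ b n) = σ b (f n)) : BalTensor ρ σ →ₗ[k] BalTensor ρ σ :=
  lift (proj ρ σ ∘ₗ f.lTensor M) (by
    intro b m n
    change mk ρ σ (ρ b m) (f n) = mk ρ σ m (f (σ b n))
    rw [hf, mk_balanced])

@[simp] theorem actRight_mk (ρ : ι → M →ₗ[k] M) (σ : ι → N →ₗ[k] N) (f : N →ₗ[k] N)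
    (hf : ∀ b n, f (σ b n) = σ b (f n)) (m : M) (n : N) :
    actRight ρ σ f hf (mk ρ σ m n) = mk ρ σ m (f n) := rfl

end

/-! ### Transport of an isomorphism W ⊗_B S ≅ R ⊗ V along U ⊗_B -. -/

section Collapse

variable {k : Type*} [CommRing k] {ι : Type*} {U W S R V : Type*}
  [AddCommGroup U] [Module k U] [AddCommGroup W] [Module k W] [AddCommGroup S] [Module k S]
  [AddCommGroup R] [Module k R] [AddCommGroup V] [Module k V]
  (ρ : ι → U →ₗ[k] U) (σ : ι → W →ₗ[k] W) (α : ι → W →ₗ[k] W) (β : ι → S →ₗ[k] S)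
  (σ' : ι → R →ₗ[k] R)
  (hα : ∀ c b n, α c (σ b n) = σ b (α c n))
  (e : BalTensor α β ≃ₗ[k] R ⊗[k] V)
  (he : ∀ b w s, e (mk α β (σ b w) s) = (σ' b).rTensor V (e (mk α β w s)))

/-- The map `r ⊗ v ↦ (u ⊗ r) ⊗ v`. -/
def insertLeft (V : Type*) [AddCommGroup V] [Module k V] :
    U →ₗ[k] R ⊗[k] V →ₗ[k] BalTensor ρ σ' ⊗[k] V :=
  LinearMap.rTensorHom V ∘ₗ mkₗ ρ σ'

@[simp] theorem insertLeft_tmul (u : U) (r : R) (v : V) :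
    insertLeft ρ σ' V u (r ⊗ₜ v) = mk ρ σ' u r ⊗ₜ v := rfl

theorem insertLeft_balanced (b : ι) (u : U) (x : R ⊗[k] V) :
    insertLeft ρ σ' V (ρ b u) x = insertLeft ρ σ' V u ((σ' b).rTensor V x) := by
  induction x using TensorProduct.induction_on with
  | zero => simp
  | add x y hx hy => simp only [map_add, hx, hy]
  | tmul r v => simp [mk_balanced]

/-- `(U ⊗_B W) ⊗_B S`, where the right action on `U ⊗_B W` is induced from `W`. -/
abbrev Triple : Type _ := BalTensor (fun c => actRight ρ σ (α c) (hα c)) β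

/-- The trilinear map `u, w, s ↦ (u ⊗ id) (e (w ⊗ s))`. -/
def collapseTri : U →ₗ[k] W →ₗ[k] S →ₗ[k] BalTensor ρ σ' ⊗[k] V :=
  (LinearMap.llcomp k S (BalTensor α β) (BalTensor ρ σ' ⊗[k] V)).compl₁₂
    (LinearMap.lcomp k (BalTensor ρ σ' ⊗[k] V) e.toLinearMap ∘ₗ insertLeft ρ σ' V) (mkₗ α β)

theorem collapseTri_apply (u : U) (w : W) (s : S) :
    collapseTri ρ α β σ' e u w s = insertLeft ρ σ' V u (e (mk α β w s)) := rfl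

theorem collapseTri_balanced
    (he : ∀ b w s, e (mk α β (σ b w) s) = (σ' b).rTensor V (e (mk α β w s))) (b : ι) (u : U)
    (w : W) : collapseTri ρ α β σ' e (ρ b u) w = collapseTri ρ α β σ' e u (σ b w) := by
  refine LinearMap.ext fun s => ?_
  rw [collapseTri_apply, collapseTri_apply, insertLeft_balanced, he]

/-- The bilinear map `u ⊗ w, s ↦ (u ⊗ id) (e (w ⊗ s))`. -/
def collapseBi : BalTensor ρ σ →ₗ[k] S →ₗ[k] BalTensor ρ σ' ⊗[k] V :=
  lift₂ (Q := S →ₗ[k] BalTensor ρ σ' ⊗[k] V) (collapseTri ρ α β σ' e) (collapseTri_balanced ρ σ α β σ' e he)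

theorem collapseBi_mk (u : U) (w : W) (s : S) :
    collapseBi ρ σ α β σ' e he (mk ρ σ u w) s = insertLeft ρ σ' V u (e (mk α β w s)) := rfl

/-- The map `(u ⊗ w) ⊗ s ↦ (u ⊗ id) (e (w ⊗ s))`. -/
def collapseFun : Triple ρ σ α β hα →ₗ[k] BalTensor ρ σ' ⊗[k] V :=
  lift₂ (collapseBi ρ σ α β σ' e he) (by
    intro b x s
    induction x using ind with
    | zero => simp
    | add x y hx hy => simp only [map_add, LinearMap.add_apply, hx, hy]
    | mk u w => rw [actRight_mk, collapseBi_mk, collapseBi_mk, mk_balanced])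

theorem collapseFun_mk (u : U) (w : W) (s : S) :
    collapseFun ρ σ α β σ' hα e he (mk _ _ (mk _ _ u w) s) = insertLeft ρ σ' V u (e (mk α β w s)) :=
  rfl

/-- The map `w ⊗ s ↦ (u ⊗ w) ⊗ s`. -/
def reassoc : U →ₗ[k] BalTensor α β →ₗ[k] Triple ρ σ α β hα :=
  LinearMap.flip (lift₂
    ((LinearMap.llcomp k U _ (Triple ρ σ α β hα)).flip.compl₁₂ (mkₗ ρ σ).flip
      (mkₗ (fun c => actRight ρ σ (α c) (hα c)) β).flip) (by
    intro c w s
    refine LinearMap.ext fun u => ?_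
    exact mk_balanced (fun c => actRight ρ σ (α c) (hα c)) β c (mk ρ σ u w) s))

theorem reassoc_mk (u : U) (w : W) (s : S) :
    reassoc ρ σ α β hα u (mk α β w s) = mk _ _ (mk ρ σ u w) s := rfl

/-- The hypothesis `he` says that e is left B-linear, whereas the inverse needs this for e⁻¹;
writing x = e(y) reduces it to simple tensors in y. -/
theorem reassoc_symm_balanced
    (he : ∀ b w s, e (mk α β (σ b w) s) = (σ' b).rTensor V (e (mk α β w s))) (b : ι) (u : U) (x : R ⊗[k] V) :
    reassoc ρ σ α β hα (ρ b u) (e.symm x) =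
      reassoc ρ σ α β hα u (e.symm ((σ' b).rTensor V x)) := by
  obtain ⟨y, rfl⟩ := e.surjective x
  induction y using ind with
  | zero => simp
  | add x y hx hy => simp only [map_add, hx, hy]
  | mk w s => rw [← he, e.symm_apply_apply, e.symm_apply_apply, reassoc_mk, reassoc_mk, mk_balanced]

/-- The map `(u ⊗ r) ⊗ v ↦ (u ⊗ id) (e⁻¹ (r ⊗ v))`. -/
def collapseInv : BalTensor ρ σ' ⊗[k] V →ₗ[k] Triple ρ σ α β hα :=
  TensorProduct.lift (lift₂ ((LinearMap.llcomp k V (R ⊗[k] V) (Triple ρ σ α β hα)).compl₁₂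
      (LinearMap.lcomp k (Triple ρ σ α β hα) e.symm.toLinearMap ∘ₗ reassoc ρ σ α β hα)
      (TensorProduct.mk k R V)) (by
    intro b u r
    refine LinearMap.ext fun v => ?_
    exact reassoc_symm_balanced ρ σ α β σ' hα e he b u (r ⊗ₜ v)))

theorem collapseInv_insertLeft (u : U) (x : R ⊗[k] V) :
    collapseInv ρ σ α β σ' hα e he (insertLeft ρ σ' V u x) = reassoc ρ σ α β hα u (e.symm x) := by
  induction x using TensorProduct.induction_on with
  | zero => simp
  | add x y hx hy => simp only [map_add, hx, hy]
  | tmul r v => rfl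

theorem collapseFun_reassoc (u : U) (y : BalTensor α β) :
    collapseFun ρ σ α β σ' hα e he (reassoc ρ σ α β hα u y) = insertLeft ρ σ' V u (e y) := by
  induction y using ind with
  | zero => simp
  | add x y hx hy => simp only [map_add, hx, hy]
  | mk w s => rfl

/-- If `W ⊗_B S ≃ R ⊗ V` as left `B`-modules, then `(U ⊗_B W) ⊗_B S ≃ (U ⊗_B R) ⊗ V`. -/
theorem collapseFun_bijective : Function.Bijective (collapseFun ρ σ α β σ' hα e he) := by
  refine Function.bijective_iff_has_inverse.2 ⟨collapseInv ρ σ α β σ' hα e he, fun x => ?_, fun x => ?_⟩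
  · induction x using ind with
    | zero => simp
    | add x y hx hy => simp only [map_add, hx, hy]
    | mk x s =>
    induction x using ind with
    | zero => simp [mk]
    | add x y hx hy =>
      have h : mk (fun c => actRight ρ σ (α c) (hα c)) β (x + y) s = mk _ _ x s + mk _ _ y s := by
        simp only [← mkₗ_apply, map_add, LinearMap.add_apply]
      rw [h, map_add, map_add, hx, hy]
    | mk u w =>
      rw [collapseFun_mk, collapseInv_insertLeft, e.symm_apply_apply, reassoc_mk]
  · induction x using TensorProduct.induction_on with
    | zero => simp
    | add x y hx hy => simp only [map_add, hx, hy]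
    | tmul x v =>
    induction x using ind with
    | zero => simp
    | add x y hx hy => simp only [TensorProduct.add_tmul, map_add, hx, hy]
    | mk u r =>
      rw [← insertLeft_tmul, collapseInv_insertLeft, collapseFun_reassoc, e.apply_symm_apply]

end Collapse
end BalTensor

/-! ### Faithful flatness for right actions given by endomorphisms. -/

section Flat

/-- A family of endomorphisms of `M` that is a right action of the algebra `B`. -/
structure IsRightAction {k B M : Type*} [CommRing k] [Ring B] [Algebra k B] [AddCommGroup M]
    [Module k M] (ρ : B → M →ₗ[k] M) : Prop where
  one : ∀ m, ρ 1 m = m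
  mul : ∀ a b m, ρ (a * b) m = ρ b (ρ a m)
  add : ∀ a b m, ρ (a + b) m = ρ a m + ρ b m
  smul : ∀ (c : k) b m, ρ (c • b) m = c • ρ b m

/-- The right `B`-module given by a right action, lifted to a larger universe. -/
def RightMod {k : Type u} {B : Type*} {M : Type w} [CommRing k] [Ring B] [Algebra k B]
    [AddCommGroup M] [Module k M] {ρ : B → M →ₗ[k] M} (_ : IsRightAction ρ) : Type (max w v) :=
  ULift.{v} M

namespace RightMod

variable {k : Type u} {B : Type*} {M : Type w} [CommRing k] [Ring B] [Algebra k B]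
  [AddCommGroup M] [Module k M] {ρ : B → M →ₗ[k] M} (h : IsRightAction ρ)

instance : AddCommGroup (RightMod.{u, v, w} h) := inferInstanceAs (AddCommGroup (ULift.{v} M))

instance : Module k (RightMod.{u, v, w} h) := inferInstanceAs (Module k (ULift.{v} M))

/-- The underlying `k`-module. -/
def equiv : RightMod.{u, v, w} h ≃ₗ[k] M := (ULift.moduleEquiv : ULift.{v} M ≃ₗ[k] M)

instance : SMul Bᵐᵒᵖ (RightMod.{u, v, w} h) where
  smul b m := (equiv h).symm (ρ b.unop (equiv h m))

theorem smul_def (b : Bᵐᵒᵖ) (m : RightMod.{u, v, w} h) :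
    b • m = (equiv h).symm (ρ b.unop (equiv h m)) := rfl

instance : Module Bᵐᵒᵖ (RightMod.{u, v, w} h) where
  one_smul m := by simp [smul_def, h.one]
  mul_smul a b m := by simp [smul_def, h.mul]
  smul_zero a := by simp [smul_def]
  smul_add a x y := by simp [smul_def]
  add_smul a b m := by simp [smul_def, h.add]
  zero_smul m := by
    have := h.smul 0 0 (equiv h m)
    simp only [zero_smul] at this
    simp [smul_def, this]

instance : IsScalarTower k Bᵐᵒᵖ (RightMod.{u, v, w} h) where
  smul_assoc c b m := by simp [smul_def, h.smul]

end RightMod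

variable {k : Type u} {B : Type*} [CommRing k] [Ring B] [Algebra k B]
  {N : Type*} [AddCommGroup N] [Module k N] [Module B N] [IsScalarTower k B N]

/-- `M ⊗_B N` computed with the module attached to a right action. -/
def RightMod.tensorEquiv {M : Type w} [AddCommGroup M] [Module k M] {ρ : B → M →ₗ[k] M}
    (h : IsRightAction ρ) (N : Type*) [AddCommGroup N] [Module k N] [Module B N]
    [IsScalarTower k B N] :
    ModTensor k B (RightMod.{u, v, w} h) N ≃ₗ[k]
      BalTensor ρ (fun b : B => Algebra.lsmul k k N b) :=
  LinearEquiv.ofLinearMap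
    (BalTensor.mapLeft _ (RightMod.equiv h).toLinearMap (fun _ _ => rfl))
    (BalTensor.mapLeft _ (RightMod.equiv h).symm.toLinearMap (fun _ _ => rfl))
    (BalTensor.hom_ext fun _ _ => rfl) (BalTensor.hom_ext fun _ _ => rfl)

/-- A map commuting with right actions as a map of right modules. -/
def RightMod.map {M M' : Type*} [AddCommGroup M] [Module k M] [AddCommGroup M'] [Module k M']
    {ρ : B → M →ₗ[k] M} {ρ' : B → M' →ₗ[k] M'} (h : IsRightAction ρ) (h' : IsRightAction ρ')
    (f : M →ₗ[k] M') (hf : ∀ b m, f (ρ b m) = ρ' b (f m)) :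
    RightMod.{u, v} h →ₗ[Bᵐᵒᵖ] RightMod.{u, v} h' where
  toFun m := (RightMod.equiv h').symm (f (RightMod.equiv h m))
  map_add' x y := by simp
  map_smul' b m := by simp [RightMod.smul_def, hf]

/-- Faithful flatness quantifies over bundled right modules in one universe. Here it is carried to
bare actions, with the third term allowed in the larger universe because it will be U ⊗ H. -/
theorem IsFaithfullyFlatLeft.exact_iff (hN : IsFaithfullyFlatLeft.{max w v} k B N)
    {M₁ M₂ : Type w} {M₃ : Type max w v} [AddCommGroup M₁] [Module k M₁] [AddCommGroup M₂]
    [Module k M₂] [AddCommGroup M₃] [Module k M₃] {ρ₁ : B → M₁ →ₗ[k] M₁} {ρ₂ : B → M₂ →ₗ[k] M₂}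
    {ρ₃ : B → M₃ →ₗ[k] M₃} (h₁ : IsRightAction ρ₁) (h₂ : IsRightAction ρ₂) (h₃ : IsRightAction ρ₃)
    (f : M₁ →ₗ[k] M₂) (g : M₂ →ₗ[k] M₃) (hf : ∀ b m, f (ρ₁ b m) = ρ₂ b (f m))
    (hg : ∀ b m, g (ρ₂ b m) = ρ₃ b (g m)) :
    Function.Exact f g ↔
      Function.Exact (BalTensor.mapLeft (fun b : B => Algebra.lsmul k k N b) f hf)
        (BalTensor.mapLeft (fun b : B => Algebra.lsmul k k N b) g hg) := by
  have e := hN (RightMod.{u, v} h₁) (RightMod.{u, v} h₂) (RightMod.{u, v} h₃)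
    (RightMod.map h₁ h₂ f hf) (RightMod.map h₂ h₃ g hg)
  have e₁ : Function.Exact f g ↔ Function.Exact (RightMod.map.{u, v} h₁ h₂ f hf)
      (RightMod.map.{u, v} h₂ h₃ g hg) := by
    refine Function.Exact.iff_of_ladder_linearEquiv (R := k) (e₁ := RightMod.equiv h₁)
      (e₂ := RightMod.equiv h₂) (e₃ := RightMod.equiv h₃)
      (f₁₂ := (RightMod.map.{u, v} h₁ h₂ f hf).restrictScalars k)
      (f₂₃ := (RightMod.map.{u, v} h₂ h₃ g hg).restrictScalars k) rfl rfl
  have e₂ := Function.Exact.iff_of_ladder_linearEquiv (R := k)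
    (f₁₂ := modTensorMap k B N (RightMod.map.{u, v} h₁ h₂ f hf))
    (f₂₃ := modTensorMap k B N (RightMod.map.{u, v} h₂ h₃ g hg))
    (g₁₂ := BalTensor.mapLeft (fun b : B => Algebra.lsmul k k N b) f hf)
    (g₂₃ := BalTensor.mapLeft (fun b : B => Algebra.lsmul k k N b) g hg)
    (e₁ := RightMod.tensorEquiv h₁ N)
    (e₂ := RightMod.tensorEquiv h₂ N) (e₃ := RightMod.tensorEquiv h₃ N)
    (BalTensor.hom_ext fun _ _ => rfl) (BalTensor.hom_ext fun _ _ => rfl)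
  exact e₁.trans (e.trans e₂.symm)

theorem IsFaithfullyFlatLeft.injective_iff (hN : IsFaithfullyFlatLeft.{max w v} k B N)
    {M₁ M₂ : Type w} [AddCommGroup M₁] [Module k M₁] [AddCommGroup M₂]
    [Module k M₂] {ρ₁ : B → M₁ →ₗ[k] M₁} {ρ₂ : B → M₂ →ₗ[k] M₂}
    (h₁ : IsRightAction ρ₁) (h₂ : IsRightAction ρ₂)
    (f : M₁ →ₗ[k] M₂) (hf : ∀ b m, f (ρ₁ b m) = ρ₂ b (f m)) :
    Function.Injective f ↔
      Function.Injective (BalTensor.mapLeft (fun b : B => Algebra.lsmul k k N b) f hf) := by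
  -- The third term in `exact_iff` lives in the larger universe, so the target is replaced by a
  -- lifted copy with the transported action.
  let M₃ := ULift.{v} M₂
  let eM : M₃ ≃ₗ[k] M₂ := ULift.moduleEquiv
  let ρ₃ : B → M₃ →ₗ[k] M₃ := fun b => eM.symm.toLinearMap ∘ₗ ρ₂ b ∘ₗ eM.toLinearMap
  have h₃ : IsRightAction ρ₃ :=
    ⟨fun m => by simp [ρ₃, h₂.one], fun a b m => by simp [ρ₃, h₂.mul],
      fun a b m => by simp [ρ₃, h₂.add], fun a b m => by simp [ρ₃, h₂.smul]⟩
  -- Injectivity of f is exactness at M₁ of the zero map followed by f.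
  have key := hN.exact_iff h₁ h₁ h₃ (0 : M₁ →ₗ[k] M₁) (eM.symm.toLinearMap ∘ₗ f)
    (fun b m => by simp) (fun b m => by simp [ρ₃, hf])
  let σ := fun b : B => Algebra.lsmul k k N b
  let E : BalTensor ρ₂ σ ≃ₗ[k] BalTensor ρ₃ σ := LinearEquiv.ofLinearMap
    (BalTensor.mapLeft _ eM.symm.toLinearMap (fun b m => by simp [ρ₃]))
    (BalTensor.mapLeft _ eM.toLinearMap (fun b m => by simp [ρ₃]))
    (BalTensor.hom_ext fun _ _ => rfl) (BalTensor.hom_ext fun _ _ => rfl)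
  have hE : BalTensor.mapLeft σ (eM.symm.toLinearMap ∘ₗ f) (ρ' := ρ₃)
      (fun b m => by simp [ρ₃, hf]) = E.toLinearMap ∘ₗ BalTensor.mapLeft σ f hf :=
    BalTensor.hom_ext fun _ _ => rfl
  have h0 : BalTensor.mapLeft σ (0 : M₁ →ₗ[k] M₁) (ρ := ρ₁) (ρ' := ρ₁) (fun b m => by simp) = 0 :=
    BalTensor.hom_ext fun m n => by
      change BalTensor.mk _ _ 0 n = 0
      simp [← BalTensor.mkₗ_apply]
  change Function.Exact _ _ ↔ Function.Exact (BalTensor.mapLeft σ _ _)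
    (BalTensor.mapLeft σ _ _) at key
  rw [hE, h0] at key
  rw [LinearMap.exact_zero_iff_injective, LinearMap.exact_zero_iff_injective, LinearMap.coe_comp,
    LinearMap.coe_comp] at key
  exact (eM.symm.injective.of_comp_iff f).symm.trans
    (key.trans (E.injective.of_comp_iff (BalTensor.mapLeft σ f hf)))

end Flat

/-! ### Right actions of P and the induced actions of P ⊗ H. -/

section RightMul

/-- A bilinear map `P × U → U` that is a right action of the algebra `P`. -/
structure IsRightMul {k P U : Type*} [CommRing k] [Ring P] [Algebra k P] [AddCommGroup U]
    [Module k U] (R : P →ₗ[k] U →ₗ[k] U) : Prop where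
  one : ∀ x, R 1 x = x
  mul : ∀ p q x, R (p * q) x = R q (R p x)

theorem IsRightMul.isRightAction {k P U : Type*} [CommRing k] [Ring P] [Algebra k P]
    [AddCommGroup U] [Module k U] {R : P →ₗ[k] U →ₗ[k] U} (h : IsRightMul R)
    (B : Subalgebra k P) : IsRightAction (fun b : B => R (b : P)) where
  one := h.one
  mul _ _ := h.mul _ _
  add _ _ _ := by simp
  smul _ _ _ := by simp

variable {k H P U : Type*} [CommRing k] [Ring H] [Algebra k H] [Ring P] [Algebra k P]
  [AddCommGroup U] [Module k U]

/-- The right action of `P ⊗ H` on `U ⊗ H` induced by a right action of `P` on `U`. -/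
noncomputable def actTensor (H : Type*) [Ring H] [Algebra k H] (R : P →ₗ[k] U →ₗ[k] U) :
    P ⊗[k] H →ₗ[k] U ⊗[k] H →ₗ[k] U ⊗[k] H :=
  TensorProduct.lift ((TensorProduct.mapBilinear (.id k) U H U H).compl₁₂ R (LinearMap.mul k H).flip)

@[simp] theorem actTensor_tmul (R : P →ₗ[k] U →ₗ[k] U) (p : P) (h : H) (x : U) (g : H) :
    actTensor H R (p ⊗ₜ h) (x ⊗ₜ g) = R p x ⊗ₜ (g * h) := rfl

theorem actTensor_isRightMul {R : P →ₗ[k] U →ₗ[k] U} (hR : IsRightMul R) :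
    IsRightMul (actTensor H R) where
  one y := by
    induction y using TensorProduct.induction_on with
    | zero => simp
    | add a b ha hb => rw [map_add, ha, hb]
    | tmul x g => rw [Algebra.TensorProduct.one_def, actTensor_tmul, hR.one, mul_one]
  mul p q y := by
    induction y using TensorProduct.induction_on with
    | zero => simp
    | add a b ha hb => simp only [map_add, ha, hb]
    | tmul x g =>
    induction p using TensorProduct.induction_on with
    | zero => simp
    | add a b ha hb => simp only [map_add, add_mul, LinearMap.add_apply, ha, hb]
    | tmul p h =>
    induction q using TensorProduct.induction_on with
    | zero => simp
    | add a b ha hb => simp only [map_add, mul_add, LinearMap.add_apply, ha, hb]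
    | tmul q h' => simp [hR.mul, mul_assoc]

theorem IsRightMul.comp_algHom {Q : Type*} [Ring Q] [Algebra k Q] {R : Q →ₗ[k] U →ₗ[k] U}
    (hR : IsRightMul R) (f : P →ₐ[k] Q) : IsRightMul (R ∘ₗ f.toLinearMap) where
  one x := by simp [hR.one]
  mul p q x := by simp [hR.mul]

end RightMul

namespace RightComoduleAlgebra

variable {k : Type u} {H : Type v} {P : Type w} [Field k] [Ring H] [HopfAlgebra k H] [Ring P]
  [Algebra k P] (δ : RightComoduleAlgebra k H P)

/-- Left multiplication by coinvariants on `P`. -/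
abbrev lmulP (b : δ.coinv) : P →ₗ[k] P := LinearMap.mulLeft k (b : P)

/-! ### The Galois isomorphism with coefficients in a right P-module. -/

section Can

variable {U : Type*} [AddCommGroup U] [Module k U] {R : P →ₗ[k] U →ₗ[k] U} (hR : IsRightMul R)

/-- The diagonal right action `(x ⊗ h) p = x p₍₀₎ ⊗ h p₍₁₎` of `P` on `U ⊗ H`. -/
noncomputable def diagAct (R : P →ₗ[k] U →ₗ[k] U) : P →ₗ[k] U ⊗[k] H →ₗ[k] U ⊗[k] H :=
  actTensor H R ∘ₗ δ.coact.toLinearMap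

theorem diagAct_apply (R : P →ₗ[k] U →ₗ[k] U) (p : P) (y : U ⊗[k] H) :
    δ.diagAct R p y = actTensor H R (δ.coact p) y := rfl

theorem diagAct_isRightMul (hR : IsRightMul R) : IsRightMul (δ.diagAct R) :=
  (actTensor_isRightMul hR).comp_algHom δ.coact

theorem diagAct_coinv (R : P →ₗ[k] U →ₗ[k] U) (b : δ.coinv) (x : U) (h : H) :
    δ.diagAct R b (x ⊗ₜ h) = R b x ⊗ₜ h := by
  rw [diagAct_apply, coact_coinv, actTensor_tmul, mul_one]

/-- The map `U ⊗_B P → U ⊗ H`, `x ⊗ p ↦ x p₍₀₎ ⊗ p₍₁₎` for a right `P`-module `U`. -/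
noncomputable def modCan : BalTensor (fun b : δ.coinv => R (b : P)) δ.lmulP →ₗ[k] U ⊗[k] H :=
  BalTensor.lift₂ (LinearMap.flip (LinearMap.lcomp k (U ⊗[k] H)
      ((TensorProduct.mk k U H).flip 1) ∘ₗ δ.diagAct R)) (by
    intro b x p
    change δ.diagAct R p (R b x ⊗ₜ 1) = δ.diagAct R (b * p) (x ⊗ₜ 1)
    rw [(diagAct_isRightMul δ hR).mul, diagAct_coinv])

theorem modCan_mk (x : U) (p : P) :
    δ.modCan hR (BalTensor.mk _ _ x p) = δ.diagAct R p (x ⊗ₜ 1) := rfl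

/-- The map `U ⊗_B P → U`, `x ⊗ p ↦ x p`. -/
noncomputable def modMul : BalTensor (fun b : δ.coinv => R (b : P)) δ.lmulP →ₗ[k] U :=
  BalTensor.lift₂ R.flip (fun b x p => (hR.mul b p x).symm)

theorem modMul_mk (x : U) (p : P) : δ.modMul hR (BalTensor.mk _ _ x p) = R p x := rfl

/-- Left multiplication by `p` on `P ⊗_B P`. -/
noncomputable def lmulPBP (p : P) : δ.PBP →ₗ[k] δ.PBP :=
  BalTensor.mapLeft _ (LinearMap.mulLeft k p) (fun _ _ => by simp [mul_assoc])

theorem can_lmulPBP (p : P) (x : δ.PBP) :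
    δ.can (δ.lmulPBP p x) = (p ⊗ₜ 1) * δ.can x := by
  induction x using BalTensor.ind with
  | zero => simp
  | add x y hx hy => rw [map_add, map_add, map_add, mul_add, hx, hy]
  | mk q r =>
    change δ.can (BalTensor.proj _ _ ((p * q) ⊗ₜ r)) = _ * δ.can (BalTensor.proj _ _ (q ⊗ₜ r))
    rw [can_proj, can_proj, ← mul_assoc, Algebra.TensorProduct.tmul_mul_tmul, mul_one]

/-- The map `p ⊗ q ↦ (x ↦ x p ⊗ q)`. -/
noncomputable def modInsert : δ.PBP →ₗ[k] U →ₗ[k]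
    BalTensor (fun b : δ.coinv => R (b : P)) δ.lmulP :=
  BalTensor.lift₂ (Q := U →ₗ[k] BalTensor (fun b : δ.coinv => R (b : P)) δ.lmulP)
    ((LinearMap.llcomp k U U (BalTensor (fun b : δ.coinv => R (b : P)) δ.lmulP)).flip.compl₁₂ R
      (BalTensor.mkₗ _ _).flip) (by
    intro b p q
    refine LinearMap.ext fun x => ?_
    change BalTensor.mk _ _ (R (p * b) x) q = BalTensor.mk _ _ (R p x) (b * q)
    rw [hR.mul]
    exact BalTensor.mk_balanced _ _ b (R p x) q)

theorem modInsert_mk (p q : P) (x : U) :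
    δ.modInsert hR (BalTensor.mk _ _ p q) x = BalTensor.mk _ _ (R p x) q := rfl

theorem modInsert_lmulPBP (p : P) (z : δ.PBP) (x : U) :
    δ.modInsert hR (δ.lmulPBP p z) x = δ.modInsert hR z (R p x) := by
  induction z using BalTensor.ind with
  | zero => simp
  | add y z hy hz => simp only [map_add, LinearMap.add_apply, hy, hz]
  | mk q r =>
    change BalTensor.mk _ _ (R (p * q) x) r = BalTensor.mk _ _ (R q (R p x)) r
    rw [hR.mul]

theorem modCan_modInsert (z : δ.PBP) (x : U) :
    δ.modCan hR (δ.modInsert hR z x) = actTensor H R (δ.can z) (x ⊗ₜ 1) := by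
  induction z using BalTensor.ind with
  | zero => simp
  | add y z hy hz => simp only [map_add, LinearMap.add_apply, hy, hz]
  | mk q r =>
    rw [modInsert_mk, modCan_mk, BalTensor.mk, can_proj, (actTensor_isRightMul hR).mul,
      actTensor_tmul, mul_one, diagAct_apply]

/-- The map `x ⊗ h ↦ x τ(h)`, inverse to `modCan`. -/
noncomputable def modCanInv (hG : δ.IsHopfGalois) :
    U ⊗[k] H →ₗ[k] BalTensor (fun b : δ.coinv => R (b : P)) δ.lmulP :=
  TensorProduct.lift (δ.modInsert hR ∘ₗ δ.translation hG).flip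

theorem modCanInv_tmul (hG : δ.IsHopfGalois) (x : U) (h : H) :
    δ.modCanInv hR hG (x ⊗ₜ h) = δ.modInsert hR (δ.translation hG h) x := rfl

theorem can_translation (hG : δ.IsHopfGalois) (h : H) :
    δ.can (δ.translation hG h) = 1 ⊗ₜ h :=
  (LinearEquiv.ofBijective δ.can hG).apply_symm_apply _

/-- By left P-linearity of can, every z is a sum of elements p τ(g), and on these both sides are (x
p) τ(g). -/
theorem modCanInv_actTensor (hG : δ.IsHopfGalois) (z : δ.PBP) (x : U) :
    δ.modCanInv hR hG (actTensor H R (δ.can z) (x ⊗ₜ 1)) = δ.modInsert hR z x := by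
  obtain ⟨y, rfl⟩ := (LinearEquiv.ofBijective δ.can hG).symm.surjective z
  have h : ∀ y, δ.can ((LinearEquiv.ofBijective δ.can hG).symm y) = y :=
    (LinearEquiv.ofBijective δ.can hG).apply_symm_apply
  rw [h]
  induction y using TensorProduct.induction_on with
  | zero => simp
  | add y z hy hz => simp only [map_add, LinearMap.add_apply, hy, hz]
  | tmul p g =>
    have e : (LinearEquiv.ofBijective δ.can hG).symm (p ⊗ₜ g) =
        δ.lmulPBP p (δ.translation hG g) := by
      rw [LinearEquiv.symm_apply_eq]
      change _ = δ.can _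
      rw [can_lmulPBP, can_translation, Algebra.TensorProduct.tmul_mul_tmul, mul_one, one_mul]
    rw [e, modInsert_lmulPBP, actTensor_tmul, modCanInv_tmul, one_mul]

/-- This is can base-changed along U ⊗_P -, since U ⊗_B P = U ⊗_P (P ⊗_B P) and U ⊗_P (P ⊗ H) = U ⊗
H. -/
theorem modCan_bijective (hG : δ.IsHopfGalois) : Function.Bijective (δ.modCan hR) := by
  refine Function.bijective_iff_has_inverse.2 ⟨δ.modCanInv hR hG, fun y => ?_, fun y => ?_⟩
  · induction y using BalTensor.ind with
    | zero => simp
    | add y z hy hz => simp only [map_add, hy, hz]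
    | mk x p =>
      -- The coaction is itself a value of can, so x p₍₀₎ ⊗ p₍₁₎ has the shape that
      -- `modCanInv_actTensor` inverts.
      have h : δ.coact p = δ.can (BalTensor.mk _ _ 1 p) := by
        rw [BalTensor.mk, can_proj, ← Algebra.TensorProduct.one_def, one_mul]
      rw [modCan_mk, diagAct_apply, h, modCanInv_actTensor, modInsert_mk, hR.one]
  · induction y using TensorProduct.induction_on with
    | zero => simp
    | add y z hy hz => simp only [map_add, hy, hz]
    | tmul x h =>
      rw [modCanInv_tmul, modCan_modInsert, can_translation, actTensor_tmul, hR.one, one_mul]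

/-- Counitality of the coaction of P: multiplication U ⊗_B P → U can be read off from U ⊗ H by
applying ε. -/
theorem rid_modCan (y : BalTensor (fun b : δ.coinv => R (b : P)) δ.lmulP) :
    TensorProduct.rid k U ((Coalgebra.counit (R := k) (A := H)).lTensor U (δ.modCan hR y)) =
      δ.modMul hR y := by
  induction y using BalTensor.ind with
  | zero => simp
  | add y z hy hz => simp only [map_add, hy, hz]
  | mk x p =>
    rw [modMul_mk, modCan_mk, diagAct_apply]
    conv_rhs => rw [← δ.counit p]
    generalize δ.coact p = y
    induction y using TensorProduct.induction_on with
    | zero => simp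
    | add y z hy hz => simp only [map_add, LinearMap.add_apply, hy, hz]
    | tmul p g => simp

end Can

/-! ### Descent for Hopf modules. -/

/-- A right `P`-module `U` with a linear map `U → U ⊗ H` compatible with the coaction of `P`. -/
structure HopfMod (U : Type*) [AddCommGroup U] [Module k U] where
  /-- The right action of `P`. -/
  act : P →ₗ[k] U →ₗ[k] U
  isRightMul : IsRightMul act
  /-- The coaction of `H`. -/
  coact : U →ₗ[k] U ⊗[k] H
  coact_act : ∀ p x, coact (act p x) = δ.diagAct act p (coact x)

namespace HopfMod

variable {δ} {U K : Type w} [AddCommGroup U] [Module k U] [AddCommGroup K] [Module k K]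
  (𝓤 : δ.HopfMod U) {ρ : δ.coinv → K →ₗ[k] K} (J : K →ₗ[k] U)
  (hJ : ∀ b x, J (ρ b x) = 𝓤.act b (J x))

/-- The map `K ⊗_B P → U`, `x ⊗ p ↦ J(x) p`. -/
noncomputable def extend : BalTensor ρ δ.lmulP →ₗ[k] U :=
  δ.modMul 𝓤.isRightMul ∘ₗ BalTensor.mapLeft δ.lmulP J hJ

theorem extend_mk (x : K) (p : P) : 𝓤.extend J hJ (BalTensor.mk _ _ x p) = 𝓤.act p (J x) := rfl

theorem exact_iff (hP : IsFaithfullyFlatLeft.{max v w} k δ.coinv P) (hρ : IsRightAction ρ)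
    {Q : Type max w v} [AddCommGroup Q] [Module k Q] {R : P →ₗ[k] Q →ₗ[k] Q} (hR : IsRightMul R)
    (g : U →ₗ[k] Q) (hg : ∀ (b : δ.coinv) x, g (𝓤.act b x) = R b (g x)) :
    Function.Exact J g ↔ Function.Exact (BalTensor.mapLeft δ.lmulP J hJ)
      (BalTensor.mapLeft δ.lmulP g hg (ρ' := fun b : δ.coinv => R (b : P))) :=
  hP.exact_iff hρ (𝓤.isRightMul.isRightAction δ.coinv) (hR.isRightAction δ.coinv) J g hJ hg

theorem injective_iff (hP : IsFaithfullyFlatLeft.{max v w} k δ.coinv P) (hρ : IsRightAction ρ) :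
    Function.Injective J ↔ Function.Injective (BalTensor.mapLeft δ.lmulP J hJ) :=
  hP.injective_iff hρ (𝓤.isRightMul.isRightAction δ.coinv) J hJ

/-- `extend` factors as J ⊗_B P followed by multiplication, so its injectivity forces that of J ⊗_B
P, and faithful flatness reflects this to J. -/
theorem injective_of_extend (hP : IsFaithfullyFlatLeft.{max v w} k δ.coinv P)
    (hρ : IsRightAction ρ) (h : Function.Injective (𝓤.extend J hJ)) : Function.Injective J :=
  (𝓤.injective_iff J hJ hP hρ).2 (Function.Injective.of_comp (f := δ.modMul 𝓤.isRightMul) h)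

/-- The map `x ↦ x₍₀₎ ⊗ x₍₁₎ - x ⊗ 1`. -/
noncomputable def coactSub : U →ₗ[k] U ⊗[k] H := 𝓤.coact - (TensorProduct.mk k U H).flip 1

theorem coactSub_apply (x : U) : 𝓤.coactSub x = 𝓤.coact x - x ⊗ₜ 1 := rfl

theorem coactSub_act (b : δ.coinv) (x : U) :
    𝓤.coactSub (𝓤.act b x) = δ.diagAct 𝓤.act b (𝓤.coactSub x) := by
  rw [coactSub_apply, coactSub_apply, coact_act, map_sub, diagAct_coinv]

/-- `coactSub ⊗_B P`. -/
noncomputable def coactSubTensor : BalTensor (fun b : δ.coinv => 𝓤.act (b : P)) δ.lmulP →ₗ[k]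
    BalTensor (fun b : δ.coinv => δ.diagAct 𝓤.act (b : P)) δ.lmulP :=
  BalTensor.mapLeft δ.lmulP 𝓤.coactSub 𝓤.coactSub_act

theorem coactSubTensor_mk (x : U) (p : P) : 𝓤.coactSubTensor (BalTensor.mk _ _ x p) =
    BalTensor.mk _ _ (𝓤.coact x) p - BalTensor.mk _ _ (x ⊗ₜ 1) p := by
  change BalTensor.mk _ _ (𝓤.coactSub x) p = _
  rw [coactSub_apply, ← BalTensor.mkₗ_apply, map_sub]
  rfl

/-- On the kernel of `coactSubTensor` this says that the Galois isomorphism equals multiplication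
followed by the coaction. That is how surjectivity of `extend` enters `exact_of_extend`. -/
theorem modMul_coactSubTensor (y : BalTensor (fun b : δ.coinv => 𝓤.act (b : P)) δ.lmulP) :
    δ.modMul (diagAct_isRightMul δ 𝓤.isRightMul) (𝓤.coactSubTensor y) =
      𝓤.coact (δ.modMul 𝓤.isRightMul y) - δ.modCan 𝓤.isRightMul y := by
  induction y using BalTensor.ind with
  | zero => simp
  | add y z hy hz => simp only [map_add, hy, hz]; abel
  | mk x p =>
    rw [coactSubTensor_mk, map_sub, modMul_mk, modMul_mk, modMul_mk, modCan_mk, coact_act]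

theorem modCan_mapLeft (hc : ∀ x, 𝓤.coact (J x) = J x ⊗ₜ 1) (y : BalTensor ρ δ.lmulP) :
    δ.modCan 𝓤.isRightMul (BalTensor.mapLeft δ.lmulP J hJ y) = 𝓤.coact (𝓤.extend J hJ y) := by
  induction y using BalTensor.ind with
  | zero => simp
  | add y z hy hz => simp only [map_add, hy, hz]
  | mk x p => rw [BalTensor.mapLeft_mk, modCan_mk, extend_mk, coact_act, hc]

/-- Exactness is tested after - ⊗_B P. If y lies in the kernel there, choose z with `extend` z equal
to the product of y; the Galois isomorphism then takes the same value on (J ⊗_B P)(z) and on y,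
namely the coaction of that product, so the two agree. -/
theorem exact_of_extend (hG : δ.IsHopfGalois) (hP : IsFaithfullyFlatLeft.{max v w} k δ.coinv P)
    (hρ : IsRightAction ρ) (hc : ∀ x, 𝓤.coact (J x) = J x ⊗ₜ 1)
    (h : Function.Surjective (𝓤.extend J hJ)) : Function.Exact J 𝓤.coactSub := by
  refine (𝓤.exact_iff J hJ hP hρ (diagAct_isRightMul δ 𝓤.isRightMul) 𝓤.coactSub
    𝓤.coactSub_act).2 fun y => ⟨fun hy => ?_, ?_⟩
  · obtain ⟨z, hz⟩ := h (δ.modMul 𝓤.isRightMul y)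
    refine ⟨z, (δ.modCan_bijective 𝓤.isRightMul hG).1 ?_⟩
    have e := 𝓤.modMul_coactSubTensor y
    rw [show 𝓤.coactSubTensor y = 0 from hy, map_zero, eq_comm, sub_eq_zero] at e
    rw [modCan_mapLeft 𝓤 J hJ hc, hz, e]
  · rintro ⟨z, rfl⟩
    change 𝓤.coactSubTensor _ = 0
    induction z using BalTensor.ind with
    | zero => simp
    | add y z hy hz => simp only [map_add, hy, hz, add_zero]
    | mk x p => rw [BalTensor.mapLeft_mk, coactSubTensor_mk, hc, sub_self]

/-- The coaction composed with `extend` is J ⊗_B P followed by the Galois isomorphism, and both of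
these are injective, the former by flatness. -/
theorem extend_injective (hG : δ.IsHopfGalois) (hP : IsFaithfullyFlatLeft.{max v w} k δ.coinv P)
    (hρ : IsRightAction ρ) (hc : ∀ x, 𝓤.coact (J x) = J x ⊗ₜ 1) (h : Function.Injective J) :
    Function.Injective (𝓤.extend J hJ) := by
  refine Function.Injective.of_comp (f := 𝓤.coact) ?_
  rw [show 𝓤.coact ∘ 𝓤.extend J hJ = δ.modCan 𝓤.isRightMul ∘ BalTensor.mapLeft δ.lmulP J hJ from
    funext fun y => (modCan_mapLeft 𝓤 J hJ hc y).symm]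
  exact (δ.modCan_bijective 𝓤.isRightMul hG).1.comp ((𝓤.injective_iff J hJ hP hρ).1 h)

/-- Under the Galois isomorphisms of U and of U ⊗ H, the map `coactSubTensor` becomes the failure of
coassociativity on U ⊗ H. The term with x ⊗ 1 is handled by coassociativity of the coaction of P. -/
theorem modCan_coact (y : BalTensor (fun b : δ.coinv => 𝓤.act (b : P)) δ.lmulP) :
    δ.modCan (diagAct_isRightMul δ 𝓤.isRightMul) (𝓤.coactSubTensor y) =
      𝓤.coact.rTensor H (δ.modCan 𝓤.isRightMul y) - (TensorProduct.assoc k U H H).symm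
        ((Coalgebra.comul (R := k) (A := H)).lTensor U (δ.modCan 𝓤.isRightMul y)) := by
  induction y using BalTensor.ind with
  | zero => simp
  | add y z hy hz => simp only [map_add, hy, hz]; abel
  | mk x p =>
    rw [coactSubTensor_mk, map_sub, modCan_mk, modCan_mk, modCan_mk]
    congr 1
    · simp only [diagAct_apply]
      generalize δ.coact p = z
      induction z using TensorProduct.induction_on with
      | zero => simp
      | add y z hy hz => simp only [map_add, LinearMap.add_apply, hy, hz]
      | tmul q h => rw [actTensor_tmul, actTensor_tmul, LinearMap.rTensor_tmul, coact_act]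
    -- G is q ⊗ h ↦ x q ⊗ h; applied to the first two legs of the iterated coaction of p, it gives x
    -- p₍₀₎ ⊗ p₍₁₎ ⊗ p₍₂₎.
    · let G : P ⊗[k] H →ₗ[k] U ⊗[k] H :=
        (actTensor H 𝓤.act).flip (x ⊗ₜ 1)
      have h₁ : δ.diagAct (δ.diagAct 𝓤.act) p ((x ⊗ₜ[k] (1 : H)) ⊗ₜ[k] (1 : H)) =
          G.rTensor H (δ.coact.toLinearMap.rTensor H (δ.coact p)) := by
        rw [diagAct_apply]
        generalize δ.coact p = z
        induction z using TensorProduct.induction_on with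
        | zero => simp
        | add y z hy hz => simp only [map_add, LinearMap.add_apply, hy, hz]
        | tmul q h => rw [actTensor_tmul, one_mul]; rfl
      have h₂ := δ.coassoc p
      rw [← LinearEquiv.eq_symm_apply] at h₂
      rw [h₁, h₂, diagAct_apply]
      generalize δ.coact p = z
      induction z using TensorProduct.induction_on with
      | zero => simp
      | add y z hy hz => simp only [map_add, LinearMap.add_apply, hy, hz]
      | tmul q h =>
        rw [actTensor_tmul, one_mul, LinearMap.lTensor_tmul, LinearMap.lTensor_tmul]
        generalize (Coalgebra.comul (R := k) h) = z
        induction z using TensorProduct.induction_on with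
        | zero => simp
        | add y z hy hz => simp only [TensorProduct.tmul_add, map_add, hy, hz]
        | tmul a b => simp [G]

/-- Let y correspond to the coaction of z under the Galois isomorphism. Coassociativity at z puts y
in the kernel of `coactSubTensor`, so y comes from K ⊗_B P by flatness; multiplying out and using
counitality at z returns z. Only conditions at z appear because `HopfMod` does not require a
comodule. -/
theorem mem_range_extend (hG : δ.IsHopfGalois) (hP : IsFaithfullyFlatLeft.{max v w} k δ.coinv P)
    (hρ : IsRightAction ρ) (h : Function.Exact J 𝓤.coactSub) (z : U)
    (hz : 𝓤.coact.rTensor H (𝓤.coact z) = (TensorProduct.assoc k U H H).symm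
        ((Coalgebra.comul (R := k) (A := H)).lTensor U (𝓤.coact z)))
    (hz' : TensorProduct.rid k U ((Coalgebra.counit (R := k) (A := H)).lTensor U (𝓤.coact z)) = z) :
    z ∈ LinearMap.range (𝓤.extend J hJ) := by
  obtain ⟨y, hy⟩ := (δ.modCan_bijective 𝓤.isRightMul hG).2 (𝓤.coact z)
  have h0 : 𝓤.coactSubTensor y = 0 := by
    apply (δ.modCan_bijective (diagAct_isRightMul δ 𝓤.isRightMul) hG).1
    rw [modCan_coact, hy, hz, sub_self, map_zero]
  obtain ⟨t, ht⟩ := ((𝓤.exact_iff J hJ hP hρ (diagAct_isRightMul δ 𝓤.isRightMul) 𝓤.coactSub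
    𝓤.coactSub_act).1 h y).1 h0
  refine ⟨t, ?_⟩
  rw [← hz', ← hy, rid_modCan, ← ht]
  rfl

end HopfMod

end RightComoduleAlgebra

/-! ### Right actions of B on 𝓛 and on balanced tensor products. -/

theorem BeRing.isRightAction_t {k B L : Type*} [CommRing k] [Ring B] [Algebra k B] [Ring L]
    [Algebra k L] (E : BeRing k B L) :
    IsRightAction (fun b : B => LinearMap.mulLeft k (E.t (op b))) where
  one m := by simp
  mul a b m := by simp
  add a b m := by simp [add_mul]
  smul c b m := by simp

theorem IsRightAction.actRight {k B M N : Type*} [CommRing k] [Ring B] [Algebra k B]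
    [AddCommGroup M] [Module k M] [AddCommGroup N] [Module k N] {ρ : B → M →ₗ[k] M}
    {σ α : B → N →ₗ[k] N} (hα : ∀ c b n, α c (σ b n) = σ b (α c n)) (h : IsRightAction α) :
    IsRightAction (fun c => BalTensor.actRight ρ σ (α c) (hα c)) where
  one x := by
    induction x using BalTensor.ind with
    | zero => simp
    | add x y hx hy => rw [map_add, hx, hy]
    | mk m n => rw [BalTensor.actRight_mk, h.one]
  mul a b x := by
    induction x using BalTensor.ind with
    | zero => simp
    | add x y hx hy => simp only [map_add, hx, hy]
    | mk m n => simp only [BalTensor.actRight_mk, h.mul]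
  add a b x := by
    induction x using BalTensor.ind with
    | zero => simp
    | add x y hx hy => simp only [map_add, hx, hy]; abel
    | mk m n =>
      simp only [BalTensor.actRight_mk, h.add]
      simp only [← BalTensor.mkₗ_apply, map_add]
  smul a b x := by
    induction x using BalTensor.ind with
    | zero => simp
    | add x y hx hy => simp only [map_add, hx, hy, smul_add]
    | mk m n =>
      simp only [BalTensor.actRight_mk, h.smul]
      simp only [← BalTensor.mkₗ_apply, map_smul]

namespace RightComoduleAlgebra

variable {k : Type u} {H : Type v} {P : Type w} [Field k] [Ring H] [HopfAlgebra k H] [Ring P]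
  [Algebra k P] (δ : RightComoduleAlgebra k H P)

/-! ### The isomorphism 𝓛 ⊗_B P ≅ P ⊗ P. -/

/-- `P ⊗ P` as a right `P`-module, by multiplication on the right factor, with the diagonal
coaction. -/
noncomputable def pairMod : δ.HopfMod (Pair k P) where
  act := LinearMap.mul k (Pair k P) ∘ₗ (Pair.ofTensor k P).toLinearMap ∘ₗ TensorProduct.mk k P P 1
  isRightMul := by
    refine ⟨fun x => one_mul x, fun p q x => ?_⟩
    change Pair.tmul k 1 (p * q) * x = Pair.tmul k 1 q * (Pair.tmul k 1 p * x)
    rw [← mul_assoc, Pair.tmul_mul_tmul, one_mul]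
  coact := δ.diagCoact
  coact_act p x := by
    change δ.diagCoact (Pair.tmul k 1 p * x) = _
    rw [diagCoact_tmul_mul, diagAct_apply, map_one, Algebra.TensorProduct.one_def]
    generalize δ.diagCoact x = y
    induction y using TensorProduct.induction_on with
    | zero => simp
    | add y z hy hz => simp only [map_add, hy, hz]
    | tmul X m =>
    generalize δ.coact p = z
    induction z using TensorProduct.induction_on with
    | zero => simp
    | add y z hy hz => simp only [map_add, LinearMap.add_apply, hy, hz]
    | tmul q h => rw [sandwich_tmul, actTensor_tmul, one_mul]; rfl

theorem pairMod_act (p : P) (X : Pair k P) : δ.pairMod.act p X = Pair.tmul k 1 p * X := rfl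

theorem pairMod_coact (X : Pair k P) : δ.pairMod.coact X = δ.diagCoact X := rfl

/-- The right action `X.b = t(b) X` of `B` on `𝓛`. -/
noncomputable abbrev esAct (b : δ.coinv) : δ.ES →ₗ[k] δ.ES := LinearMap.mulLeft k (δ.esRing.t (op b))

/-- The inclusion of `𝓛` in `P ⊗ P`. -/
noncomputable abbrev esVal : δ.ES →ₗ[k] Pair k P := δ.ES.val.toLinearMap

theorem esVal_esAct (b : δ.coinv) (X : δ.ES) :
    δ.esVal (δ.esAct b X) = δ.pairMod.act b (δ.esVal X) := rfl

/-- The map `𝓛 ⊗_B P → P ⊗ P`, `(p ⊗ q) ⊗ r ↦ p ⊗ q r`. -/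
noncomputable def esExtend : BalTensor δ.esAct δ.lmulP →ₗ[k] Pair k P :=
  δ.pairMod.extend δ.esVal δ.esVal_esAct

theorem esExtend_mk (X : δ.ES) (p : P) :
    δ.esExtend (BalTensor.mk _ _ X p) = Pair.tmul k 1 p * X := rfl

theorem esVal_exact : Function.Exact δ.esVal δ.pairMod.coactSub := by
  intro X
  rw [HopfMod.coactSub_apply, sub_eq_zero]
  exact ⟨fun h => ⟨⟨X, h⟩, rfl⟩, fun ⟨Y, hY⟩ => hY ▸ Y.2⟩

theorem diagCoact_tmul_one (p : P) : δ.diagCoact (Pair.tmul k p 1) =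
    ((Pair.ofTensor k P).toLinearMap ∘ₗ (TensorProduct.mk k P P).flip 1).rTensor H
      (δ.coact p) := by
  rw [diagCoact_tmul, map_one, Algebra.TensorProduct.one_def]
  generalize δ.coact p = y
  induction y using TensorProduct.induction_on with
  | zero => simp
  | add y z hy hz => simp only [TensorProduct.add_tmul, map_add, hy, hz]
  | tmul q h => rw [diagMerge_tmul, mul_one]; rfl

/-- It suffices to reach p ⊗ 1, since the range is stable under right multiplication by P. On these
elements the diagonal coaction is just that of P, so coassociativity and counitality are inherited.
-/
theorem esExtend_surjective (hG : δ.IsHopfGalois)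
    (hP : IsFaithfullyFlatLeft.{max v w} k δ.coinv P) : Function.Surjective δ.esExtend := by
  intro X
  change X ∈ LinearMap.range δ.esExtend
  induction X using Pair.induction with
  | zero => exact zero_mem _
  | add X Y hX hY => exact add_mem hX hY
  | tmul p q =>
    have h : Pair.tmul k p 1 ∈ LinearMap.range δ.esExtend := by
      refine δ.pairMod.mem_range_extend δ.esVal δ.esVal_esAct hG hP δ.esRing.isRightAction_t
        δ.esVal_exact _ ?_ ?_
      · simp only [pairMod_coact, diagCoact_tmul_one]
        set j := (Pair.ofTensor k P).toLinearMap ∘ₗ (TensorProduct.mk k P P).flip 1 with hj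
        have h₁ : ∀ y : P ⊗[k] H, δ.pairMod.coact.rTensor H (j.rTensor H y) =
            (j.rTensor H).rTensor H (δ.coact.toLinearMap.rTensor H y) := by
          intro y
          induction y using TensorProduct.induction_on with
          | zero => simp
          | add y z hy hz => simp only [map_add, hy, hz]
          | tmul q h =>
            simp only [LinearMap.rTensor_tmul]
            exact congrArg (· ⊗ₜ h) (δ.diagCoact_tmul_one q)
        have h₂ := δ.coassoc p
        rw [← LinearEquiv.eq_symm_apply] at h₂
        rw [h₁, h₂]
        generalize δ.coact p = y
        induction y using TensorProduct.induction_on with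
        | zero => simp
        | add y z hy hz => simp only [map_add, hy, hz]
        | tmul q h =>
          rw [LinearMap.lTensor_tmul, LinearMap.rTensor_tmul, LinearMap.lTensor_tmul]
          generalize (Coalgebra.comul (R := k) h) = z
          induction z using TensorProduct.induction_on with
          | zero => simp
          | add y z hy hz => simp only [TensorProduct.tmul_add, map_add, hy, hz]
          | tmul a b => simp
      · rw [pairMod_coact, diagCoact_tmul_one]
        conv_rhs => rw [← δ.counit p]
        generalize δ.coact p = y
        induction y using TensorProduct.induction_on with
        | zero => simp [Pair.tmul]
        | add y z hy hz => simp only [map_add, hy, hz, Pair.add_tmul]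
        | tmul q h => simp [Pair.tmul, ← map_smul, TensorProduct.smul_tmul']
    obtain ⟨y, hy⟩ := h
    clear * - hy
    -- The range is a right P-submodule: the factor q is absorbed into the P-leg of 𝓛 ⊗_B P.
    have key : ∀ y : BalTensor δ.esAct δ.lmulP,
        Pair.tmul k 1 q * δ.esExtend y ∈ LinearMap.range δ.esExtend := by
      intro y
      induction y using BalTensor.ind with
      | zero => simp
      | add y z hy hz => rw [map_add, mul_add]; exact add_mem hy hz
      | mk X r =>
        refine ⟨BalTensor.mk _ _ X (r * q), ?_⟩
        rw [esExtend_mk, esExtend_mk, ← mul_assoc, Pair.tmul_mul_tmul, one_mul]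
    have := key y
    rwa [hy, Pair.tmul_mul_tmul, one_mul, one_mul] at this

theorem esExtend_bijective (hG : δ.IsHopfGalois)
    (hP : IsFaithfullyFlatLeft.{max v w} k δ.coinv P) : Function.Bijective δ.esExtend :=
  ⟨δ.pairMod.extend_injective δ.esVal δ.esVal_esAct hG hP δ.esRing.isRightAction_t
    (fun X => X.2) Subtype.val_injective, δ.esExtend_surjective hG hP⟩

/-! ### Tensoring a Hopf module with P and descending to K ⊗_B 𝓛. -/

/-- The map `(x ⊗ h) ⊗ (c ⊗ g) ↦ (x ⊗ c) ⊗ h g`. -/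
noncomputable def merge (H P U : Type*) [Ring H] [Algebra k H] [Ring P] [Algebra k P]
    [AddCommGroup U] [Module k U] : U ⊗[k] H →ₗ[k] P ⊗[k] H →ₗ[k] (U ⊗[k] P) ⊗[k] H :=
  TensorProduct.curry (TensorProduct.map .id (LinearMap.mul' k H) ∘ₗ
    (TensorProduct.tensorTensorTensorComm k U H P H).toLinearMap)

@[simp] theorem merge_tmul {U : Type*} [AddCommGroup U] [Module k U] (x : U) (h g : H) (c : P) :
    merge (k := k) H P U (x ⊗ₜ h) (c ⊗ₜ g) = (x ⊗ₜ c) ⊗ₜ (h * g) := rfl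

namespace HopfMod

variable {δ} {U K W : Type w} [AddCommGroup U] [Module k U] [AddCommGroup K] [Module k K]
  [AddCommGroup W] [Module k W] (𝓤 : δ.HopfMod U)

/-- The Hopf module `U ⊗ P`, with `P` acting on the right factor and the diagonal coaction. -/
noncomputable def tensor : δ.HopfMod (U ⊗[k] P) where
  act := LinearMap.lTensorHom U ∘ₗ (LinearMap.mul k P).flip
  isRightMul := by
    refine ⟨fun x => ?_, fun p q x => ?_⟩
    · induction x using TensorProduct.induction_on with
      | zero => simp
      | add x y hx hy => rw [map_add, hx, hy]
      | tmul x c => simp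
    · induction x using TensorProduct.induction_on with
      | zero => simp
      | add x y hx hy => simp only [map_add, hx, hy]
      | tmul x c => simp [mul_assoc]
  coact := TensorProduct.lift ((merge H P U).compl₁₂ 𝓤.coact δ.coact.toLinearMap)
  coact_act p x := by
    induction x using TensorProduct.induction_on with
    | zero => simp
    | add x y hx hy => simp only [map_add, hx, hy]
    | tmul x c =>
      change merge H P U (𝓤.coact x) (δ.coact (c * p)) = actTensor H
        (LinearMap.lTensorHom U ∘ₗ (LinearMap.mul k P).flip) (δ.coact p)
          (merge H P U (𝓤.coact x) (δ.coact c))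
      rw [map_mul]
      generalize δ.coact c = a
      generalize δ.coact p = b
      generalize 𝓤.coact x = y
      induction y using TensorProduct.induction_on with
      | zero => simp
      | add x y hx hy => simp only [map_add, LinearMap.add_apply, hx, hy]
      | tmul x h =>
      induction a using TensorProduct.induction_on with
      | zero => simp
      | add x y hx hy => simp only [map_add, add_mul, hx, hy]
      | tmul c g =>
      induction b using TensorProduct.induction_on with
      | zero => simp
      | add x y hx hy => simp only [map_add, mul_add, LinearMap.add_apply, hx, hy]
      | tmul p h' => simp [mul_assoc]

theorem tensor_act_tmul (p c : P) (x : U) : 𝓤.tensor.act p (x ⊗ₜ c) = x ⊗ₜ (c * p) := rfl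

theorem tensor_coact_tmul (c : P) (x : U) :
    𝓤.tensor.coact (x ⊗ₜ c) = merge H P U (𝓤.coact x) (δ.coact c) := rfl

/-- The map `x ↦ (a ⊗ c ↦ x a ⊗ c)`. -/
noncomputable def pairAct : U →ₗ[k] Pair k P →ₗ[k] U ⊗[k] P :=
  LinearMap.lcomp k (U ⊗[k] P) (Pair.ofTensor k P).symm.toLinearMap ∘ₗ
    LinearMap.rTensorHom P ∘ₗ 𝓤.act.flip

@[simp] theorem pairAct_tmul (x : U) (a c : P) :
    𝓤.pairAct x (Pair.tmul k a c) = 𝓤.act a x ⊗ₜ c := by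
  simp [pairAct, Pair.tmul]

theorem pairAct_act (b : δ.coinv) (x : U) (X : Pair k P) :
    𝓤.pairAct (𝓤.act b x) X = 𝓤.pairAct x (δ.pairRing.s b * X) := by
  induction X using Pair.induction with
  | zero => simp
  | add X Y hX hY => simp only [mul_add, map_add, hX, hY]
  | tmul a c => rw [pairRing_s, Pair.tmul_mul_tmul, pairAct_tmul, pairAct_tmul, mul_one,
      𝓤.isRightMul.mul]

theorem pairAct_mul (p : P) (x : U) (X : Pair k P) :
    𝓤.pairAct x (Pair.tmul k 1 p * X) = 𝓤.tensor.act p (𝓤.pairAct x X) := by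
  induction X using Pair.induction with
  | zero => simp
  | add X Y hX hY => simp only [mul_add, map_add, hX, hY]
  | tmul a c => rw [Pair.tmul_mul_tmul, pairAct_tmul, pairAct_tmul, one_mul, tensor_act_tmul]

/-- A coinvariant x contributes only 1 ∈ H, so inserting it in front of a ⊗ c intertwines the
coactions; coinvariance of K ⊗_B 𝓛 in U ⊗ P follows. -/
theorem coact_pairAct (x : U) (hx : 𝓤.coact x = x ⊗ₜ 1) (X : Pair k P) :
    𝓤.tensor.coact (𝓤.pairAct x X) = (𝓤.pairAct x).rTensor H (δ.diagCoact X) := by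
  induction X using Pair.induction with
  | zero => simp
  | add X Y hX hY => simp only [map_add, hX, hY]
  | tmul a c =>
    rw [pairAct_tmul, tensor_coact_tmul, coact_act, hx, diagAct_apply, diagCoact_tmul]
    generalize δ.coact a = y
    generalize δ.coact c = z
    induction y using TensorProduct.induction_on with
    | zero => simp
    | add y z hy hz => simp only [map_add, LinearMap.add_apply, TensorProduct.add_tmul, hy, hz]
    | tmul a h =>
    induction z using TensorProduct.induction_on with
    | zero => simp
    | add y z hy hz => simp only [map_add, TensorProduct.tmul_add, hy, hz]
    | tmul c g => simp [diagMerge_tmul]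

section TensorMap

variable {ρ : δ.coinv → K →ₗ[k] K} (J : K →ₗ[k] U) (hJ : ∀ b x, J (ρ b x) = 𝓤.act b (J x))
  {σ : δ.coinv → W →ₗ[k] W} (ι : W →ₗ[k] Pair k P)
  (hι : ∀ b x, ι (σ b x) = δ.pairRing.s b * ι x)

/-- The map `x ⊗ X ↦ J(x) a ⊗ c` for `ι(X) = a ⊗ c`. -/
noncomputable def tensorMap : BalTensor ρ σ →ₗ[k] U ⊗[k] P :=
  BalTensor.lift₂ (𝓤.pairAct.compl₁₂ J ι) (fun b x X => by
    simp only [LinearMap.compl₁₂_apply, hJ, hι, pairAct_act])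

end TensorMap

section ES

variable {ρ : δ.coinv → K →ₗ[k] K} (J : K →ₗ[k] U) (hJ : ∀ b x, J (ρ b x) = 𝓤.act b (J x))

/-- Left multiplication by `s(b)` on `𝓛`. -/
noncomputable abbrev esLeft (b : δ.coinv) : δ.ES →ₗ[k] δ.ES := LinearMap.mulLeft k (δ.esRing.s b)

theorem esAct_esLeft (c b : δ.coinv) (X : δ.ES) :
    δ.esAct c (esLeft b X) = esLeft b (δ.esAct c X) := by
  simp [← mul_assoc, δ.esRing.comm]

/-- The map `K ⊗_B 𝓛 → U ⊗ P`, `x ⊗ (a ⊗ c) ↦ J(x) a ⊗ c`. -/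
noncomputable def tensorES : BalTensor ρ (esLeft (δ := δ)) →ₗ[k] U ⊗[k] P :=
  𝓤.tensorMap J hJ δ.esVal (fun _ _ => rfl)

theorem tensorES_mk (x : K) (X : δ.ES) :
    𝓤.tensorES J hJ (BalTensor.mk ρ esLeft x X) = 𝓤.pairAct (J x) X := rfl

/-- The right action of `B` on `K ⊗_B 𝓛`. -/
noncomputable abbrev tensorESAct (ρ : δ.coinv → K →ₗ[k] K) (b : δ.coinv) :
    BalTensor ρ (esLeft (δ := δ)) →ₗ[k] BalTensor ρ (esLeft (δ := δ)) :=
  BalTensor.actRight ρ esLeft (δ.esAct b) (esAct_esLeft b)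

theorem tensorES_act (b : δ.coinv) (x : BalTensor ρ (esLeft (δ := δ))) :
    𝓤.tensorES J hJ (tensorESAct ρ b x) = 𝓤.tensor.act b (𝓤.tensorES J hJ x) := by
  induction x using BalTensor.ind with
  | zero => simp
  | add x y hx hy => simp only [map_add, hx, hy]
  | mk x X =>
    rw [BalTensor.actRight_mk, tensorES_mk, tensorES_mk, ← pairAct_mul]
    rfl

theorem tensorES_coact (hc : ∀ x, 𝓤.coact (J x) = J x ⊗ₜ 1)
    (x : BalTensor ρ (esLeft (δ := δ))) :
    𝓤.tensor.coact (𝓤.tensorES J hJ x) = 𝓤.tensorES J hJ x ⊗ₜ 1 := by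
  induction x using BalTensor.ind with
  | zero => simp
  | add x y hx hy => simp only [map_add, TensorProduct.add_tmul, hx, hy]
  | mk x X =>
    rw [tensorES_mk, coact_pairAct _ _ (hc x), X.2, LinearMap.rTensor_tmul]

theorem rTensor_extend_insertLeft (x : K) (X : Pair k P) :
    (𝓤.extend J hJ).rTensor P (BalTensor.insertLeft ρ δ.lmulP P x ((Pair.ofTensor k P).symm X)) =
      𝓤.pairAct (J x) X := by
  induction X using Pair.induction with
  | zero => simp
  | add X Y hX hY => simp only [map_add, hX, hY]
  | tmul a c =>
    rw [Pair.tmul, LinearEquiv.symm_apply_apply, BalTensor.insertLeft_tmul,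
      LinearMap.rTensor_tmul, extend_mk, ← pairAct_tmul, Pair.tmul]

/-- The isomorphism `𝓛 ⊗_B P ≃ P ⊗ P`. -/
noncomputable def esEquiv (hE : Function.Bijective δ.esExtend) :
    BalTensor δ.esAct δ.lmulP ≃ₗ[k] P ⊗[k] P :=
  (LinearEquiv.ofBijective δ.esExtend hE).trans (Pair.ofTensor k P).symm

theorem esEquiv_mk (hE : Function.Bijective δ.esExtend) (X : δ.ES) (p : P) :
    esEquiv hE (BalTensor.mk _ _ X p) = (Pair.ofTensor k P).symm (Pair.tmul k 1 p * X) := rfl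

theorem ofTensor_symm_s_mul (b : δ.coinv) (X : Pair k P) :
    (Pair.ofTensor k P).symm (δ.pairRing.s b * X) =
      (δ.lmulP b).rTensor P ((Pair.ofTensor k P).symm X) := by
  induction X using Pair.induction with
  | zero => simp
  | add X Y hX hY => simp only [mul_add, map_add, hX, hY]
  | tmul a c => rw [pairRing_s, Pair.tmul_mul_tmul]; simp [Pair.tmul]

theorem esEquiv_left (hE : Function.Bijective δ.esExtend) (b : δ.coinv) (X : δ.ES) (p : P) :
    esEquiv hE (BalTensor.mk _ _ (esLeft b X) p) =
      (δ.lmulP b).rTensor P (esEquiv hE (BalTensor.mk _ _ X p)) := by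
  rw [esEquiv_mk, esEquiv_mk, ← ofTensor_symm_s_mul]
  congr 1
  change _ * (δ.pairRing.s b * (X : Pair k P)) = _
  rw [← mul_assoc, ← mul_assoc, pairRing_s, Pair.tmul_mul_tmul, Pair.tmul_mul_tmul]
  simp

/-- Induction step for iterated tensor products: the map is (K ⊗_B 𝓛) ⊗_B P ≅ (K ⊗_B P) ⊗ P,
obtained by collapsing 𝓛 ⊗_B P ≅ P ⊗ P, followed by K ⊗_B P ≅ U on the left factor. -/
theorem extend_tensorES_bijective (hE : Function.Bijective δ.esExtend)
    (h : Function.Bijective (𝓤.extend J hJ)) : Function.Bijective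
      (𝓤.tensor.extend (𝓤.tensorES J hJ) (ρ := tensorESAct ρ) (𝓤.tensorES_act J hJ)) := by
  have e : 𝓤.tensor.extend (𝓤.tensorES J hJ) (ρ := tensorESAct ρ) (𝓤.tensorES_act J hJ) =
      (LinearEquiv.rTensor P (LinearEquiv.ofBijective _ h)).toLinearMap ∘ₗ
        BalTensor.collapseFun ρ esLeft δ.esAct δ.lmulP δ.lmulP esAct_esLeft (esEquiv hE)
          (esEquiv_left hE) := by
    refine BalTensor.hom_ext fun x p => ?_
    induction x using BalTensor.ind with
    | zero => simp
    | add x y hx hy => simp only [TensorProduct.add_tmul, map_add, hx, hy]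
    | mk x X =>
      -- Both composites send (x ⊗ X) ⊗ p to the value of `pairAct` at J(x) and (1 ⊗ p)X.
      exact ((𝓤.pairAct_mul p (J x) X).symm).trans
        (𝓤.rTensor_extend_insertLeft J hJ x (Pair.tmul k 1 p * X)).symm
  rw [e]
  exact (LinearEquiv.rTensor P (LinearEquiv.ofBijective _ h)).bijective.comp
    (BalTensor.collapseFun_bijective _ _ _ _ _ _ _ _)

end ES

end HopfMod

/-! ### Embeddings of 𝓛 ⊗_B 𝓛 and of the triple product in tensor powers of P. -/

open HopfMod

/-- The map `𝓛 ⊗_B 𝓛 → P ⊗ P ⊗ P`, `(p ⊗ q) ⊗ (a ⊗ c) ↦ p ⊗ q a ⊗ c`. -/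
noncomputable def tensMap : δ.esRing.Tens →ₗ[k] Pair k P ⊗[k] P :=
  δ.pairMod.tensorES (ρ := δ.esAct) δ.esVal δ.esVal_esAct

theorem tensMap_tmul (X Y : δ.ES) :
    δ.tensMap (δ.esRing.tmul X Y) = δ.pairMod.pairAct (X : Pair k P) (Y : Pair k P) := rfl

theorem tensMap_rightAct (b : δ.coinv) (x : δ.esRing.Tens) :
    δ.tensMap (δ.esRing.rightAct b x) = δ.pairMod.tensor.act b (δ.tensMap x) :=
  δ.pairMod.tensorES_act (ρ := δ.esAct) δ.esVal δ.esVal_esAct b x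

theorem tensMap_coact (x : δ.esRing.Tens) :
    δ.pairMod.tensor.coact (δ.tensMap x) = δ.tensMap x ⊗ₜ 1 :=
  δ.pairMod.tensorES_coact (ρ := δ.esAct) δ.esVal δ.esVal_esAct (fun X => X.2) x

theorem tens_isRightAction : IsRightAction (fun b => δ.esRing.rightAct b) :=
  IsRightAction.actRight (ρ := δ.esAct) (σ := esLeft) esAct_esLeft δ.esRing.isRightAction_t

theorem tensMap_extend_bijective (hE : Function.Bijective δ.esExtend) :
    Function.Bijective (δ.pairMod.tensor.extend δ.tensMap δ.tensMap_rightAct) :=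
  δ.pairMod.extend_tensorES_bijective (ρ := δ.esAct) δ.esVal δ.esVal_esAct hE hE

theorem tensMap_injective (hG : δ.IsHopfGalois)
    (hP : IsFaithfullyFlatLeft.{max v w} k δ.coinv P) : Function.Injective δ.tensMap :=
  injective_of_extend _ _ δ.tensMap_rightAct hP δ.tens_isRightAction
    (δ.tensMap_extend_bijective (δ.esExtend_bijective hG hP)).1

/-- The image of 𝓛 ⊗_B 𝓛 is all of (P ⊗ P ⊗ P)^{co H}. Both the existence of the coproduct and the
surjectivity of λ rest on this. -/
theorem tensMap_exact (hG : δ.IsHopfGalois)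
    (hP : IsFaithfullyFlatLeft.{max v w} k δ.coinv P) :
    Function.Exact δ.tensMap δ.pairMod.tensor.coactSub :=
  exact_of_extend _ _ δ.tensMap_rightAct hG hP δ.tens_isRightAction δ.tensMap_coact
    (δ.tensMap_extend_bijective (δ.esExtend_bijective hG hP)).2

/-- The map `(𝓛 ⊗_B 𝓛) ⊗_B 𝓛 → P ⊗ P ⊗ P ⊗ P`. -/
noncomputable def tensLMap : δ.esRing.TensL →ₗ[k] (Pair k P ⊗[k] P) ⊗[k] P :=
  δ.pairMod.tensor.tensorES (ρ := δ.esRing.rightAct) δ.tensMap δ.tensMap_rightAct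

theorem tensLMap_mk (x : δ.esRing.Tens) (X : δ.ES) :
    δ.tensLMap (BalTensor.proj _ _ (x ⊗ₜ X)) =
      δ.pairMod.tensor.pairAct (δ.tensMap x) (X : Pair k P) := rfl

/-- Second round of the induction, with U = P ⊗ P ⊗ P and K = 𝓛 ⊗_B 𝓛. -/
theorem tensLMap_injective (hG : δ.IsHopfGalois)
    (hP : IsFaithfullyFlatLeft.{max v w} k δ.coinv P) : Function.Injective δ.tensLMap :=
  injective_of_extend _ _ (δ.pairMod.tensor.tensorES_act (ρ := δ.esRing.rightAct) δ.tensMap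
      δ.tensMap_rightAct) hP
    (IsRightAction.actRight (ρ := δ.esRing.rightAct) (σ := esLeft) esAct_esLeft
      δ.esRing.isRightAction_t)
    (δ.pairMod.tensor.extend_tensorES_bijective (ρ := δ.esRing.rightAct) δ.tensMap
      δ.tensMap_rightAct (δ.esExtend_bijective hG hP)
      (δ.tensMap_extend_bijective (δ.esExtend_bijective hG hP))).1

theorem tensMap_leftAct (b : δ.coinv) (x : δ.esRing.Tens) :
    δ.tensMap (δ.esRing.leftAct b x) =
      (LinearMap.mulLeft k (δ.pairRing.s b)).rTensor P (δ.tensMap x) := by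
  induction x using BalTensor.ind with
  | zero => simp
  | add x y hx hy => simp only [map_add, hx, hy]
  | mk X Y =>
    change δ.pairMod.pairAct (δ.pairRing.s b * (X : Pair k P)) (Y : Pair k P) =
      (LinearMap.mulLeft k (δ.pairRing.s b)).rTensor P
        (δ.pairMod.pairAct (X : Pair k P) (Y : Pair k P))
    generalize (Y : Pair k P) = Z
    induction Z using Pair.induction with
    | zero => simp
    | add x y hx hy => simp only [map_add, hx, hy]
    | tmul a c =>
      rw [pairAct_tmul, pairAct_tmul, LinearMap.rTensor_tmul, pairMod_act, pairMod_act, pairRing_s,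
        LinearMap.mulLeft_apply, ← mul_assoc, ← mul_assoc, Pair.tmul_mul_tmul, Pair.tmul_mul_tmul]
      simp

/-- The map `𝓛 ⊗_B (𝓛 ⊗_B 𝓛) → P ⊗ P ⊗ P ⊗ P`. -/
noncomputable def tensRMap : δ.esRing.TensR →ₗ[k] (Pair k P ⊗[k] P) ⊗[k] P :=
  BalTensor.lift₂ ((LinearMap.rTensorHom P ∘ₗ δ.pairMod.pairAct).compl₁₂ δ.esVal δ.tensMap) (by
    intro b X x
    change (δ.pairMod.pairAct (δ.pairMod.act b (X : Pair k P))).rTensor P (δ.tensMap x) =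
      (δ.pairMod.pairAct (X : Pair k P)).rTensor P (δ.tensMap (δ.esRing.leftAct b x))
    rw [tensMap_leftAct, ← LinearMap.rTensor_comp_apply]
    congr 2
    exact LinearMap.ext fun Y => pairAct_act _ b _ Y)

theorem tensRMap_mk (X : δ.ES) (x : δ.esRing.Tens) :
    δ.tensRMap (BalTensor.proj _ _ (X ⊗ₜ x)) =
      (δ.pairMod.pairAct (X : Pair k P)).rTensor P (δ.tensMap x) := rfl

theorem tensRMap_assoc (x : δ.esRing.TensL) : δ.tensRMap (δ.esRing.assoc x) = δ.tensLMap x := by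
  induction x using BalTensor.ind with
  | zero => simp
  | add x y hx hy => simp only [map_add, hx, hy]
  | mk x Z =>
    induction x using BalTensor.ind with
    | zero => simp [BalTensor.mk]
    | add x y hx hy =>
      have h : BalTensor.mk (fun b => δ.esRing.rightAct b)
          (fun b => LinearMap.mulLeft k (δ.esRing.s b)) (x + y) Z =
          BalTensor.mk _ _ x Z + BalTensor.mk _ _ y Z := by
        simp only [← BalTensor.mkₗ_apply, map_add, LinearMap.add_apply]
      rw [h, map_add, map_add, map_add, hx, hy]
    | mk X Y =>
      change (δ.pairMod.pairAct (X : Pair k P)).rTensor P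
          (δ.pairMod.pairAct (Y : Pair k P) (Z : Pair k P)) =
        δ.pairMod.tensor.pairAct (δ.pairMod.pairAct (X : Pair k P) (Y : Pair k P)) (Z : Pair k P)
      generalize (Z : Pair k P) = Z
      induction Z using Pair.induction with
      | zero => simp
      | add x y hx hy => simp only [map_add, hx, hy]
      | tmul a c =>
        rw [pairAct_tmul, pairAct_tmul, LinearMap.rTensor_tmul, ← pairAct_mul, pairMod_act]

theorem assoc_surjective : Function.Surjective δ.esRing.assoc := by
  intro x
  change x ∈ LinearMap.range δ.esRing.assoc
  induction x using BalTensor.ind with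
  | zero => exact zero_mem _
  | add x y hx hy => exact add_mem hx hy
  | mk X x =>
    induction x using BalTensor.ind with
    | zero => simp [BalTensor.mk]
    | add x y hx hy =>
      rw [← BalTensor.mkₗ_apply, map_add]
      exact add_mem hx hy
    | mk Y Z => exact ⟨BalTensor.proj _ _ (δ.esRing.tmul X Y ⊗ₜ Z), rfl⟩

/-- The associator is surjective and intertwines the two maps to the fourth tensor power, so
injectivity passes from the left bracketing to the right one without an explicit inverse of the
associator. -/
theorem tensRMap_injective (hG : δ.IsHopfGalois)
    (hP : IsFaithfullyFlatLeft.{max v w} k δ.coinv P) : Function.Injective δ.tensRMap := by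
  intro x y h
  obtain ⟨x, rfl⟩ := δ.assoc_surjective x
  obtain ⟨y, rfl⟩ := δ.assoc_surjective y
  rw [tensRMap_assoc, tensRMap_assoc] at h
  rw [δ.tensLMap_injective hG hP h]

/-- The map `(P ⊗ P) ⊗_B (P ⊗ P) → P ⊗ P ⊗ P`, `(p ⊗ q) ⊗ (a ⊗ c) ↦ p ⊗ q a ⊗ c`. -/
noncomputable def pairTensMap : δ.pairRing.Tens →ₗ[k] Pair k P ⊗[k] P :=
  BalTensor.lift₂ δ.pairMod.pairAct (fun b x X => δ.pairMod.pairAct_act b x X)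

theorem pairTensMap_inclTens (x : δ.esRing.Tens) :
    δ.pairTensMap (δ.inclTens x) = δ.tensMap x := by
  induction x using BalTensor.ind with
  | zero => simp
  | add x y hx hy => simp only [map_add, hx, hy]
  | mk X Y => rfl

/-- The embedding in P ⊗ P ⊗ P makes sense on all of (P ⊗ P) ⊗_B (P ⊗ P), so it factors through the
canonical map. -/
theorem inclTens_injective (hG : δ.IsHopfGalois)
    (hP : IsFaithfullyFlatLeft.{max v w} k δ.coinv P) : Function.Injective δ.inclTens := by
  refine Function.Injective.of_comp (f := δ.pairTensMap) ?_
  rw [show δ.pairTensMap ∘ δ.inclTens = δ.tensMap from funext δ.pairTensMap_inclTens]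
  exact δ.tensMap_injective hG hP

/-! ### The parallel description of 𝓛 ⊗_{Bᵒᵖ} 𝓛. -/

section Op

/-- The isomorphism `(r ⊗ u) ⊗ p ↦ (p ⊗ r) ⊗ u`. -/
noncomputable def rotate (k : Type u) (P : Type w) [Field k] [Ring P] [Algebra k P] :
    Pair k P ⊗[k] P ≃ₗ[k] Pair k P ⊗[k] P :=
  (TensorProduct.comm k (Pair k P) P).trans
    (((Pair.ofTensor k P).symm.lTensor P).trans
      ((TensorProduct.assoc k P P P).symm.trans ((Pair.ofTensor k P).rTensor P)))

theorem rotate_tmul (r u p : P) :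
    rotate k P (Pair.tmul k r u ⊗ₜ p) = Pair.tmul k p r ⊗ₜ u := by
  simp [rotate, Pair.tmul]

/-- The map `p, r ⊗ u ↦ (p ⊗ r) ⊗ u`. -/
noncomputable def rotateMap (k : Type u) (P : Type w) [Field k] [Ring P] [Algebra k P] :
    P →ₗ[k] Pair k P →ₗ[k] Pair k P ⊗[k] P :=
  (TensorProduct.mk k (Pair k P) P).flip.compr₂ (rotate k P).toLinearMap

theorem rotateMap_apply (p : P) (X : Pair k P) : rotateMap k P p X = rotate k P (X ⊗ₜ p) := rfl

theorem rotateMap_tmul (p r u : P) :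
    rotateMap k P p (Pair.tmul k r u) = Pair.tmul k p r ⊗ₜ u := rotate_tmul r u p

theorem rotateMap_act (p q : P) (X : Pair k P) : rotateMap k P p (Pair.tmul k 1 q * X) =
    δ.pairMod.tensor.act q (rotateMap k P p X) := by
  induction X using Pair.induction with
  | zero => simp
  | add X Y hX hY => simp only [mul_add, map_add, hX, hY]
  | tmul r u =>
    rw [Pair.tmul_mul_tmul, rotateMap_tmul, rotateMap_tmul, tensor_act_tmul, one_mul]

/-- The map `(p ⊗ q), (r ⊗ u) ↦ p ⊗ r ⊗ u q`. -/
noncomputable def opMap : Pair k P →ₗ[k] Pair k P →ₗ[k] Pair k P ⊗[k] P :=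
  Pair.lift ((LinearMap.llcomp k (Pair k P) (Pair k P) (Pair k P ⊗[k] P)).compl₁₂
    (rotateMap k P) δ.pairMod.act)

theorem opMap_tmul (p q : P) (X : Pair k P) :
    δ.opMap (Pair.tmul k p q) X = rotateMap k P p (Pair.tmul k 1 q * X) := by
  rw [opMap, Pair.lift_tmul]
  rfl

theorem opMap_act (q : P) (X Y : Pair k P) :
    δ.opMap (Pair.tmul k 1 q * X) Y = δ.pairMod.tensor.act q (δ.opMap X Y) := by
  induction X using Pair.induction with
  | zero => simp
  | add X Y hX hY => simp only [mul_add, map_add, LinearMap.add_apply, hX, hY]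
  | tmul r u =>
    rw [Pair.tmul_mul_tmul, opMap_tmul, opMap_tmul, ← rotateMap_act, one_mul, ← mul_assoc,
      Pair.tmul_mul_tmul, one_mul]

theorem opMap_balanced (b : δ.coinv) (X Y : Pair k P) :
    δ.opMap (X * δ.pairRing.t (op b)) Y = δ.opMap X (δ.pairRing.t (op b) * Y) := by
  induction X using Pair.induction with
  | zero => simp
  | add X Y hX hY => simp only [add_mul, map_add, LinearMap.add_apply, hX, hY]
  | tmul r u =>
    rw [pairRing_t, Pair.tmul_mul_tmul, opMap_tmul, opMap_tmul, ← mul_assoc,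
      Pair.tmul_mul_tmul, one_mul, mul_one]

/-- The map `(x ⊗ h), (X ⊗ g) ↦ (x ⊗ X) ⊗ h g`. -/
noncomputable def rotateTensor (k : Type u) (H : Type v) (P : Type w) [Field k] [Ring H]
    [Algebra k H] [Ring P] [Algebra k P] :
    P ⊗[k] H →ₗ[k] Pair k P ⊗[k] H →ₗ[k] (Pair k P ⊗[k] P) ⊗[k] H :=
  TensorProduct.lift ((TensorProduct.mapBilinear (.id k) (Pair k P) H (Pair k P ⊗[k] P) H).compl₁₂
    (rotateMap k P) (LinearMap.mul k H))

theorem rotateTensor_tmul (p : P) (h g : H) (X : Pair k P) :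
    rotateTensor k H P (p ⊗ₜ h) (X ⊗ₜ g) = rotateMap k P p X ⊗ₜ (h * g) := rfl

theorem coact_rotateMap (p : P) (X : Pair k P) : δ.pairMod.tensor.coact (rotateMap k P p X) =
    rotateTensor k H P (δ.coact p) (δ.diagCoact X) := by
  induction X using Pair.induction with
  | zero => simp
  | add X Y hX hY => simp only [map_add, hX, hY]
  | tmul r u =>
    rw [rotateMap_tmul, tensor_coact_tmul, pairMod_coact, diagCoact_tmul, diagCoact_tmul]
    generalize δ.coact p = x
    generalize δ.coact r = y
    generalize δ.coact u = z
    induction x using TensorProduct.induction_on with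
    | zero => simp
    | add x y hx hy => simp only [map_add, LinearMap.add_apply, TensorProduct.add_tmul, hx, hy]
    | tmul p h =>
    induction y using TensorProduct.induction_on with
    | zero => simp
    | add x y hx hy => simp only [map_add, LinearMap.add_apply, TensorProduct.add_tmul,
        TensorProduct.tmul_add, hx, hy]
    | tmul r g =>
    induction z using TensorProduct.induction_on with
    | zero => simp
    | add x y hx hy => simp only [map_add, TensorProduct.tmul_add, hx, hy]
    | tmul u m =>
      rw [diagMerge_tmul, merge_tmul, diagMerge_tmul, rotateTensor_tmul, rotateMap_tmul, mul_assoc]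

/-- Y is inserted between the legs p and q of X; being coinvariant it adds 1 between p₍₁₎ and q₍₁₎,
leaving the diagonal coaction of X. This nesting is why H need not be commutative. -/
theorem coact_opMap (X Y : Pair k P) (hY : Y ∈ δ.ES) :
    δ.pairMod.tensor.coact (δ.opMap X Y) = (δ.opMap.flip Y).rTensor H (δ.diagCoact X) := by
  induction X using Pair.induction with
  | zero => simp
  | add X Z hX hZ => simp only [map_add, LinearMap.add_apply, hX, hZ]
  | tmul p q =>
    have h : δ.diagCoact (Pair.tmul k 1 q * Y) = _ := δ.pairMod.coact_act q Y
    rw [opMap_tmul, coact_rotateMap, h, pairMod_coact, hY, diagAct_apply, diagCoact_tmul]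
    generalize δ.coact p = x
    generalize δ.coact q = y
    induction x using TensorProduct.induction_on with
    | zero => simp
    | add x y hx hy => simp only [map_add, LinearMap.add_apply, TensorProduct.add_tmul, hx, hy]
    | tmul p h =>
    induction y using TensorProduct.induction_on with
    | zero => simp
    | add x y hx hy => simp only [map_add, LinearMap.add_apply, TensorProduct.tmul_add, hx, hy]
    | tmul q g =>
      rw [actTensor_tmul, rotateTensor_tmul, diagMerge_tmul, LinearMap.rTensor_tmul,
        LinearMap.flip_apply, opMap_tmul, one_mul, pairMod_act]

/-- Right multiplication by `t(b)` on `𝓛`. -/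
noncomputable abbrev esRight (b : δ.coinv) : δ.ES →ₗ[k] δ.ES :=
  LinearMap.mulRight k (δ.esRing.t (op b))

theorem esAct_esRight (c b : δ.coinv) (X : δ.ES) :
    δ.esAct c (δ.esRight b X) = δ.esRight b (δ.esAct c X) := by
  simp [mul_assoc]

/-- The map `Y ⊗ X ↦ p ⊗ r ⊗ u q` for `X = p ⊗ q` and `Y = r ⊗ u`. -/
noncomputable def opTensMap : BalTensor δ.esAct δ.esRight →ₗ[k] Pair k P ⊗[k] P :=
  BalTensor.lift₂ (δ.opMap.compl₁₂ δ.esVal δ.esVal).flip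
    (fun b Y X => (δ.opMap_balanced b (X : Pair k P) (Y : Pair k P)).symm)

theorem opTensMap_mk (X Y : δ.ES) :
    δ.opTensMap (BalTensor.mk _ _ Y X) = δ.opMap (X : Pair k P) (Y : Pair k P) := rfl

/-- The right action of `B` by `t(b)` on the factor `X` of `Y ⊗ X`. -/
noncomputable abbrev opTensAct (b : δ.coinv) :
    BalTensor δ.esAct δ.esRight →ₗ[k] BalTensor δ.esAct δ.esRight :=
  BalTensor.actRight δ.esAct δ.esRight (δ.esAct b) (δ.esAct_esRight b)

theorem opTensMap_act (b : δ.coinv) (x : BalTensor δ.esAct δ.esRight) :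
    δ.opTensMap (δ.opTensAct b x) = δ.pairMod.tensor.act b (δ.opTensMap x) := by
  induction x using BalTensor.ind with
  | zero => simp
  | add x y hx hy => simp only [map_add, hx, hy]
  | mk Y X => exact δ.opMap_act b (X : Pair k P) (Y : Pair k P)

theorem opTensMap_coact (x : BalTensor δ.esAct δ.esRight) :
    δ.pairMod.tensor.coact (δ.opTensMap x) = δ.opTensMap x ⊗ₜ 1 := by
  induction x using BalTensor.ind with
  | zero => simp
  | add x y hx hy => simp only [map_add, TensorProduct.add_tmul, hx, hy]
  | mk Y X => rw [opTensMap_mk, coact_opMap _ _ _ Y.2, X.2]; rfl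

/-- The isomorphism `𝓛 ⊗_B P ≃ P ⊗ P`, `(p ⊗ q) ⊗ r ↦ q r ⊗ p`. -/
noncomputable def esEquivOp (hE : Function.Bijective δ.esExtend) :
    BalTensor δ.esAct δ.lmulP ≃ₗ[k] P ⊗[k] P :=
  (esEquiv hE).trans (TensorProduct.comm k P P)

theorem esEquivOp_mk (hE : Function.Bijective δ.esExtend) (X : δ.ES) (p : P) :
    δ.esEquivOp hE (BalTensor.mk _ _ X p) =
      TensorProduct.comm k P P ((Pair.ofTensor k P).symm (Pair.tmul k 1 p * X)) := rfl

/-- Since (p ⊗ q) t(b) = p ⊗ b q, the action to be transported sits on the second leg. The flip in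
`esEquivOp` brings that leg to the front, where `collapseFun` expects it. -/
theorem esEquivOp_right (hE : Function.Bijective δ.esExtend) (b : δ.coinv) (X : δ.ES) (p : P) :
    δ.esEquivOp hE (BalTensor.mk _ _ (δ.esRight b X) p) =
      (δ.lmulP b).rTensor P (δ.esEquivOp hE (BalTensor.mk _ _ X p)) := by
  rw [esEquivOp_mk, esEquivOp_mk]
  change TensorProduct.comm k P P ((Pair.ofTensor k P).symm
    (Pair.tmul k 1 p * ((X : Pair k P) * δ.pairRing.t (op b)))) = _
  rw [← mul_assoc]
  generalize Pair.tmul k 1 p * (X : Pair k P) = Z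
  induction Z using Pair.induction with
  | zero => simp
  | add X Y hX hY => simp only [add_mul, map_add, hX, hY]
  | tmul a c => rw [pairRing_t, Pair.tmul_mul_tmul]; simp [Pair.tmul]

theorem rotate_extend (Y : δ.ES) (X : Pair k P) :
    rotate k P (δ.esExtend.rTensor P (BalTensor.insertLeft δ.esAct δ.lmulP P Y
      (TensorProduct.comm k P P ((Pair.ofTensor k P).symm X)))) = δ.opMap X (Y : Pair k P) := by
  induction X using Pair.induction with
  | zero => simp
  | add X Y hX hY => simp only [map_add, LinearMap.add_apply, hX, hY]
  | tmul p q => rw [opMap_tmul, Pair.tmul, LinearEquiv.symm_apply_apply]; rfl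

/-- The collapse argument with Y as left factor yields r ⊗ u q ⊗ p; `rotate` restores the order p ⊗
r ⊗ u q, for which the diagonal coaction is the right one. -/
theorem opTensMap_extend_bijective (hE : Function.Bijective δ.esExtend) : Function.Bijective
    (δ.pairMod.tensor.extend δ.opTensMap (ρ := δ.opTensAct) δ.opTensMap_act) := by
  have e : δ.pairMod.tensor.extend δ.opTensMap (ρ := δ.opTensAct) δ.opTensMap_act =
      ((LinearEquiv.rTensor P (LinearEquiv.ofBijective _ hE)).trans (rotate k P)).toLinearMap ∘ₗ
        BalTensor.collapseFun δ.esAct δ.esRight δ.esAct δ.lmulP δ.lmulP δ.esAct_esRight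
          (δ.esEquivOp hE) (δ.esEquivOp_right hE) := by
    refine BalTensor.hom_ext fun x p => ?_
    induction x using BalTensor.ind with
    | zero => simp
    | add x y hx hy => simp only [TensorProduct.add_tmul, map_add, hx, hy]
    | mk Y X =>
      exact ((δ.opMap_act p X Y).symm).trans (δ.rotate_extend Y (Pair.tmul k 1 p * X)).symm
  rw [e]
  exact ((LinearEquiv.rTensor P (LinearEquiv.ofBijective _ hE)).trans (rotate k P)).bijective.comp
    (BalTensor.collapseFun_bijective _ _ _ _ _ _ _ _)

theorem opTensMap_injective (hG : δ.IsHopfGalois)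
    (hP : IsFaithfullyFlatLeft.{max v w} k δ.coinv P) : Function.Injective δ.opTensMap :=
  injective_of_extend _ _ δ.opTensMap_act hP
    (IsRightAction.actRight (σ := δ.esRight) δ.esAct_esRight δ.esRing.isRightAction_t)
    (δ.opTensMap_extend_bijective (δ.esExtend_bijective hG hP)).1

theorem opTensMap_exact (hG : δ.IsHopfGalois)
    (hP : IsFaithfullyFlatLeft.{max v w} k δ.coinv P) :
    Function.Exact δ.opTensMap δ.pairMod.tensor.coactSub :=
  exact_of_extend _ _ δ.opTensMap_act hG hP
    (IsRightAction.actRight (σ := δ.esRight) δ.esAct_esRight δ.esRing.isRightAction_t)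
    δ.opTensMap_coact (δ.opTensMap_extend_bijective (δ.esExtend_bijective hG hP)).2

/-- The map `(P ⊗ P) ⊗_{Bᵒᵖ} (P ⊗ P) → P ⊗ P ⊗ P`, `(p ⊗ q) ⊗ (r ⊗ u) ↦ p ⊗ r ⊗ u q`. -/
noncomputable def pairOpMap : δ.pairRing.TensOp →ₗ[k] Pair k P ⊗[k] P :=
  BalTensor.lift₂ δ.opMap δ.opMap_balanced

theorem pairOpMap_inclTensOp (x : δ.esRing.TensOp) :
    δ.pairOpMap (δ.inclTensOp x) = δ.opTensMap (BalTensor.swap _ _ x) := by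
  induction x using BalTensor.ind with
  | zero => simp
  | add x y hx hy => simp only [map_add, hx, hy]
  | mk X Y => rfl

theorem pairOpMap_inclTensOp_injective (hG : δ.IsHopfGalois)
    (hP : IsFaithfullyFlatLeft.{max v w} k δ.coinv P) :
    Function.Injective (δ.pairOpMap ∘ δ.inclTensOp) := by
  rw [show δ.pairOpMap ∘ δ.inclTensOp = δ.opTensMap ∘ BalTensor.swap _ _ from
    funext δ.pairOpMap_inclTensOp]
  exact (δ.opTensMap_injective hG hP).comp (LinearEquiv.injective _)

end Op

/-! ### The coproduct as insertion of 1. -/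

section InsertOne

/-- The map `p ⊗ q ↦ p ⊗ 1 ⊗ q`. -/
noncomputable def insertOne (k : Type u) (P : Type w) [Field k] [Ring P] [Algebra k P] :
    Pair k P →ₗ[k] Pair k P ⊗[k] P :=
  ((Pair.ofTensor k P).toLinearMap ∘ₗ (TensorProduct.mk k P P).flip 1).rTensor P ∘ₗ
    (Pair.ofTensor k P).symm.toLinearMap

@[simp] theorem insertOne_tmul (p q : P) :
    insertOne k P (Pair.tmul k p q) = Pair.tmul k p 1 ⊗ₜ q := by
  simp [insertOne, Pair.tmul]

theorem coact_insertOne (X : Pair k P) : δ.pairMod.tensor.coact (insertOne k P X) =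
    (insertOne k P).rTensor H (δ.diagCoact X) := by
  induction X using Pair.induction with
  | zero => simp
  | add X Y hX hY => simp only [map_add, hX, hY]
  | tmul p q =>
    rw [insertOne_tmul, tensor_coact_tmul, pairMod_coact, diagCoact_tmul_one, diagCoact_tmul]
    generalize δ.coact p = x
    generalize δ.coact q = y
    induction x using TensorProduct.induction_on with
    | zero => simp
    | add x y hx hy => simp only [map_add, LinearMap.add_apply, TensorProduct.add_tmul, hx, hy]
    | tmul p h =>
    induction y using TensorProduct.induction_on with
    | zero => simp
    | add x y hx hy => simp only [map_add, TensorProduct.tmul_add, hx, hy]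
    | tmul q g =>
      rw [diagMerge_tmul, LinearMap.rTensor_tmul, LinearMap.rTensor_tmul, insertOne_tmul]
      rfl

theorem insertOne_act (q : P) (X : Pair k P) :
    insertOne k P (Pair.tmul k 1 q * X) = δ.pairMod.tensor.act q (insertOne k P X) := by
  induction X using Pair.induction with
  | zero => simp
  | add X Y hX hY => simp only [mul_add, map_add, hX, hY]
  | tmul r u => rw [Pair.tmul_mul_tmul, insertOne_tmul, insertOne_tmul, tensor_act_tmul, one_mul]

theorem insertOne_left (p : P) (X : Pair k P) : insertOne k P (Pair.tmul k p 1 * X) =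
    (LinearMap.mulLeft k (Pair.tmul k p 1)).rTensor P (insertOne k P X) := by
  induction X using Pair.induction with
  | zero => simp
  | add X Y hX hY => simp only [mul_add, map_add, hX, hY]
  | tmul r u => simp [Pair.tmul_mul_tmul]

/-- Inserting 1 commutes with the coaction, so an element of 𝓛 gives a coinvariant of P ⊗ P ⊗ P, and
such coinvariants come from 𝓛 ⊗_B 𝓛. -/
theorem insertOne_mem_range (hG : δ.IsHopfGalois)
    (hP : IsFaithfullyFlatLeft.{max v w} k δ.coinv P) (X : δ.ES) :
    insertOne k P (X : Pair k P) ∈ LinearMap.range δ.tensMap := by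
  refine (δ.tensMap_exact hG hP _).1 ?_
  rw [coactSub_apply, coact_insertOne, X.2, LinearMap.rTensor_tmul, sub_self]

/-- The coproduct of `𝓛`, determined by `p ⊗ q ↦ p ⊗ 1 ⊗ q` in `P ⊗ P ⊗ P`. -/
noncomputable def esComul (hG : δ.IsHopfGalois)
    (hP : IsFaithfullyFlatLeft.{max v w} k δ.coinv P) : δ.ES →ₗ[k] δ.esRing.Tens :=
  (LinearEquiv.ofInjective δ.tensMap (δ.tensMap_injective hG hP)).symm.toLinearMap ∘ₗ
    (insertOne k P ∘ₗ δ.esVal).codRestrict _ (δ.insertOne_mem_range hG hP)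

theorem tensMap_esComul (hG : δ.IsHopfGalois)
    (hP : IsFaithfullyFlatLeft.{max v w} k δ.coinv P) (X : δ.ES) :
    δ.tensMap (δ.esComul hG hP X) = insertOne k P (X : Pair k P) :=
  congrArg Subtype.val ((LinearEquiv.ofInjective δ.tensMap
    (δ.tensMap_injective hG hP)).apply_symm_apply ⟨_, δ.insertOne_mem_range hG hP X⟩)

end InsertOne

/-! ### The counit as multiplication. -/

section Counit

@[simp] theorem pairMul_tmul (p q : P) : pairMul k P (Pair.tmul k p q) = p * q := by
  simp [pairMul]

/-- The coaction of P is multiplicative, so multiplication is colinear for the diagonal coaction;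
hence it takes 𝓛 into B. -/
theorem coact_pairMul (X : Pair k P) :
    δ.coact (pairMul k P X) = (pairMul k P).rTensor H (δ.diagCoact X) := by
  induction X using Pair.induction with
  | zero => simp
  | add X Y hX hY => simp only [map_add, hX, hY]
  | tmul p q =>
    rw [pairMul_tmul, map_mul, diagCoact_tmul]
    generalize δ.coact p = x
    generalize δ.coact q = y
    induction x using TensorProduct.induction_on with
    | zero => simp
    | add x y hx hy => simp only [map_add, add_mul, TensorProduct.add_tmul, hx, hy]
    | tmul p h =>
    induction y using TensorProduct.induction_on with
    | zero => simp
    | add x y hx hy => simp only [map_add, mul_add, TensorProduct.tmul_add, hx, hy]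
    | tmul q g => simp [diagMerge_tmul]

theorem pairMul_mem (X : δ.ES) : pairMul k P (X : Pair k P) ∈ δ.coinv := by
  change δ.coact _ = _ ⊗ₜ 1
  rw [coact_pairMul, X.2, LinearMap.rTensor_tmul]

/-- The counit `p ⊗ q ↦ p q` of `𝓛`. -/
noncomputable def esCounit : δ.ES →ₗ[k] δ.coinv where
  toFun X := ⟨pairMul k P (X : Pair k P), δ.pairMul_mem X⟩
  map_add' X Y := Subtype.ext (map_add (pairMul k P) (X : Pair k P) (Y : Pair k P))
  map_smul' c X := Subtype.ext (map_smul (pairMul k P) c (X : Pair k P))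

theorem pairMul_left (p : P) (X : Pair k P) :
    pairMul k P (Pair.tmul k p 1 * X) = p * pairMul k P X := by
  induction X using Pair.induction with
  | zero => simp
  | add X Y hX hY => simp only [mul_add, map_add, hX, hY]
  | tmul r u => simp [Pair.tmul_mul_tmul, mul_assoc]

theorem pairMul_right (p : P) (X : Pair k P) :
    pairMul k P (Pair.tmul k 1 p * X) = pairMul k P X * p := by
  induction X using Pair.induction with
  | zero => simp
  | add X Y hX hY => simp only [mul_add, add_mul, map_add, hX, hY]
  | tmul r u => simp [Pair.tmul_mul_tmul, mul_assoc]

/-- For X = p ⊗ q and Y = r ⊗ u both sides are p r u q: left multiplication by X wraps p and q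
around the product of Y. -/
theorem pairMul_mul_s (X Y : Pair k P) :
    pairMul k P (X * Pair.tmul k (pairMul k P Y) 1) = pairMul k P (X * Y) := by
  induction X using Pair.induction with
  | zero => simp
  | add X Y hX hY => simp only [add_mul, map_add, hX, hY]
  | tmul p q =>
  induction Y using Pair.induction with
  | zero => simp [Pair.tmul]
  | add X Y hX hY => simp only [mul_add, map_add, Pair.add_tmul, hX, hY]
  | tmul r u => simp [Pair.tmul_mul_tmul, mul_assoc]

theorem pairMul_mul_t (X Y : Pair k P) :
    pairMul k P (X * Pair.tmul k 1 (pairMul k P Y)) = pairMul k P (X * Y) := by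
  induction X using Pair.induction with
  | zero => simp
  | add X Y hX hY => simp only [add_mul, map_add, hX, hY]
  | tmul p q =>
  induction Y using Pair.induction with
  | zero => simp [Pair.tmul]
  | add X Y hX hY => simp only [mul_add, map_add, Pair.tmul_add, hX, hY]
  | tmul r u => simp [Pair.tmul_mul_tmul, mul_assoc]

theorem esCounit_s (b : δ.coinv) (X : δ.ES) :
    δ.esCounit (δ.esRing.s b * X) = b * δ.esCounit X :=
  Subtype.ext (pairMul_left (b : P) (X : Pair k P))

theorem esCounit_t (b : δ.coinv) (X : δ.ES) :
    δ.esCounit (δ.esRing.t (op b) * X) = δ.esCounit X * b :=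
  Subtype.ext (pairMul_right (b : P) (X : Pair k P))

end Counit

/-! ### Products of 𝓛 ⊗_B 𝓛 in the coordinates P ⊗ P ⊗ P. -/

section Mul

/-- For `Y = a ⊗ c`, the map `(p ⊗ q) ⊗ r ↦ (p ⊗ q)X a ⊗ c r`. -/
noncomputable def mulTriple (X : Pair k P) : Pair k P →ₗ[k] Pair k P ⊗[k] P →ₗ[k] Pair k P ⊗[k] P :=
  Pair.lift ((TensorProduct.mapBilinear (.id k) (Pair k P) P (Pair k P) P).compl₁₂
    (LinearMap.lcomp k (Pair k P) (LinearMap.mulRight k X) ∘ₗ δ.pairMod.act) (LinearMap.mul k P))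

theorem mulTriple_tmul (X Z : Pair k P) (a c r : P) :
    δ.mulTriple X (Pair.tmul k a c) (Z ⊗ₜ r) = (Pair.tmul k 1 a * (Z * X)) ⊗ₜ (c * r) := by
  rw [mulTriple, Pair.lift_tmul]
  rfl

/-- `mulTriple` is the right action of 𝓛 ⊗ 𝓛 on 𝓛 ⊗_B 𝓛, expressed on P ⊗ P ⊗ P. -/
theorem mulTriple_pairAct (X Y Z W : Pair k P) :
    δ.mulTriple X Y (δ.pairMod.pairAct Z W) = δ.pairMod.pairAct (Z * X) (W * Y) := by
  induction W using Pair.induction with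
  | zero => simp
  | add X Y hX hY => simp only [add_mul, map_add, hX, hY]
  | tmul a c =>
  induction Y using Pair.induction with
  | zero => simp
  | add X Y hX hY => simp only [mul_add, map_add, LinearMap.add_apply, hX, hY]
  | tmul a' c' =>
    rw [pairAct_tmul, mulTriple_tmul, Pair.tmul_mul_tmul, pairAct_tmul, pairMod_act, pairMod_act,
      ← mul_assoc, ← mul_assoc, ← mul_assoc, Pair.tmul_mul_tmul, one_mul]

theorem tensMap_mulAct (x : δ.esRing.Tens) (X Y : δ.ES) :
    δ.tensMap (δ.esRing.mulAct x (X ⊗ₜ Y)) =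
      δ.mulTriple (X : Pair k P) (Y : Pair k P) (δ.tensMap x) := by
  induction x using BalTensor.ind with
  | zero => simp
  | add x y hx hy => simp only [map_add, LinearMap.add_apply, hx, hy]
  | mk Z W =>
    change δ.tensMap (δ.esRing.mulAct (δ.esRing.tmul Z W) _) =
      δ.mulTriple (X : Pair k P) (Y : Pair k P) (δ.tensMap (δ.esRing.tmul Z W))
    rw [BeRing.mulAct_tmul, tensMap_tmul, tensMap_tmul, mulTriple_pairAct]
    rfl

/-- The Takeuchi condition: for p ⊗ 1 ⊗ q, either side places b in the middle leg. -/
theorem mulTriple_t (b : δ.coinv) (X : Pair k P) :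
    δ.mulTriple (δ.pairRing.t (op b)) 1 (insertOne k P X) =
      δ.mulTriple 1 (δ.pairRing.s b) (insertOne k P X) := by
  induction X using Pair.induction with
  | zero => simp
  | add X Y hX hY => simp only [map_add, hX, hY]
  | tmul p q =>
    rw [insertOne_tmul, pairRing_t, pairRing_s, Pair.one_def, mulTriple_tmul, mulTriple_tmul]
    simp [Pair.tmul_mul_tmul]

/-- For `X = p ⊗ q`, the map `(r ⊗ m) ⊗ u ↦ (p r ⊗ m) ⊗ u q`. -/
noncomputable def outerMul (k : Type u) (P : Type w) [Field k] [Ring P] [Algebra k P] :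
    Pair k P →ₗ[k] Pair k P ⊗[k] P →ₗ[k] Pair k P ⊗[k] P :=
  Pair.lift ((TensorProduct.mapBilinear (.id k) (Pair k P) P (Pair k P) P).compl₁₂
    (LinearMap.mul k (Pair k P) ∘ₗ (Pair.ofTensor k P).toLinearMap ∘ₗ
      (TensorProduct.mk k P P).flip 1) (LinearMap.mul k P).flip)

theorem outerMul_tmul (p q u : P) (Z : Pair k P) :
    outerMul k P (Pair.tmul k p q) (Z ⊗ₜ u) = (Pair.tmul k p 1 * Z) ⊗ₜ (u * q) := by
  rw [outerMul, Pair.lift_tmul]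
  rfl

/-- Multiplying by a coproduct touches only the outer legs, as the middle leg of the coproduct is 1.
Multiplicativity of Δ and the shape of λ both follow from this. -/
theorem mulTriple_insertOne (X Y Z : Pair k P) : δ.mulTriple X Y (insertOne k P Z) =
    outerMul k P Z (δ.pairMod.pairAct X Y) := by
  induction Z using Pair.induction with
  | zero => simp
  | add X Y hX hY => simp only [map_add, LinearMap.add_apply, hX, hY]
  | tmul p q =>
  induction Y using Pair.induction with
  | zero => simp
  | add X Y hX hY => simp only [map_add, LinearMap.add_apply, hX, hY]
  | tmul a c =>
    rw [insertOne_tmul, mulTriple_tmul, pairAct_tmul, outerMul_tmul, pairMod_act, ← mul_assoc,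
      ← mul_assoc, Pair.tmul_mul_tmul, Pair.tmul_mul_tmul]
    simp

theorem outerMul_insertOne (X Y : Pair k P) :
    outerMul k P X (insertOne k P Y) = insertOne k P (X * Y) := by
  induction X using Pair.induction with
  | zero => simp
  | add X Y hX hY => simp only [add_mul, map_add, LinearMap.add_apply, hX, hY]
  | tmul p q =>
  induction Y using Pair.induction with
  | zero => simp
  | add X Y hX hY => simp only [mul_add, map_add, hX, hY]
  | tmul r u =>
    rw [insertOne_tmul, outerMul_tmul, Pair.tmul_mul_tmul, Pair.tmul_mul_tmul, insertOne_tmul,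
      one_mul]

/-- The left side is λ(X ⊗ Y) in coordinates and the right side is the embedding of 𝓛 ⊗_{Bᵒᵖ} 𝓛;
both are p ⊗ r ⊗ u q. -/
theorem outerMul_one (X Y : Pair k P) :
    outerMul k P X (δ.pairMod.pairAct 1 Y) = δ.opMap X Y := by
  induction X using Pair.induction with
  | zero => simp
  | add X Y hX hY => simp only [map_add, LinearMap.add_apply, hX, hY]
  | tmul p q =>
  induction Y using Pair.induction with
  | zero => simp
  | add X Y hX hY => simp only [map_add, hX, hY]
  | tmul r u =>
    rw [pairAct_tmul, outerMul_tmul, opMap_tmul, Pair.tmul_mul_tmul, rotateMap_tmul, pairMod_act,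
      mul_one, Pair.tmul_mul_tmul]
    simp

end Mul

/-! ### The bialgebroid axioms and bijectivity of λ. -/

section Coalgebra

variable (hG : δ.IsHopfGalois) (hP : IsFaithfullyFlatLeft.{max v w} k δ.coinv P)

theorem esComul_s (b : δ.coinv) (X : δ.ES) : δ.esComul hG hP (δ.esRing.s b * X) =
    δ.esRing.leftAct b (δ.esComul hG hP X) := by
  apply δ.tensMap_injective hG hP
  rw [tensMap_leftAct, tensMap_esComul, tensMap_esComul]
  exact insertOne_left (b : P) (X : Pair k P)

theorem esComul_t (b : δ.coinv) (X : δ.ES) : δ.esComul hG hP (δ.esRing.t (op b) * X) =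
    δ.esRing.rightAct b (δ.esComul hG hP X) := by
  apply δ.tensMap_injective hG hP
  rw [tensMap_rightAct, tensMap_esComul, tensMap_esComul]
  exact δ.insertOne_act (b : P) (X : Pair k P)

theorem tensLMap_comulLeft (x : δ.esRing.Tens) :
    δ.tensLMap (δ.esRing.comulLeft (δ.esComul hG hP) (δ.esComul_t hG hP) x) =
      (insertOne k P).rTensor P (δ.tensMap x) := by
  induction x using BalTensor.ind with
  | zero => simp
  | add x y hx hy => simp only [map_add, hx, hy]
  | mk X Y =>
    change δ.tensLMap (BalTensor.proj _ _ (δ.esComul hG hP X ⊗ₜ Y)) = (insertOne k P).rTensor P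
      (δ.pairMod.pairAct (X : Pair k P) (Y : Pair k P))
    rw [tensLMap_mk, tensMap_esComul]
    generalize (Y : Pair k P) = Z
    induction Z using Pair.induction with
    | zero => simp
    | add x y hx hy => simp only [map_add, hx, hy]
    | tmul a c =>
      rw [pairAct_tmul, pairAct_tmul, LinearMap.rTensor_tmul, pairMod_act, δ.insertOne_act]

theorem tensRMap_comulRight (x : δ.esRing.Tens) :
    δ.tensRMap (δ.esRing.comulRight (δ.esComul hG hP) (δ.esComul_s hG hP) x) =
      ((TensorProduct.mk k (Pair k P) P).flip 1).rTensor P (δ.tensMap x) := by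
  induction x using BalTensor.ind with
  | zero => simp
  | add x y hx hy => simp only [map_add, hx, hy]
  | mk X Y =>
    change δ.tensRMap (BalTensor.proj _ _ (X ⊗ₜ δ.esComul hG hP Y)) =
      ((TensorProduct.mk k (Pair k P) P).flip 1).rTensor P
        (δ.pairMod.pairAct (X : Pair k P) (Y : Pair k P))
    rw [tensRMap_mk, tensMap_esComul]
    generalize (Y : Pair k P) = Z
    induction Z using Pair.induction with
    | zero => simp
    | add x y hx hy => simp only [map_add, hx, hy]
    | tmul a c => simp

/-- Both iterated coproducts become p ⊗ 1 ⊗ 1 ⊗ q in the fourth tensor power, into which the triple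
product embeds. -/
theorem esComul_coassoc (X : δ.ES) :
    δ.esRing.assoc (δ.esRing.comulLeft (δ.esComul hG hP) (δ.esComul_t hG hP)
      (δ.esComul hG hP X)) =
    δ.esRing.comulRight (δ.esComul hG hP) (δ.esComul_s hG hP) (δ.esComul hG hP X) := by
  apply δ.tensRMap_injective hG hP
  rw [tensRMap_assoc, tensLMap_comulLeft, tensRMap_comulRight, tensMap_esComul]
  generalize (X : Pair k P) = X
  induction X using Pair.induction with
  | zero => simp
  | add x y hx hy => simp only [map_add, hx, hy]
  | tmul a c => simp

/-- In coordinates ε ⊗ id multiplies the first two legs; on p ⊗ 1 ⊗ q this gives back p ⊗ q.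
`counitRight_coe` does the same with the last two legs. -/
theorem counitLeft_coe (x : δ.esRing.Tens) :
    (δ.esRing.counitLeft δ.esCounit δ.esCounit_t x : Pair k P) =
      Pair.ofTensor k P ((pairMul k P).rTensor P (δ.tensMap x)) := by
  induction x using BalTensor.ind with
  | zero => simp
  | add x y hx hy => simp only [map_add, Subalgebra.coe_add, hx, hy]
  | mk X Y =>
    change Pair.tmul k (pairMul k P (X : Pair k P)) 1 * (Y : Pair k P) = Pair.ofTensor k P
      ((pairMul k P).rTensor P (δ.pairMod.pairAct (X : Pair k P) (Y : Pair k P)))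
    generalize (Y : Pair k P) = Z
    induction Z using Pair.induction with
    | zero => simp
    | add x y hx hy => simp only [mul_add, map_add, hx, hy]
    | tmul a c =>
      rw [pairAct_tmul, LinearMap.rTensor_tmul, pairMod_act, pairMul_right, Pair.tmul_mul_tmul,
        mul_one]
      rfl

theorem counitRight_coe (x : δ.esRing.Tens) :
    (δ.esRing.counitRight δ.esCounit δ.esCounit_s x : Pair k P) =
      TensorProduct.lift δ.pairMod.act.flip (δ.tensMap x) := by
  induction x using BalTensor.ind with
  | zero => simp
  | add x y hx hy => simp only [map_add, Subalgebra.coe_add, hx, hy]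
  | mk X Y =>
    change Pair.tmul k 1 (pairMul k P (Y : Pair k P)) * (X : Pair k P) =
      TensorProduct.lift δ.pairMod.act.flip (δ.pairMod.pairAct (X : Pair k P) (Y : Pair k P))
    generalize (Y : Pair k P) = Z
    induction Z using Pair.induction with
    | zero => simp [Pair.tmul]
    | add x y hx hy => simp only [map_add, Pair.tmul_add, add_mul, hx, hy]
    | tmul a c =>
      rw [pairAct_tmul, TensorProduct.lift.tmul, LinearMap.flip_apply, ← δ.pairMod.isRightMul.mul,
        pairMul_tmul, pairMod_act]

theorem counitLeft_esComul (X : δ.ES) :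
    δ.esRing.counitLeft δ.esCounit δ.esCounit_t (δ.esComul hG hP X) = X := by
  apply Subtype.ext
  rw [counitLeft_coe, tensMap_esComul]
  generalize (X : Pair k P) = X
  induction X using Pair.induction with
  | zero => simp
  | add x y hx hy => simp only [map_add, hx, hy]
  | tmul a c => rw [insertOne_tmul, LinearMap.rTensor_tmul, pairMul_tmul, mul_one, Pair.tmul]

theorem counitRight_esComul (X : δ.ES) :
    δ.esRing.counitRight δ.esCounit δ.esCounit_s (δ.esComul hG hP X) = X := by
  apply Subtype.ext
  rw [counitRight_coe, tensMap_esComul]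
  generalize (X : Pair k P) = X
  induction X using Pair.induction with
  | zero => simp
  | add x y hx hy => simp only [map_add, hx, hy]
  | tmul a c =>
    rw [insertOne_tmul, TensorProduct.lift.tmul, LinearMap.flip_apply, pairMod_act,
      Pair.tmul_mul_tmul, one_mul, one_mul]

theorem tensMap_mulAct_esComul (X Y Z : δ.ES) :
    δ.tensMap (δ.esRing.mulAct (δ.esComul hG hP X) (Y ⊗ₜ Z)) =
      outerMul k P (X : Pair k P) (δ.tensMap (δ.esRing.tmul Y Z)) := by
  rw [tensMap_mulAct, tensMap_esComul, mulTriple_insertOne, tensMap_tmul]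

theorem esComul_mem (X : δ.ES) : δ.esComul hG hP X ∈ δ.esRing.takeuchi := by
  intro b
  apply δ.tensMap_injective hG hP
  rw [tensMap_mulAct, tensMap_mulAct, tensMap_esComul]
  exact δ.mulTriple_t b (X : Pair k P)

theorem esComul_mul (X Y : δ.ES) : δ.esComul hG hP (X * Y) =
    δ.esRing.takeuchiMul ⟨δ.esComul hG hP X, δ.esComul_mem hG hP X⟩ (δ.esComul hG hP Y) := by
  apply δ.tensMap_injective hG hP
  have h : ∀ y, δ.tensMap (δ.esRing.takeuchiMul
      ⟨δ.esComul hG hP X, δ.esComul_mem hG hP X⟩ y) = outerMul k P (X : Pair k P) (δ.tensMap y) := by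
    intro y
    induction y using BalTensor.ind with
    | zero => simp
    | add x y hx hy => simp only [map_add, hx, hy]
    | mk Y Z => exact δ.tensMap_mulAct_esComul hG hP X Y Z
  rw [h, tensMap_esComul, tensMap_esComul, outerMul_insertOne]
  rfl

theorem esComul_one : δ.esComul hG hP 1 = δ.esRing.tmul 1 1 := by
  apply δ.tensMap_injective hG hP
  rw [tensMap_esComul, tensMap_tmul]
  change insertOne k P (Pair.tmul k 1 1) = δ.pairMod.pairAct 1 (Pair.tmul k 1 1)
  rw [insertOne_tmul, pairAct_tmul, δ.pairMod.isRightMul.one]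
  rfl

/-- The Ehresmann–Schauenburg bialgebroid. -/
noncomputable def esBialgebroid : LeftBialgebroid δ.esRing where
  comul := δ.esComul hG hP
  comul_s := δ.esComul_s hG hP
  comul_t := δ.esComul_t hG hP
  counit := δ.esCounit
  counit_s := δ.esCounit_s
  counit_t := δ.esCounit_t
  coassoc := δ.esComul_coassoc hG hP
  counit_comul := δ.counitLeft_esComul hG hP
  comul_counit := δ.counitRight_esComul hG hP
  comul_mem := δ.esComul_mem hG hP
  comul_one := δ.esComul_one hG hP
  comul_mul := δ.esComul_mul hG hP
  counit_one := Subtype.ext ((pairMul_tmul 1 1).trans (one_mul 1))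
  counit_mul_s X Y := Subtype.ext (pairMul_mul_s (X : Pair k P) (Y : Pair k P))
  counit_mul_t X Y := Subtype.ext (pairMul_mul_t (X : Pair k P) (Y : Pair k P))

theorem tensMap_galoisMap (x : δ.esRing.TensOp) :
    δ.tensMap ((δ.esBialgebroid hG hP).galoisMap x) = δ.opTensMap (BalTensor.swap _ _ x) := by
  induction x using BalTensor.ind with
  | zero => simp
  | add x y hx hy => simp only [map_add, hx, hy]
  | mk X Y =>
    exact (δ.tensMap_mulAct_esComul hG hP X 1 Y).trans
      (δ.outerMul_one (X : Pair k P) (Y : Pair k P))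

/-- By `tensMap_galoisMap`, λ intertwines two embeddings in P ⊗ P ⊗ P, each with image the
coinvariants. Injectivity of `opTensMap` gives injectivity of λ; exactness of `opTensMap` and
injectivity of `tensMap` give surjectivity. -/
theorem esBialgebroid_isLeftHopf : (δ.esBialgebroid hG hP).IsLeftHopf := by
  refine ⟨fun x y h => ?_, fun y => ?_⟩
  · replace h := congrArg δ.tensMap h
    rw [tensMap_galoisMap, tensMap_galoisMap] at h
    exact (BalTensor.swap _ _).injective (δ.opTensMap_injective hG hP h)
  · obtain ⟨x, hx⟩ := (δ.opTensMap_exact hG hP (δ.tensMap y)).1 (by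
      rw [coactSub_apply, tensMap_coact, sub_self])
    refine ⟨(BalTensor.swap _ _).symm x, δ.tensMap_injective hG hP ?_⟩
    rw [tensMap_galoisMap, LinearEquiv.apply_symm_apply, hx]

end Coalgebra

/-! ### Detecting the translation map through can. -/

/-- `(P ⊗ P) ⊗_B P`. -/
abbrev PairP : Type w := BalTensor (fun b : δ.coinv => δ.pairMod.act (b : P)) δ.lmulP

/-- The isomorphism `(P ⊗ P) ⊗_B P ≃ (P ⊗ P) ⊗ H`. -/
noncomputable def pairCan (hG : δ.IsHopfGalois) : δ.PairP ≃ₗ[k] Pair k P ⊗[k] H :=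
  LinearEquiv.ofBijective (δ.modCan δ.pairMod.isRightMul) (δ.modCan_bijective _ hG)

/-- The defining property of τ: X τ(h) corresponds to X ⊗ h. -/
theorem pairCan_modInsert (hG : δ.IsHopfGalois) (h : H) (X : Pair k P) :
    δ.pairCan hG (δ.modInsert δ.pairMod.isRightMul (δ.translation hG h) X) = X ⊗ₜ h := by
  change δ.modCan δ.pairMod.isRightMul _ = _
  rw [modCan_modInsert, can_translation, actTensor_tmul, δ.pairMod.isRightMul.one, one_mul]

theorem pairCan_mk (hG : δ.IsHopfGalois) (X : Pair k P) (hX : X ∈ δ.ES) (p : P) :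
    δ.pairCan hG (BalTensor.mk _ _ X p) = δ.pairMod.coact (δ.pairMod.act p X) := by
  change δ.modCan δ.pairMod.isRightMul _ = _
  rw [modCan_mk, coact_act, pairMod_coact, hX]

/-! ### The coproduct formula. -/

section Tens

/-- The map `X ⊗ (a ⊗ c) ↦ (X ⊗ a) ⊗ c`. -/
noncomputable def tensSplit : δ.pairRing.Tens →ₗ[k] δ.PairP ⊗[k] P :=
  BalTensor.lift₂ (LinearMap.lcomp k (δ.PairP ⊗[k] P) (Pair.ofTensor k P).symm.toLinearMap ∘ₗ
      BalTensor.insertLeft (fun b : δ.coinv => δ.pairMod.act (b : P)) δ.lmulP P) (by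
    intro b X Y
    change BalTensor.insertLeft (fun b : δ.coinv => δ.pairMod.act (b : P)) δ.lmulP P
      (δ.pairMod.act b X) ((Pair.ofTensor k P).symm Y) = BalTensor.insertLeft _ δ.lmulP P X
        ((Pair.ofTensor k P).symm (δ.pairRing.s b * Y))
    rw [ofTensor_symm_s_mul]
    exact BalTensor.insertLeft_balanced (fun b : δ.coinv => δ.pairMod.act (b : P)) δ.lmulP b X _)

theorem tensSplit_tmul (X : Pair k P) (a c : P) :
    δ.tensSplit (δ.pairRing.tmul X (Pair.tmul k a c)) = BalTensor.mk _ _ X a ⊗ₜ c := by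
  change BalTensor.insertLeft (fun b : δ.coinv => δ.pairMod.act (b : P)) δ.lmulP P X
    ((Pair.ofTensor k P).symm (Pair.tmul k a c)) = _
  rw [Pair.tmul, LinearEquiv.symm_apply_apply, BalTensor.insertLeft_tmul]

/-- The map `(X ⊗ a), c ↦ X ⊗ (a ⊗ c)`. -/
noncomputable def tensJoin : δ.PairP ⊗[k] P →ₗ[k] δ.pairRing.Tens :=
  TensorProduct.lift (BalTensor.lift₂ (Q := P →ₗ[k] δ.pairRing.Tens)
    ((LinearMap.llcomp k P (Pair k P) δ.pairRing.Tens).compl₁₂ (BalTensor.mkₗ _ _)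
      ((TensorProduct.mk k P P).compr₂ (Pair.ofTensor k P).toLinearMap)) (by
    intro b X a
    refine LinearMap.ext fun c => ?_
    have h := δ.pairRing.tmul_balanced b X (Pair.tmul k a c)
    rw [pairRing_s, Pair.tmul_mul_tmul, mul_one] at h
    exact h))

theorem tensJoin_tensSplit (x : δ.pairRing.Tens) : δ.tensJoin (δ.tensSplit x) = x := by
  induction x using BalTensor.ind with
  | zero => simp
  | add x y hx hy => simp only [map_add, hx, hy]
  | mk X Y =>
    change δ.tensJoin (δ.tensSplit (δ.pairRing.tmul X Y)) = δ.pairRing.tmul X Y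
    induction Y using Pair.induction with
    | zero => simp [BeRing.tmul]
    | add Y Z hY hZ =>
      have h : δ.pairRing.tmul X (Y + Z) = δ.pairRing.tmul X Y + δ.pairRing.tmul X Z := by
        simp [BeRing.tmul, TensorProduct.tmul_add]
      rw [h, map_add, map_add, hY, hZ]
    | tmul a c => rw [tensSplit_tmul]; rfl

/-- Unlike `pairTensMap`, this detects all of (P ⊗ P) ⊗_B (P ⊗ P): the balanced leg is kept and
converted into H by can, not multiplied away. -/
theorem rTensor_pairCan_tensSplit_injective (hG : δ.IsHopfGalois) :
    Function.Injective ((δ.pairCan hG).rTensor P ∘ δ.tensSplit) :=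
  (LinearEquiv.injective _).comp (Function.LeftInverse.injective δ.tensJoin_tensSplit)

/-- On elements coming from 𝓛 the finer invariant is determined by the image in P ⊗ P ⊗ P: as X is
coinvariant, X a₍₀₎ ⊗ a₍₁₎ is the coaction of X a. -/
theorem tensSplit_inclTens (hG : δ.IsHopfGalois) (x : δ.esRing.Tens) :
    (δ.pairCan hG).rTensor P (δ.tensSplit (δ.inclTens x)) =
      δ.pairMod.coact.rTensor P (δ.tensMap x) := by
  induction x using BalTensor.ind with
  | zero => simp
  | add x y hx hy => simp only [map_add, hx, hy]
  | mk X Y =>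
    change (δ.pairCan hG).rTensor P (δ.tensSplit
      (δ.pairRing.tmul (X : Pair k P) (Y : Pair k P))) =
        δ.pairMod.coact.rTensor P (δ.pairMod.pairAct (X : Pair k P) (Y : Pair k P))
    generalize (Y : Pair k P) = Y
    induction Y using Pair.induction with
    | zero => simp [BeRing.tmul]
    | add Y Z hY hZ =>
      have h : δ.pairRing.tmul (X : Pair k P) (Y + Z) =
          δ.pairRing.tmul (X : Pair k P) Y + δ.pairRing.tmul (X : Pair k P) Z := by
        simp [BeRing.tmul, TensorProduct.tmul_add]
      rw [h, map_add, map_add, map_add, map_add, hY, hZ]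
    | tmul a c =>
      rw [tensSplit_tmul, LinearEquiv.rTensor_tmul, pairCan_mk _ _ _ X.2, pairAct_tmul,
        LinearMap.rTensor_tmul]

theorem tensSplit_insertMid (z : δ.PBP) (p q : P) : δ.tensSplit (δ.insertMid z p q) =
    δ.modInsert δ.pairMod.isRightMul z (Pair.tmul k p 1) ⊗ₜ q := by
  induction z using BalTensor.ind with
  | zero => simp
  | add x y hx hy => simp only [map_add, LinearMap.add_apply, TensorProduct.add_tmul, hx, hy]
  | mk x y =>
    change δ.tensSplit (δ.pairRing.tmul (Pair.tmul k p x) (Pair.tmul k y q)) = _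
    rw [tensSplit_tmul, modInsert_mk, pairMod_act, Pair.tmul_mul_tmul, one_mul, one_mul]

/-- Applying can to τ(p₍₁₎) leaves (p₍₀₎ ⊗ 1) ⊗ p₍₁₎ ⊗ q, which is the coaction on the first two
legs of p ⊗ 1 ⊗ q. -/
theorem tensSplit_comulFormula (hG : δ.IsHopfGalois) (X : Pair k P) :
    (δ.pairCan hG).rTensor P (δ.tensSplit (δ.comulFormula hG X)) =
      δ.pairMod.coact.rTensor P (insertOne k P X) := by
  induction X using Pair.induction with
  | zero => simp
  | add x y hx hy => simp only [map_add, hx, hy]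
  | tmul p q =>
    rw [insertOne_tmul, LinearMap.rTensor_tmul, pairMod_coact, diagCoact_tmul_one, comulFormula,
      Pair.lift_tmul]
    change (δ.pairCan hG).rTensor P (δ.tensSplit
      (TensorProduct.lift (δ.insertMid ∘ₗ δ.translation hG).flip (δ.coact p) q)) = _
    generalize δ.coact p = x
    induction x using TensorProduct.induction_on with
    | zero => simp
    | add x y hx hy => simp only [map_add, LinearMap.add_apply, TensorProduct.add_tmul, hx, hy]
    | tmul p h =>
      change (δ.pairCan hG).rTensor P (δ.tensSplit (δ.insertMid (δ.translation hG h) p q)) = _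
      rw [tensSplit_insertMid, LinearEquiv.rTensor_tmul, pairCan_modInsert]
      rfl

theorem inclTens_esComul (hG : δ.IsHopfGalois)
    (hP : IsFaithfullyFlatLeft.{max v w} k δ.coinv P) (X : δ.ES) :
    δ.inclTens (δ.esComul hG hP X) = δ.comulFormula hG (X : Pair k P) := by
  apply δ.rTensor_pairCan_tensSplit_injective hG
  rw [Function.comp_apply, Function.comp_apply, tensSplit_inclTens, tensMap_esComul,
    tensSplit_comulFormula]

end Tens

/-! ### The formula for the inverse of λ. -/

section TensOp

/-- The map `p, q ↦ (Y ↦ (Y ⊗ q) ⊗ p)`. -/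
noncomputable def opSplitBi : Pair k P →ₗ[k] Pair k P →ₗ[k] δ.PairP ⊗[k] P :=
  Pair.lift (Q := Pair k P →ₗ[k] δ.PairP ⊗[k] P)
    (((LinearMap.llcomp k (Pair k P) δ.PairP (δ.PairP ⊗[k] P)).compl₁₂
    (TensorProduct.mk k δ.PairP P).flip
      (BalTensor.mkₗ (fun b : δ.coinv => δ.pairMod.act (b : P)) δ.lmulP).flip))

theorem opSplitBi_tmul (p q : P) (Y : Pair k P) :
    δ.opSplitBi (Pair.tmul k p q) Y = BalTensor.mk _ _ Y q ⊗ₜ p := by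
  rw [opSplitBi, Pair.lift_tmul]
  rfl

/-- The map `(p ⊗ q) ⊗ Y ↦ (Y ⊗ q) ⊗ p`. -/
noncomputable def opSplit : δ.pairRing.TensOp →ₗ[k] δ.PairP ⊗[k] P :=
  BalTensor.lift₂ δ.opSplitBi (by
    intro b X Y
    change δ.opSplitBi (X * δ.pairRing.t (op b)) Y = δ.opSplitBi X (δ.pairRing.t (op b) * Y)
    induction X using Pair.induction with
    | zero => simp
    | add x y hx hy => simp only [map_add, add_mul, LinearMap.add_apply, hx, hy]
    | tmul p q =>
      rw [pairRing_t, Pair.tmul_mul_tmul, mul_one, opSplitBi_tmul, opSplitBi_tmul]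
      exact congrArg (· ⊗ₜ p) (BalTensor.mk_balanced (fun b : δ.coinv => δ.pairMod.act (b : P))
        δ.lmulP b Y q).symm)

theorem opSplit_tmulOp (p q : P) (Y : Pair k P) :
    δ.opSplit (δ.pairRing.tmulOp (Pair.tmul k p q) Y) = BalTensor.mk _ _ Y q ⊗ₜ p :=
  δ.opSplitBi_tmul p q Y

/-- The map `(Y ⊗ q), p ↦ (p ⊗ q) ⊗ Y`. -/
noncomputable def opJoin : δ.PairP ⊗[k] P →ₗ[k] δ.pairRing.TensOp :=
  TensorProduct.lift (BalTensor.lift₂ (Q := P →ₗ[k] δ.pairRing.TensOp)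
    ((LinearMap.llcomp k P (Pair k P) δ.pairRing.TensOp).compl₁₂ (BalTensor.mkₗ _ _).flip
      ((TensorProduct.mk k P P).flip.compr₂ (Pair.ofTensor k P).toLinearMap)) (by
    intro b Y q
    refine LinearMap.ext fun p => ?_
    have h := δ.pairRing.tmulOp_balanced b (Pair.tmul k p q) Y
    rw [pairRing_t, Pair.tmul_mul_tmul, mul_one] at h
    exact h.symm))

theorem opJoin_opSplit (x : δ.pairRing.TensOp) : δ.opJoin (δ.opSplit x) = x := by
  induction x using BalTensor.ind with
  | zero => simp
  | add x y hx hy => simp only [map_add, hx, hy]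
  | mk X Y =>
    change δ.opJoin (δ.opSplit (δ.pairRing.tmulOp X Y)) = δ.pairRing.tmulOp X Y
    induction X using Pair.induction with
    | zero => simp [BeRing.tmulOp]
    | add X Z hX hZ =>
      have h : δ.pairRing.tmulOp (X + Z) Y = δ.pairRing.tmulOp X Y + δ.pairRing.tmulOp Z Y := by
        simp [BeRing.tmulOp, TensorProduct.add_tmul]
      rw [h, map_add, map_add, hX, hZ]
    | tmul p q => rw [opSplit_tmulOp]; rfl

theorem rTensor_pairCan_opSplit_injective (hG : δ.IsHopfGalois) :
    Function.Injective ((δ.pairCan hG).rTensor P ∘ δ.opSplit) :=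
  (LinearEquiv.injective _).comp (Function.LeftInverse.injective δ.opJoin_opSplit)

/-- Analogue of `tensSplit_inclTens`: here Y is the coinvariant factor acted on by q, and undoing
`rotate` exposes Y q as the first factor. -/
theorem opSplit_inclTensOp (hG : δ.IsHopfGalois) (x : δ.esRing.TensOp) :
    (δ.pairCan hG).rTensor P (δ.opSplit (δ.inclTensOp x)) =
      δ.pairMod.coact.rTensor P ((rotate k P).symm (δ.pairOpMap (δ.inclTensOp x))) := by
  induction x using BalTensor.ind with
  | zero => simp
  | add x y hx hy => simp only [map_add, hx, hy]
  | mk X Y =>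
    change (δ.pairCan hG).rTensor P (δ.opSplitBi (X : Pair k P) (Y : Pair k P)) =
      δ.pairMod.coact.rTensor P ((rotate k P).symm (δ.opMap (X : Pair k P) (Y : Pair k P)))
    generalize (X : Pair k P) = X
    induction X using Pair.induction with
    | zero => simp
    | add x y hx hy => simp only [map_add, LinearMap.add_apply, hx, hy]
    | tmul p q =>
      rw [opSplitBi_tmul, opMap_tmul, rotateMap_apply, LinearEquiv.symm_apply_apply,
        LinearEquiv.rTensor_tmul, pairCan_mk _ _ _ Y.2, LinearMap.rTensor_tmul, pairMod_act]

theorem opSplit_insertOp (z : δ.PBP) (p q : P) (Y : Pair k P) :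
    δ.opSplit (δ.pairRing.rmulOp Y (δ.insertOp z q p)) =
      δ.modInsert δ.pairMod.isRightMul z (Pair.tmul k q 1 * Y) ⊗ₜ p := by
  induction z using BalTensor.ind with
  | zero => simp
  | add x y hx hy => simp only [map_add, LinearMap.add_apply, TensorProduct.add_tmul, hx, hy]
  | mk x y =>
    change δ.opSplit (δ.pairRing.tmulOp (Pair.tmul k p y) (Pair.tmul k q x * Y)) = _
    rw [opSplit_tmulOp, modInsert_mk, pairMod_act, ← mul_assoc, Pair.tmul_mul_tmul, one_mul,
      one_mul]

theorem pairAct_eq_rotate (p q : P) (Y : Pair k P) :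
    δ.pairMod.pairAct (Pair.tmul k p q) Y = rotate k P ((Pair.tmul k q 1 * Y) ⊗ₜ p) := by
  induction Y using Pair.induction with
  | zero => simp
  | add x y hx hy => simp only [map_add, mul_add, TensorProduct.add_tmul, hx, hy]
  | tmul r u =>
    rw [pairAct_tmul, Pair.tmul_mul_tmul, rotate_tmul, pairMod_act, Pair.tmul_mul_tmul]
    simp

/-- Can turns (q₍₀₎ ⊗ τ¹(q₍₁₎)) Y ⊗ τ²(q₍₁₎) into (q₍₀₎ ⊗ 1) Y ⊗ q₍₁₎. Because Y is coinvariant,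
this is the coaction of (q ⊗ 1) Y, the part of p ⊗ q r ⊗ u other than p. -/
theorem opSplit_invFormula (hG : δ.IsHopfGalois) (X Y : Pair k P) (hY : Y ∈ δ.ES) :
    (δ.pairCan hG).rTensor P (δ.opSplit (δ.invFormula hG X Y)) =
      δ.pairMod.coact.rTensor P ((rotate k P).symm (δ.pairMod.pairAct X Y)) := by
  rw [invFormula]
  induction X using Pair.induction with
  | zero => simp
  | add x y hx hy => simp only [map_add, LinearMap.add_apply, hx, hy]
  | tmul p q =>
    rw [pairAct_eq_rotate, LinearEquiv.symm_apply_apply, LinearMap.rTensor_tmul, pairMod_coact,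
      diagCoact_tmul_mul, hY, map_one, Algebra.TensorProduct.one_def, transFormula, Pair.lift_tmul]
    change (δ.pairCan hG).rTensor P (δ.opSplit (δ.pairRing.rmulOp Y
      (TensorProduct.lift (δ.insertOp ∘ₗ δ.translation hG).flip (δ.coact q) p))) = _
    generalize δ.coact q = x
    induction x using TensorProduct.induction_on with
    | zero => simp
    | add x y hx hy => simp only [map_add, LinearMap.add_apply, TensorProduct.add_tmul, hx, hy]
    | tmul q h =>
      change (δ.pairCan hG).rTensor P (δ.opSplit (δ.pairRing.rmulOp Y
        (δ.insertOp (δ.translation hG h) q p))) = _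
      rw [opSplit_insertOp, LinearEquiv.rTensor_tmul, pairCan_modInsert, sandwich_tmul, one_mul,
        mul_one]

/-- Since λ is the identity in P ⊗ P ⊗ P, the preimage of X ⊗ Y has the coordinates of X ⊗ Y itself,
and by `opSplit_invFormula` these are what the formula yields. -/
theorem inclTensOp_galoisInv (hG : δ.IsHopfGalois)
    (hP : IsFaithfullyFlatLeft.{max v w} k δ.coinv P) (X Y : δ.ES) :
    δ.inclTensOp ((δ.esBialgebroid hG hP).galoisInv (δ.esBialgebroid_isLeftHopf hG hP)
      (δ.esRing.tmul X Y)) = δ.invFormula hG (X : Pair k P) (Y : Pair k P) := by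
  apply δ.rTensor_pairCan_opSplit_injective hG
  have h : (δ.esBialgebroid hG hP).galoisMap ((δ.esBialgebroid hG hP).galoisInv
      (δ.esBialgebroid_isLeftHopf hG hP) (δ.esRing.tmul X Y)) = δ.esRing.tmul X Y :=
    (LinearEquiv.ofBijective _ (δ.esBialgebroid_isLeftHopf hG hP)).apply_symm_apply _
  rw [Function.comp_apply, Function.comp_apply, opSplit_inclTensOp, opSplit_invFormula _ _ _ _ Y.2,
    pairOpMap_inclTensOp, ← δ.tensMap_galoisMap hG hP, h, tensMap_tmul]

end TensOp

end RightComoduleAlgebra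

/-! ### Assembly of the three statements. -/

theorem mainTheorem1 {k : Type u} {H : Type v} {P : Type w} [Field k] [Ring H] [HopfAlgebra k H]
    [Ring P] [Algebra k P] (δ : RightComoduleAlgebra k H P) (hG : δ.IsHopfGalois)
    (hP : IsFaithfullyFlatLeft.{max v w} k δ.coinv P) :
    Function.Injective δ.inclTens ∧ Function.Injective δ.inclTensOp ∧
    ∃ 𝓛 : LeftBialgebroid δ.esRing,
      (∀ X : δ.ES, δ.inclTens (𝓛.comul X) = δ.comulFormula hG (X : Pair k P)) ∧
      (∀ X : δ.ES, (𝓛.counit X : P) =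
        RightComoduleAlgebra.pairMul k P (X : Pair k P)) ∧
      ∃ hL : 𝓛.IsLeftHopf, ∀ X Y : δ.ES,
        δ.inclTensOp (𝓛.galoisInv hL (δ.esRing.tmul X Y)) =
          δ.invFormula hG (X : Pair k P) (Y : Pair k P) :=
  ⟨δ.inclTens_injective hG hP,
    Function.Injective.of_comp (δ.pairOpMap_inclTensOp_injective hG hP),
    δ.esBialgebroid hG hP, δ.inclTens_esComul hG hP, fun _ => rfl,
    δ.esBialgebroid_isLeftHopf hG hP, δ.inclTensOp_galoisInv hG hP⟩
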